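/- Let $\Omega\subset\mathbb{R}^2$ be the whole plane $\mathbb{R}^2$, the half-plane $\{y>0\}$, or a sector $\{(r\cos\theta,r\sin\theta):\ \alpha<\theta<\beta,\ 0<r<\infty\}$ with $0\le\alpha<\beta\le 2\pi$. Let $u\in C^3(\Omega;\mathbb{R}^2)\cap C^0(\overline\Omega;\mathbb{R}^2)$ and $p\in C^1(\Omega)$ solve the steady Navier–Stokes equations $$-\Delta u+u\cdot\nabla u+\nabla p=0,\qquad \operatorname{div}u=0\qquad\text{in }\Omega,$$ and suppose that in polar coordinates $x=r\cos\theta$, $y=r\sin\theta$ ($r>0$, $0\le\theta<2\pi$) $u$ has the separated form $$u(x,y)=\bigl(v_1(\theta)\varphi_1(r),\ v_2(\theta)\varphi_2(r)\bigr)\qquad\text{in }\Omega .$$ Then there are real constants $C_1,C_2,\dots$ such that $(u,p)$ is, in $\Omega$, of one of the following forms: (i) $u=(C_1,C_2)$, $p=C_3$; (ii) $u=(C_1x+C_2y,\ C_3x-C_1y)$, $p=-\tfrac12(C_1^2+C_2C_3)(x^2+y^2)+C_4$; (iii) $u=\bigl((C_2+C_3)x^2+(3C_2-C_3)y^2+2(C_1+C_4)xy,\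 (C_4-3C_1)x^2-(C_1+C_4)y^2-2(C_2+C_3)xy\bigr)$, $p=\tfrac12(C_1^2+C_2^2-C_3^2-C_4^2)(x^2+y^2)^2+8C_2x-8C_1y+C_5$, where $C_1C_3+C_2C_4-2C_1C_2=0$ and $C_1C_4-C_2C_3+C_1^2-C_2^2=0$; (iv) $u=r^\lambda\bigl(C_1\cos(\lambda\theta)+C_2\sin(\lambda\theta),\ C_2\cos(\lambda\theta)-C_1\sin(\lambda\theta)\bigr)$, $p=-\tfrac12(C_1^2+C_2^2)r^{2\lambda}+C_3$, where $\lambda\ge3$ is an integer if $\Omega=\mathbb{R}^2$, and $\lambda\in(0,1)\cup(1,2)\cup(2,\infty)$ otherwise; (v) (only if $\Omega\ne\mathbb{R}^2$) $u=(C_1+C_2\ln r)(-y,x)$, $p=\tfrac12r^2\bigl[C_2^2\ln^2r+(2C_1C_2-C_2^2)\ln r+C_1^2-C_1C_2+\tfrac12C_2^2\bigr]+2C_2\theta+C_3$; (vi) $u=(C_1,\ C_2x)$, $p=-C_1C_2y+C_3$; (vii) $u=(C_1y,\ C_2)$, $p=-C_1C_2x+C_3$. -/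

import Mathlib

open scoped Laplacian Gradient

namespace SteadyNS

noncomputable section

/-- The Euclidean plane `ℝ²`; the Cartesian coordinates of `z` are `x = z 0` and `y = z 1`. -/
abbrev Plane : Type := EuclideanSpace ℝ (Fin 2)

/-- The point with polar coordinates `(r, θ)`. -/
def polar (r θ : ℝ) : Plane := !₂[r * Real.cos θ, r * Real.sin θ]

/-- The open sector `α < θ < β`, `0 < r < ∞`. -/
def sector (α β : ℝ) : Set Plane :=
  {z | ∃ r θ : ℝ, 0 < r ∧ α < θ ∧ θ < β ∧ z = polar r θ}

/-- The admissible domains: the whole plane, the half-plane `y > 0`, and the sectors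
with `0 ≤ α < β ≤ 2π`. -/
def IsConeLike (Ω : Set Plane) : Prop :=
  Ω = Set.univ ∨ Ω = {z : Plane | 0 < z 1} ∨
    ∃ α β : ℝ, 0 ≤ α ∧ α < β ∧ β ≤ 2 * Real.pi ∧ Ω = sector α β

/-- The divergence of a planar vector field. -/
def divergence (u : Plane → Plane) (z : Plane) : ℝ :=
  ∑ i : Fin 2, fderiv ℝ u z (EuclideanSpace.single i 1) i

/-- `(u, p)` solves the steady Navier-Stokes equations
`-Δu + u·∇u + ∇p = 0`, `div u = 0` pointwise in `Ω`; here `u·∇u` at `z` is the derivative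
of `u` at `z` in the direction `u z`. -/
structure IsSolution (Ω : Set Plane) (u : Plane → Plane) (p : Plane → ℝ) : Prop where
  momentum : ∀ z ∈ Ω, -(Δ u z) + fderiv ℝ u z (u z) + ∇ p z = 0
  incompressible : ∀ z ∈ Ω, divergence u z = 0

/-- The separated form `u = (v₁(θ) φ₁(r), v₂(θ) φ₂(r))` in `Ω`, away from the origin
(where polar coordinates are not defined). No regularity of the factors is required. -/
def HasSeparatedForm (Ω : Set Plane) (u : Plane → Plane) : Prop :=
  ∃ v₁ v₂ φ₁ φ₂ : ℝ → ℝ, ∀ r θ : ℝ, 0 < r → 0 ≤ θ → θ < 2 * Real.pi → polar r θ ∈ Ω →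
    u (polar r θ) = !₂[v₁ θ * φ₁ r, v₂ θ * φ₂ r]

/-- Type (i): constants. -/
def TypeI (Ω : Set Plane) (u : Plane → Plane) (p : Plane → ℝ) : Prop :=
  ∃ C₁ C₂ C₃ : ℝ, ∀ z ∈ Ω, u z = !₂[C₁, C₂] ∧ p z = C₃

/-- Type (ii): linear fields. -/
def TypeII (Ω : Set Plane) (u : Plane → Plane) (p : Plane → ℝ) : Prop :=
  ∃ C₁ C₂ C₃ C₄ : ℝ, ∀ z ∈ Ω,
    u z = !₂[C₁ * z 0 + C₂ * z 1, C₃ * z 0 - C₁ * z 1] ∧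
    p z = -(1 / 2) * (C₁ ^ 2 + C₂ * C₃) * (z 0 ^ 2 + z 1 ^ 2) + C₄

/-- Type (iii): quadratic fields. -/
def TypeIII (Ω : Set Plane) (u : Plane → Plane) (p : Plane → ℝ) : Prop :=
  ∃ C₁ C₂ C₃ C₄ C₅ : ℝ,
    C₁ * C₃ + C₂ * C₄ - 2 * C₁ * C₂ = 0 ∧
    C₁ * C₄ - C₂ * C₃ + C₁ ^ 2 - C₂ ^ 2 = 0 ∧
    ∀ z ∈ Ω,
      u z = !₂[(C₂ + C₃) * z 0 ^ 2 + (3 * C₂ - C₃) * z 1 ^ 2 + 2 * (C₁ + C₄) * (z 0 * z 1),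
        (C₄ - 3 * C₁) * z 0 ^ 2 - (C₁ + C₄) * z 1 ^ 2 - 2 * (C₂ + C₃) * (z 0 * z 1)] ∧
      p z = 1 / 2 * (C₁ ^ 2 + C₂ ^ 2 - C₃ ^ 2 - C₄ ^ 2) * (z 0 ^ 2 + z 1 ^ 2) ^ 2
        + 8 * C₂ * z 0 - 8 * C₁ * z 1 + C₅

/-- Type (iv): irrotational homogeneous fields of degree `lam`, with `lam ≥ 3` an integer in the
whole plane, and `lam ∈ (0,1) ∪ (1,2) ∪ (2,∞)` otherwise. -/
def TypeIV (Ω : Set Plane) (u : Plane → Plane) (p : Plane → ℝ) : Prop :=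
  ∃ C₁ C₂ C₃ lam : ℝ,
    (Ω = Set.univ → ∃ n : ℕ, 3 ≤ n ∧ lam = n) ∧
    (Ω ≠ Set.univ → lam ∈ Set.Ioo (0 : ℝ) 1 ∪ Set.Ioo (1 : ℝ) 2 ∪ Set.Ioi (2 : ℝ)) ∧
    ∀ r θ : ℝ, 0 ≤ r → 0 ≤ θ → θ < 2 * Real.pi → polar r θ ∈ Ω →
      u (polar r θ) = r ^ lam • !₂[C₁ * Real.cos (lam * θ) + C₂ * Real.sin (lam * θ),
        C₂ * Real.cos (lam * θ) - C₁ * Real.sin (lam * θ)] ∧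
      p (polar r θ) = -(1 / 2) * (C₁ ^ 2 + C₂ ^ 2) * r ^ (2 * lam) + C₃

/-- Type (v): rotating fields with a logarithm; only if `Ω` is not the whole plane. -/
def TypeV (Ω : Set Plane) (u : Plane → Plane) (p : Plane → ℝ) : Prop :=
  Ω ≠ Set.univ ∧ ∃ C₁ C₂ C₃ : ℝ,
    ∀ r θ : ℝ, 0 < r → 0 ≤ θ → θ < 2 * Real.pi → polar r θ ∈ Ω →
      u (polar r θ) = (C₁ + C₂ * Real.log r) • !₂[-(r * Real.sin θ), r * Real.cos θ] ∧
      p (polar r θ) = 1 / 2 * r ^ 2 * (C₂ ^ 2 * Real.log r ^ 2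
        + (2 * C₁ * C₂ - C₂ ^ 2) * Real.log r + C₁ ^ 2 - C₁ * C₂ + 1 / 2 * C₂ ^ 2)
        + 2 * C₂ * θ + C₃

/-- The shear family `u = (C₁, C₂ x)`. -/
def ShearX (Ω : Set Plane) (u : Plane → Plane) (p : Plane → ℝ) : Prop :=
  ∃ C₁ C₂ C₃ : ℝ, ∀ z ∈ Ω, u z = !₂[C₁, C₂ * z 0] ∧ p z = -C₁ * C₂ * z 1 + C₃

/-- The shear family `u = (C₁ y, C₂)`. -/
def ShearY (Ω : Set Plane) (u : Plane → Plane) (p : Plane → ℝ) : Prop :=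
  ∃ C₁ C₂ C₃ : ℝ, ∀ z ∈ Ω, u z = !₂[C₁ * z 1, C₂] ∧ p z = -C₁ * C₂ * z 0 + C₃

end

end SteadyNS

/-! In the variables `t = log r` and `θ`, the frame `logPolar`, `logPolarPerp` has
constant-coefficient calculus: `r² Δ = ∂ₜₜ + ∂_θθ`. Cross differentiation removes the pressure, so a
separated field `(v(θ) φ(t), w(θ) χ(t))` is governed by two scalar identities, incompressibility and
the vorticity equation. A third piece of information is that `φ` and `χ` converge as `t → -∞`,
because `u` is continuous at the vertex; this excludes every mode that blows up there.

If the radial factors are linearly dependent, they may be taken equal (`dependent_classified`).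
Either the radial velocity vanishes, or incompressibility at one angle makes the factor an
exponential `exp (lam t)`. For `lam > 0` the viscous and convective terms then carry different
powers of `r` and vanish separately: the vorticity is harmonic and is transported by the flow.
`homogeneous_profiles` solves this. The vorticity is zero, or constant in degree one, or a linear
function in degree two, the last being a parabolic shear flow.

If the radial factors are independent (`independent_classified`), incompressibility at two angles
usually expresses `φ'` and `χ'` through `φ` and `χ` by a constant matrix. The vorticity equation at
a fixed angle then equates a linear form in `(φ, χ)` with `exp t` times a quadratic form. Applying
the characteristic polynomial of the matrix kills the linear side, and the quadratic form that is
left must vanish identically (`balance_consequences`). With `triangular_false` this forces a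
diagonal matrix, and the exponents can only be `0` and `1`, which gives the two shear flows. The
remaining possibility, proportional angular coefficients, leads to the field `(P(t) sin θ, X(t) cos
θ)` of `swirl_classified`; this is where the logarithm comes from. The same lemma handles the
dependent case with vanishing radial velocity.

The pressure follows by integrating its gradient. The half-plane is a sector, and the whole plane is
treated as the slit plane `sector 0 (2π)`: continuity across the slit removes the logarithm and
makes the degree in (iv) an integer. -/

namespace SteadyNS

open Set Filter Topology

/-! ### Logarithmic polar coordinates -/

/-- The point with logarithmic polar coordinates `(t, θ)`, i.e. with radius `exp t`. -/
noncomputable def logPolar (t θ : ℝ) : Plane := polar (Real.exp t) θ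

/-- Rotation of `logPolar t θ` by a right angle. -/
noncomputable def logPolarPerp (t θ : ℝ) : Plane :=
  !₂[-(Real.exp t * Real.sin θ), Real.exp t * Real.cos θ]

lemma hasDerivAt_plane {f g : ℝ → ℝ} {f' g' x : ℝ} (hf : HasDerivAt f f' x)
    (hg : HasDerivAt g g' x) :
    HasDerivAt (fun y => (!₂[f y, g y] : Plane)) !₂[f', g'] x := by
  have h : HasDerivAt (fun y => (![f y, g y] : Fin 2 → ℝ)) ![f', g'] x := by
    rw [hasDerivAt_pi]
    intro i
    fin_cases i
    · exact hf
    · exact hg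
  exact ((PiLp.continuousLinearEquiv 2 ℝ (fun _ : Fin 2 => ℝ)).symm.hasFDerivAt.comp_hasDerivAt
    x h)

lemma hasDerivAt_logPolar_left (t θ : ℝ) :
    HasDerivAt (fun τ => logPolar τ θ) (logPolar t θ) t := by
  unfold logPolar polar
  exact hasDerivAt_plane ((Real.hasDerivAt_exp t).mul_const _) ((Real.hasDerivAt_exp t).mul_const _)

lemma hasDerivAt_logPolar_right (t θ : ℝ) :
    HasDerivAt (fun η => logPolar t η) (logPolarPerp t θ) θ := by
  unfold logPolar polar logPolarPerp
  refine hasDerivAt_plane ?_ ((Real.hasDerivAt_sin θ).const_mul _)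
  simpa using (Real.hasDerivAt_cos θ).const_mul (Real.exp t)

lemma hasDerivAt_logPolarPerp_right (t θ : ℝ) :
    HasDerivAt (fun η => logPolarPerp t η) (-logPolar t θ) θ := by
  have h : (-logPolar t θ) = !₂[-(Real.exp t * Real.cos θ), Real.exp t * -Real.sin θ] := by
    ext i; fin_cases i <;> simp [logPolar, polar]
  rw [h]
  unfold logPolarPerp
  exact hasDerivAt_plane ((Real.hasDerivAt_sin θ).const_mul _).neg
    ((Real.hasDerivAt_cos θ).const_mul _)

lemma hasDerivAt_apply {f : ℝ → Plane} {f' : Plane} {x : ℝ} (hf : HasDerivAt f f' x) (i : Fin 2) :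
    HasDerivAt (fun y => f y i) (f' i) x :=
  (EuclideanSpace.proj (𝕜 := ℝ) i).hasFDerivAt.comp_hasDerivAt x hf

section Curves

variable {Ω : Set Plane} {u : Plane → Plane}

lemma hasDerivAt_along (hΩ : IsOpen Ω) (hu : ContDiffOn ℝ 3 u Ω) {γ : ℝ → Plane} {γ' : Plane}
    {x : ℝ} (hγ : HasDerivAt γ γ' x) (hx : γ x ∈ Ω) :
    HasDerivAt (fun y => u (γ y)) (fderiv ℝ u (γ x) γ') x := by
  have h1 : DifferentiableAt ℝ u (γ x) :=
    (hu.differentiableOn (by norm_num)).differentiableAt (hΩ.mem_nhds hx)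
  exact h1.hasFDerivAt.comp_hasDerivAt x hγ

lemma hasDerivAt_fderiv_along (hΩ : IsOpen Ω) (hu : ContDiffOn ℝ 3 u Ω) {γ γ' : ℝ → Plane}
    {γ'' : Plane} {x : ℝ} (hγ : HasDerivAt γ (γ' x) x) (hγ' : HasDerivAt γ' γ'' x)
    (hx : γ x ∈ Ω) :
    HasDerivAt (fun y => fderiv ℝ u (γ y) (γ' y))
      (fderiv ℝ (fderiv ℝ u) (γ x) (γ' x) (γ' x) + fderiv ℝ u (γ x) γ'') x := by
  have h1 : DifferentiableAt ℝ (fderiv ℝ u) (γ x) :=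
    ((hu.fderiv_of_isOpen (m := 2) hΩ (by norm_num)).differentiableOn
      (by norm_num)).differentiableAt (hΩ.mem_nhds hx)
  exact (h1.hasFDerivAt.comp_hasDerivAt x hγ).clm_apply hγ'

/-- The two vectors are `exp t` times an orthonormal frame, and the trace of the second derivative
is the same in every orthonormal frame. The mixed terms cancel one by one, so symmetry of the second
derivative is not needed. -/
lemma laplacian_logPolar (t θ : ℝ) :
    fderiv ℝ (fderiv ℝ u) (logPolar t θ) (logPolar t θ) (logPolar t θ) +
      fderiv ℝ (fderiv ℝ u) (logPolar t θ) (logPolarPerp t θ) (logPolarPerp t θ) =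
      (Real.exp t ^ 2) • Δ u (logPolar t θ) := by
  rw [InnerProductSpace.laplacian_eq_iteratedFDeriv_orthonormalBasis u
    (EuclideanSpace.basisFun (Fin 2) ℝ)]
  simp only [Fin.sum_univ_two, iteratedFDeriv_two_apply]
  set D := fderiv ℝ (fderiv ℝ u) (logPolar t θ)
  have e1 : logPolar t θ = (Real.exp t * Real.cos θ) • EuclideanSpace.basisFun (Fin 2) ℝ 0 +
      (Real.exp t * Real.sin θ) • EuclideanSpace.basisFun (Fin 2) ℝ 1 := by
    ext i; fin_cases i <;> simp [logPolar, polar]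
  have e2 : logPolarPerp t θ = (-(Real.exp t * Real.sin θ)) • EuclideanSpace.basisFun (Fin 2) ℝ 0 +
      (Real.exp t * Real.cos θ) • EuclideanSpace.basisFun (Fin 2) ℝ 1 := by
    ext i; fin_cases i <;> simp [logPolarPerp]
  rw [e1, e2]
  simp only [map_add, map_smul, add_apply, smul_apply,
    Matrix.cons_val_zero, Matrix.cons_val_one]
  have hcs := Real.sin_sq_add_cos_sq θ
  generalize D (EuclideanSpace.basisFun (Fin 2) ℝ 0) (EuclideanSpace.basisFun (Fin 2) ℝ 0) = a
  generalize D (EuclideanSpace.basisFun (Fin 2) ℝ 0) (EuclideanSpace.basisFun (Fin 2) ℝ 1) = b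
  generalize D (EuclideanSpace.basisFun (Fin 2) ℝ 1) (EuclideanSpace.basisFun (Fin 2) ℝ 0) = c
  generalize D (EuclideanSpace.basisFun (Fin 2) ℝ 1) (EuclideanSpace.basisFun (Fin 2) ℝ 1) = d
  ext i
  simp only [PiLp.add_apply, PiLp.smul_apply, smul_eq_mul]
  linear_combination (Real.exp t ^ 2 * (a i + d i)) * hcs

end Curves

/-! ### The Navier–Stokes equations in logarithmic polar coordinates -/

/-- The partial derivatives, up to second order, in logarithmic polar coordinates of a function
of `(t, θ)`, for angles in the interval `(α, β)`. -/
structure HasPolarPartials (α β : ℝ) (F Ft Ftt Fθ Fθθ : ℝ → ℝ → ℝ) : Prop where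
  dt : ∀ t, ∀ θ ∈ Ioo α β, HasDerivAt (fun τ => F τ θ) (Ft t θ) t
  dtt : ∀ t, ∀ θ ∈ Ioo α β, HasDerivAt (fun τ => Ft τ θ) (Ftt t θ) t
  dθ : ∀ t, ∀ θ ∈ Ioo α β, HasDerivAt (fun η => F t η) (Fθ t θ) θ
  dθθ : ∀ t, ∀ θ ∈ Ioo α β, HasDerivAt (fun η => Fθ t η) (Fθθ t θ) θ

section Equations

variable {Ω : Set Plane} {u : Plane → Plane} {p : Plane → ℝ} {α β : ℝ}
  {F Ft Ftt Fθ Fθθ G Gt Gtt Gθ Gθθ : ℝ → ℝ → ℝ}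

/-- The second derivative along a ray contributes an extra `Du(logPolar)`, and the one along a
circle an extra `Du(-logPolar)`. These cancel, which is why no first-order term accompanies `∂ₜₜ +
∂_θθ`. -/
lemma partials_eq (hΩ : IsOpen Ω) (hu : ContDiffOn ℝ 3 u Ω)
    (hmem : ∀ t, ∀ θ ∈ Ioo α β, logPolar t θ ∈ Ω) (i : Fin 2)
    (hF : HasPolarPartials α β F Ft Ftt Fθ Fθθ)
    (huF : ∀ t, ∀ θ ∈ Ioo α β, u (logPolar t θ) i = F t θ) {t θ : ℝ} (hθ : θ ∈ Ioo α β) :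
    fderiv ℝ u (logPolar t θ) (logPolar t θ) i = Ft t θ ∧
    fderiv ℝ u (logPolar t θ) (logPolarPerp t θ) i = Fθ t θ ∧
    Real.exp t ^ 2 * Δ u (logPolar t θ) i = Ftt t θ + Fθθ t θ := by
  have ht : ∀ t, ∀ θ ∈ Ioo α β, fderiv ℝ u (logPolar t θ) (logPolar t θ) i = Ft t θ := by
    intro t θ hθ
    have h1 := hasDerivAt_apply (hasDerivAt_along hΩ hu (hasDerivAt_logPolar_left t θ)
      (hmem t θ hθ)) i
    have h2 : (fun τ => u (logPolar τ θ) i) = fun τ => F τ θ := funext fun τ => huF τ θ hθ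
    rw [h2] at h1
    exact h1.unique (hF.dt t θ hθ)
  have hθ' : ∀ t, ∀ θ ∈ Ioo α β, fderiv ℝ u (logPolar t θ) (logPolarPerp t θ) i = Fθ t θ := by
    intro t θ hθ
    have h1 := hasDerivAt_apply (hasDerivAt_along hΩ hu (hasDerivAt_logPolar_right t θ)
      (hmem t θ hθ)) i
    have h2 : (fun η => u (logPolar t η) i) =ᶠ[𝓝 θ] fun η => F t η := by
      filter_upwards [isOpen_Ioo.mem_nhds hθ] with η hη using huF t η hη
    exact h1.unique ((hF.dθ t θ hθ).congr_of_eventuallyEq h2)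
  refine ⟨ht t θ hθ, hθ' t θ hθ, ?_⟩
  have a1 := hasDerivAt_apply (hasDerivAt_fderiv_along hΩ hu (hasDerivAt_logPolar_left t θ)
    (hasDerivAt_logPolar_left t θ) (hmem t θ hθ)) i
  have a2 : (fun τ => fderiv ℝ u (logPolar τ θ) (logPolar τ θ) i) = fun τ => Ft τ θ :=
    funext fun τ => ht τ θ hθ
  rw [a2] at a1
  have a3 := a1.unique (hF.dtt t θ hθ)
  have b1 := hasDerivAt_apply (hasDerivAt_fderiv_along hΩ hu (hasDerivAt_logPolar_right t θ)
    (hasDerivAt_logPolarPerp_right t θ) (hmem t θ hθ)) i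
  have b2 : (fun η => fderiv ℝ u (logPolar t η) (logPolarPerp t η) i) =ᶠ[𝓝 θ] fun η => Fθ t η := by
    filter_upwards [isOpen_Ioo.mem_nhds hθ] with η hη using hθ' t η hη
  have b3 := b1.unique ((hF.dθθ t θ hθ).congr_of_eventuallyEq b2)
  have hl := congrArg (fun w : Plane => w i) (laplacian_logPolar (u := u) t θ)
  simp only [PiLp.add_apply, PiLp.smul_apply, smul_eq_mul, map_neg, PiLp.neg_apply] at hl a3 b3
  linarith

lemma single_zero_eq (t θ : ℝ) : (EuclideanSpace.single 0 1 : Plane) =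
    Real.exp (-t) • (Real.cos θ • logPolar t θ - Real.sin θ • logPolarPerp t θ) := by
  have h : Real.exp (-t) * Real.exp t = 1 := by rw [← Real.exp_add]; simp
  have hcs := Real.sin_sq_add_cos_sq θ
  ext i; fin_cases i
  · simp [logPolar, polar, logPolarPerp]
    linear_combination (-1 : ℝ) * hcs + (-(Real.sin θ ^ 2 + Real.cos θ ^ 2)) * h
  · simp [logPolar, polar, logPolarPerp]
    ring

lemma single_one_eq (t θ : ℝ) : (EuclideanSpace.single 1 1 : Plane) =
    Real.exp (-t) • (Real.sin θ • logPolar t θ + Real.cos θ • logPolarPerp t θ) := by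
  have h : Real.exp (-t) * Real.exp t = 1 := by rw [← Real.exp_add]; simp
  have hcs := Real.sin_sq_add_cos_sq θ
  ext i; fin_cases i
  · simp [logPolar, polar, logPolarPerp]
    ring
  · simp [logPolar, polar, logPolarPerp]
    linear_combination (-1 : ℝ) * hcs + (-(Real.sin θ ^ 2 + Real.cos θ ^ 2)) * h

lemma plane_eq_polar_comb (w : Plane) (t θ : ℝ) :
    w = Real.exp (-t) • ((Real.cos θ * w 0 + Real.sin θ * w 1) • logPolar t θ +
      (-Real.sin θ * w 0 + Real.cos θ * w 1) • logPolarPerp t θ) := by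
  have h : w = w 0 • (EuclideanSpace.single 0 1 : Plane) + w 1 • EuclideanSpace.single 1 1 := by
    ext i; fin_cases i <;> simp
  nth_rw 1 [h]
  rw [single_zero_eq t θ, single_one_eq t θ]
  module

lemma divergence_logPolar (hΩ : IsOpen Ω) (hu : ContDiffOn ℝ 3 u Ω)
    (hsol : IsSolution Ω u p)
    (hmem : ∀ t, ∀ θ ∈ Ioo α β, logPolar t θ ∈ Ω)
    (hF : HasPolarPartials α β F Ft Ftt Fθ Fθθ) (hG : HasPolarPartials α β G Gt Gtt Gθ Gθθ)
    (huF : ∀ t, ∀ θ ∈ Ioo α β, u (logPolar t θ) 0 = F t θ)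
    (huG : ∀ t, ∀ θ ∈ Ioo α β, u (logPolar t θ) 1 = G t θ) {t θ : ℝ} (hθ : θ ∈ Ioo α β) :
    Real.cos θ * Ft t θ - Real.sin θ * Fθ t θ + Real.sin θ * Gt t θ + Real.cos θ * Gθ t θ = 0 := by
  obtain ⟨f1, f2, -⟩ := partials_eq hΩ hu hmem 0 hF huF (t := t) hθ
  obtain ⟨g1, g2, -⟩ := partials_eq hΩ hu hmem 1 hG huG (t := t) hθ
  have h := hsol.incompressible _ (hmem t θ hθ)
  rw [divergence, Fin.sum_univ_two, single_zero_eq t θ, single_one_eq t θ] at h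
  simp only [map_smul, map_add, map_sub, PiLp.smul_apply, PiLp.add_apply, PiLp.sub_apply,
    smul_eq_mul, f1, f2, g1, g2] at h
  have he := (Real.exp_pos (-t)).ne'
  have : Real.exp (-t) * (Real.cos θ * Ft t θ - Real.sin θ * Fθ t θ + Real.sin θ * Gt t θ
      + Real.cos θ * Gθ t θ) = 0 := by linear_combination h
  exact (mul_eq_zero.1 this).resolve_left he

lemma momentum_logPolar (hΩ : IsOpen Ω) (hu : ContDiffOn ℝ 3 u Ω)
    (hsol : IsSolution Ω u p)
    (hmem : ∀ t, ∀ θ ∈ Ioo α β, logPolar t θ ∈ Ω) (i : Fin 2) {H Ht Htt Hθ Hθθ : ℝ → ℝ → ℝ}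
    (hH : HasPolarPartials α β H Ht Htt Hθ Hθθ)
    (huF : ∀ t, ∀ θ ∈ Ioo α β, u (logPolar t θ) 0 = F t θ)
    (huG : ∀ t, ∀ θ ∈ Ioo α β, u (logPolar t θ) 1 = G t θ)
    (huH : ∀ t, ∀ θ ∈ Ioo α β, u (logPolar t θ) i = H t θ) {t θ : ℝ} (hθ : θ ∈ Ioo α β) :
    Real.exp t ^ 2 * ∇ p (logPolar t θ) i = Htt t θ + Hθθ t θ - Real.exp t *
      ((Real.cos θ * F t θ + Real.sin θ * G t θ) * Ht t θ +
       (-Real.sin θ * F t θ + Real.cos θ * G t θ) * Hθ t θ) := by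
  obtain ⟨h1, h2, h3⟩ := partials_eq hΩ hu hmem i hH huH (t := t) hθ
  have h := congrArg (fun w : Plane => w i) (hsol.momentum _ (hmem t θ hθ))
  have e := plane_eq_polar_comb (u (logPolar t θ)) t θ
  rw [huF t θ hθ, huG t θ hθ] at e
  rw [e] at h
  simp only [map_smul, map_add, PiLp.smul_apply, PiLp.add_apply, PiLp.neg_apply, PiLp.zero_apply,
    smul_eq_mul, h1, h2] at h
  have he : Real.exp t * Real.exp (-t) = 1 := by rw [← Real.exp_add]; simp
  linear_combination (Real.exp t ^ 2) * h + h3 - Real.exp t *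
      ((Real.cos θ * F t θ + Real.sin θ * G t θ) * Ht t θ +
       (-Real.sin θ * F t θ + Real.cos θ * G t θ) * Hθ t θ) * he

lemma gradient_apply_logPolar {z w : Plane} (hp : DifferentiableAt ℝ p z) :
    fderiv ℝ p z w = ∇ p z 0 * w 0 + ∇ p z 1 * w 1 := by
  have := hp.hasGradientAt.hasFDerivAt.fderiv
  rw [this, InnerProductSpace.toDual_apply_apply, PiLp.inner_apply, Fin.sum_univ_two]
  simp [mul_comm]

/-- The components of the pressure gradient in logarithmic polar coordinates, multiplied by the
squared radius. -/
noncomputable def forcing (F G Ht Htt Hθ Hθθ : ℝ → ℝ → ℝ) (t θ : ℝ) : ℝ :=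
  Htt t θ + Hθθ t θ - Real.exp t *
      ((Real.cos θ * F t θ + Real.sin θ * G t θ) * Ht t θ +
       (-Real.sin θ * F t θ + Real.cos θ * G t θ) * Hθ t θ)

/-- This serves twice: its mixed partials give the vorticity equation, and its integration recovers
the pressure. The factor `exp (-t)` is what remains after `forcing`, which is `r² ∇p`, is paired
with the derivatives of position, of length `r`. -/
lemma hasFDerivAt_pressure (hΩ : IsOpen Ω) (hu : ContDiffOn ℝ 3 u Ω) (hp : ContDiffOn ℝ 1 p Ω)
    (hsol : IsSolution Ω u p)
    (hmem : ∀ t, ∀ θ ∈ Ioo α β, logPolar t θ ∈ Ω)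
    (hF : HasPolarPartials α β F Ft Ftt Fθ Fθθ) (hG : HasPolarPartials α β G Gt Gtt Gθ Gθθ)
    (huF : ∀ t, ∀ θ ∈ Ioo α β, u (logPolar t θ) 0 = F t θ)
    (huG : ∀ t, ∀ θ ∈ Ioo α β, u (logPolar t θ) 1 = G t θ) {t θ : ℝ} (hθ : θ ∈ Ioo α β) :
    HasFDerivAt (fun y : ℝ × ℝ => p (logPolar y.1 y.2))
      ((Real.exp (-t) * (Real.cos θ * forcing F G Ft Ftt Fθ Fθθ t θ +
          Real.sin θ * forcing F G Gt Gtt Gθ Gθθ t θ)) • ContinuousLinearMap.fst ℝ ℝ ℝ +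
        (Real.exp (-t) * (-Real.sin θ * forcing F G Ft Ftt Fθ Fθθ t θ +
          Real.cos θ * forcing F G Gt Gtt Gθ Gθθ t θ)) • ContinuousLinearMap.snd ℝ ℝ ℝ) (t, θ) := by
  have hpd : DifferentiableAt ℝ p (logPolar t θ) :=
    (hp.differentiableOn (by norm_num)).differentiableAt (hΩ.mem_nhds (hmem t θ hθ))
  have hd : DifferentiableAt ℝ (fun y : ℝ × ℝ => logPolar y.1 y.2) (t, θ) := by
    unfold logPolar polar
    have h : DifferentiableAt ℝ (fun y : ℝ × ℝ =>
        (![Real.exp y.1 * Real.cos y.2, Real.exp y.1 * Real.sin y.2] : Fin 2 → ℝ)) (t, θ) := by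
      rw [differentiableAt_pi]
      intro i
      fin_cases i
      · simp; fun_prop
      · simp; fun_prop
    exact ((PiLp.continuousLinearEquiv 2 ℝ (fun _ : Fin 2 => ℝ)).symm.differentiableAt.comp _ h)
  have hc : HasFDerivAt (fun y : ℝ × ℝ => p (logPolar y.1 y.2)) _ (t, θ) :=
    HasFDerivAt.comp (t, θ) (g := p) (f := fun y : ℝ × ℝ => logPolar y.1 y.2)
      hpd.hasFDerivAt hd.hasFDerivAt
  refine hc.congr_fderiv ?_
  have m0 := momentum_logPolar hΩ hu hsol hmem 0 hF huF huG huF (t := t) hθ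
  have m1 := momentum_logPolar hΩ hu hsol hmem 1 hG huF huG huG (t := t) hθ
  have he : Real.exp (-t) * Real.exp t = 1 := by rw [← Real.exp_add]; simp
  have c1 : HasDerivAt (fun τ : ℝ => ((τ, θ) : ℝ × ℝ)) (1, 0) t :=
    (hasDerivAt_id t).prodMk (hasDerivAt_const t θ)
  have c2 : HasDerivAt (fun η : ℝ => ((t, η) : ℝ × ℝ)) (0, 1) θ :=
    (hasDerivAt_const θ t).prodMk (hasDerivAt_id θ)
  have d1 : fderiv ℝ (fun y : ℝ × ℝ => logPolar y.1 y.2) (t, θ) (1, 0) = logPolar t θ :=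
    (HasFDerivAt.comp_hasDerivAt (f := fun τ : ℝ => ((τ, θ) : ℝ × ℝ)) t hd.hasFDerivAt c1).unique
      (hasDerivAt_logPolar_left t θ)
  have d2 : fderiv ℝ (fun y : ℝ × ℝ => logPolar y.1 y.2) (t, θ) (0, 1) = logPolarPerp t θ :=
    (HasFDerivAt.comp_hasDerivAt (f := fun η : ℝ => ((t, η) : ℝ × ℝ)) θ hd.hasFDerivAt c2).unique
      (hasDerivAt_logPolar_right t θ)
  apply ContinuousLinearMap.ext
  rintro ⟨x, y⟩
  have e : ((x, y) : ℝ × ℝ) = x • ((1, 0) : ℝ × ℝ) + y • ((0, 1) : ℝ × ℝ) := by simp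
  have hR : ((fderiv ℝ p (logPolar t θ)).comp
      (fderiv ℝ (fun y : ℝ × ℝ => logPolar y.1 y.2) (t, θ))) (x, y) =
      x * (∇ p (logPolar t θ) 0 * logPolar t θ 0 + ∇ p (logPolar t θ) 1 * logPolar t θ 1) +
      y * (∇ p (logPolar t θ) 0 * logPolarPerp t θ 0 + ∇ p (logPolar t θ) 1 * logPolarPerp t θ 1)
      := by
    rw [e, map_add, map_smul, map_smul, ContinuousLinearMap.comp_apply,
      ContinuousLinearMap.comp_apply, d1, d2, gradient_apply_logPolar hpd,
      gradient_apply_logPolar hpd]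
    simp
  rw [hR]
  simp only [add_apply, smul_apply,
    ContinuousLinearMap.coe_fst', ContinuousLinearMap.coe_snd', smul_eq_mul]
  unfold forcing
  rw [← m0, ← m1]
  simp only [logPolar, polar, logPolarPerp, Matrix.cons_val_zero, Matrix.cons_val_one,
    PiLp.toLp_apply]
  generalize ∇ p !₂[Real.exp t * Real.cos θ, Real.exp t * Real.sin θ] 0 = a
  generalize ∇ p !₂[Real.exp t * Real.cos θ, Real.exp t * Real.sin θ] 1 = b
  linear_combination -(Real.exp t * (x * (Real.cos θ * a + Real.sin θ * b) +
    y * (-Real.sin θ * a + Real.cos θ * b))) * he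

end Equations

/-! ### Elimination of the pressure for separated fields -/

/-- `f` is three times differentiable on `I` with successive derivatives `f₁`, `f₂`, `f₃`, the
last of which is continuous. -/
structure Jet (I : Set ℝ) (f f₁ f₂ f₃ : ℝ → ℝ) : Prop where
  d0 : ∀ x ∈ I, HasDerivAt f (f₁ x) x
  d1 : ∀ x ∈ I, HasDerivAt f₁ (f₂ x) x
  d2 : ∀ x ∈ I, HasDerivAt f₂ (f₃ x) x
  cont : ContinuousOn f₃ I

lemma exists_jet {I : Set ℝ} (hI : IsOpen I) {f : ℝ → ℝ} (hf : ContDiffOn ℝ 3 f I) :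
    ∃ f₁ f₂ f₃, Jet I f f₁ f₂ f₃ := by
  have h1 : ContDiffOn ℝ 2 (deriv f) I := hf.deriv_of_isOpen hI (by norm_num)
  have h2 : ContDiffOn ℝ 1 (deriv (deriv f)) I := h1.deriv_of_isOpen hI (by norm_num)
  have h3 : ContDiffOn ℝ 0 (deriv (deriv (deriv f))) I := h2.deriv_of_isOpen hI (by norm_num)
  refine ⟨deriv f, deriv (deriv f), deriv (deriv (deriv f)), ?_, ?_, ?_, h3.continuousOn⟩
  · exact fun x hx => ((hf.differentiableOn (by norm_num)).differentiableAt
      (hI.mem_nhds hx)).hasDerivAt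
  · exact fun x hx => ((h1.differentiableOn (by norm_num)).differentiableAt
      (hI.mem_nhds hx)).hasDerivAt
  · exact fun x hx => ((h2.differentiableOn (by norm_num)).differentiableAt
      (hI.mem_nhds hx)).hasDerivAt

lemma jet_zero (I : Set ℝ) : Jet I 0 0 0 0 where
  d0 x _ := hasDerivAt_const x 0
  d1 x _ := hasDerivAt_const x 0
  d2 x _ := hasDerivAt_const x 0
  cont := continuousOn_const

lemma Jet.const_mul {I : Set ℝ} {f f₁ f₂ f₃ : ℝ → ℝ} (h : Jet I f f₁ f₂ f₃) (k : ℝ) :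
    Jet I (fun x => k * f x) (fun x => k * f₁ x) (fun x => k * f₂ x) (fun x => k * f₃ x) where
  d0 x hx := (h.d0 x hx).const_mul k
  d1 x hx := (h.d1 x hx).const_mul k
  d2 x hx := (h.d2 x hx).const_mul k
  cont := h.cont.const_smul k

/-- Equality of mixed partial derivatives, for a function given through its first partials. -/
lemma mixed_partials_eq {P A B : ℝ × ℝ → ℝ} {U : Set (ℝ × ℝ)} (hU : IsOpen U)
    (hP : ∀ y ∈ U, HasFDerivAt P
      (A y • ContinuousLinearMap.fst ℝ ℝ ℝ + B y • ContinuousLinearMap.snd ℝ ℝ ℝ) y)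
    {t θ a b : ℝ} (hy : (t, θ) ∈ U) (hA : DifferentiableAt ℝ A (t, θ))
    (hB : DifferentiableAt ℝ B (t, θ)) (ha : HasDerivAt (fun η => A (t, η)) a θ)
    (hb : HasDerivAt (fun τ => B (τ, θ)) b t) : a = b := by
  have hd : HasFDerivAt (fun y => A y • ContinuousLinearMap.fst ℝ ℝ ℝ +
      B y • ContinuousLinearMap.snd ℝ ℝ ℝ) _ (t, θ) :=
    (hA.hasFDerivAt.smul_const (ContinuousLinearMap.fst ℝ ℝ ℝ)).add
      (hB.hasFDerivAt.smul_const (ContinuousLinearMap.snd ℝ ℝ ℝ))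
  have hs := second_derivative_symmetric_of_eventually
    (by filter_upwards [hU.mem_nhds hy] with y hy using hP y hy) hd (1, 0) (0, 1)
  have c1 : HasDerivAt (fun τ : ℝ => ((τ, θ) : ℝ × ℝ)) (1, 0) t :=
    (hasDerivAt_id t).prodMk (hasDerivAt_const t θ)
  have c2 : HasDerivAt (fun η : ℝ => ((t, η) : ℝ × ℝ)) (0, 1) θ :=
    (hasDerivAt_const θ t).prodMk (hasDerivAt_id θ)
  have d1 : fderiv ℝ A (t, θ) (0, 1) = a :=
    (HasFDerivAt.comp_hasDerivAt (f := fun η : ℝ => ((t, η) : ℝ × ℝ)) θ hA.hasFDerivAt c2).unique ha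
  have d2 : fderiv ℝ B (t, θ) (1, 0) = b :=
    (HasFDerivAt.comp_hasDerivAt (f := fun τ : ℝ => ((τ, θ) : ℝ × ℝ)) t hB.hasFDerivAt c1).unique hb
  simp [d1, d2] at hs
  exact hs.symm

/-- The ordinary differential equations satisfied by the factors of a separated solution
`(v(θ) φ(t), w(θ) χ(t))`, `t = log r`: the divergence equation, the vorticity equation, and
the existence of a limit at the origin. -/
structure SepSystem (α β : ℝ) (v v₁ v₂ v₃ w w₁ w₂ w₃ φ φ₁ φ₂ φ₃ χ χ₁ χ₂ χ₃ : ℝ → ℝ) :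
    Prop where
  jv : Jet (Ioo α β) v v₁ v₂ v₃
  jw : Jet (Ioo α β) w w₁ w₂ w₃
  jφ : Jet univ φ φ₁ φ₂ φ₃
  jχ : Jet univ χ χ₁ χ₂ χ₃
  div : ∀ t, ∀ θ ∈ Ioo α β, Real.cos θ * v θ * φ₁ t - Real.sin θ * v₁ θ * φ t +
    Real.sin θ * w θ * χ₁ t + Real.cos θ * w₁ θ * χ t = 0
  vort : ∀ t, ∀ θ ∈ Ioo α β,
    (Real.cos θ * w θ * χ₃ t - Real.sin θ * w₁ θ * χ₂ t
      - Real.sin θ * v θ * φ₃ t - Real.cos θ * v₁ θ * φ₂ t)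
    - 2 * (Real.cos θ * w θ * χ₂ t - Real.sin θ * w₁ θ * χ₁ t
      - Real.sin θ * v θ * φ₂ t - Real.cos θ * v₁ θ * φ₁ t)
    + (Real.cos θ * w θ * χ₁ t - Real.sin θ * w₁ θ * χ t
      - Real.sin θ * v θ * φ₁ t - Real.cos θ * v₁ θ * φ t)
    + ((-Real.cos θ * w θ - 2 * Real.sin θ * w₁ θ + Real.cos θ * w₂ θ) * χ₁ t
      - (-Real.sin θ * w₁ θ + 2 * Real.cos θ * w₂ θ + Real.sin θ * w₃ θ) * χ t
      - (-Real.sin θ * v θ + 2 * Real.cos θ * v₁ θ + Real.sin θ * v₂ θ) * φ₁ t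
      - (-Real.cos θ * v₁ θ - 2 * Real.sin θ * v₂ θ + Real.cos θ * v₃ θ) * φ t)
    = Real.exp t * ((Real.cos θ * v θ * φ t + Real.sin θ * w θ * χ t) *
        ((Real.cos θ * w θ * χ₂ t - Real.sin θ * w₁ θ * χ₁ t
          - Real.sin θ * v θ * φ₂ t - Real.cos θ * v₁ θ * φ₁ t)
        - (Real.cos θ * w θ * χ₁ t - Real.sin θ * w₁ θ * χ t
          - Real.sin θ * v θ * φ₁ t - Real.cos θ * v₁ θ * φ t))
      + (-Real.sin θ * v θ * φ t + Real.cos θ * w θ * χ t) *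
        ((-Real.sin θ * w θ + Real.cos θ * w₁ θ) * χ₁ t
          - (Real.cos θ * w₁ θ + Real.sin θ * w₂ θ) * χ t
          - (Real.cos θ * v θ + Real.sin θ * v₁ θ) * φ₁ t
          - (-Real.sin θ * v₁ θ + Real.cos θ * v₂ θ) * φ t))
  limφ : ∃ l, Tendsto φ atBot (𝓝 l) ∧ ∀ θ ∈ Ioo α β, ∀ θ' ∈ Ioo α β, v θ * l = v θ' * l
  limχ : ∃ l, Tendsto χ atBot (𝓝 l) ∧ ∀ θ ∈ Ioo α β, ∀ θ' ∈ Ioo α β, w θ * l = w θ' * l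

lemma hasPolarPartials_mul {α β : ℝ} {v v₁ v₂ v₃ φ φ₁ φ₂ φ₃ : ℝ → ℝ}
    (hv : Jet (Ioo α β) v v₁ v₂ v₃) (hφ : Jet univ φ φ₁ φ₂ φ₃) :
    HasPolarPartials α β (fun t θ => v θ * φ t) (fun t θ => v θ * φ₁ t) (fun t θ => v θ * φ₂ t)
      (fun t θ => v₁ θ * φ t) (fun t θ => v₂ θ * φ t) where
  dt t _ _ := (hφ.d0 t trivial).const_mul _
  dtt t _ _ := (hφ.d1 t trivial).const_mul _
  dθ _ θ h := (hv.d0 θ h).mul_const _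
  dθθ _ θ h := (hv.d1 θ h).mul_const _

section

variable {Ω : Set Plane} {u : Plane → Plane} {p : Plane → ℝ} {α β : ℝ}
  {v v₁ v₂ v₃ w w₁ w₂ w₃ φ φ₁ φ₂ φ₃ χ χ₁ χ₂ χ₃ : ℝ → ℝ}

/-- The pressure is only `C¹`, but the momentum equation shows that its first partials are
differentiable, so the mixed partials agree. With `W = r · curl u`, the four groups on the left of
`vort` are `Wₜₜ`, `-2 Wₜ`, `W`, `W_θθ`, and the right side is `exp t` times (radial velocity · `(Wₜ
- W)` + angular velocity component · `W_θ`). -/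
lemma vorticity_of_separated (hΩ : IsOpen Ω) (hu : ContDiffOn ℝ 3 u Ω) (hp : ContDiffOn ℝ 1 p Ω)
    (hsol : IsSolution Ω u p) (hmem : ∀ t, ∀ θ ∈ Ioo α β, logPolar t θ ∈ Ω)
    (jv : Jet (Ioo α β) v v₁ v₂ v₃) (jw : Jet (Ioo α β) w w₁ w₂ w₃)
    (jφ : Jet univ φ φ₁ φ₂ φ₃) (jχ : Jet univ χ χ₁ χ₂ χ₃)
    (hu0 : ∀ t, ∀ θ ∈ Ioo α β, u (logPolar t θ) 0 = v θ * φ t)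
    (hu1 : ∀ t, ∀ θ ∈ Ioo α β, u (logPolar t θ) 1 = w θ * χ t)
    (hlφ : ∃ l, Tendsto φ atBot (𝓝 l) ∧ ∀ θ ∈ Ioo α β, ∀ θ' ∈ Ioo α β, v θ * l = v θ' * l)
    (hlχ : ∃ l, Tendsto χ atBot (𝓝 l) ∧ ∀ θ ∈ Ioo α β, ∀ θ' ∈ Ioo α β, w θ * l = w θ' * l) :
    SepSystem α β v v₁ v₂ v₃ w w₁ w₂ w₃ φ φ₁ φ₂ φ₃ χ χ₁ χ₂ χ₃ := by
  have hF := hasPolarPartials_mul jv jφ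
  have hG := hasPolarPartials_mul jw jχ
  have hdiv : ∀ t, ∀ θ ∈ Ioo α β, Real.cos θ * v θ * φ₁ t - Real.sin θ * v₁ θ * φ t +
      Real.sin θ * w θ * χ₁ t + Real.cos θ * w₁ θ * χ t = 0 := by
    intro t θ hθ
    have := divergence_logPolar hΩ hu hsol hmem hF hG hu0 hu1 (t := t) hθ
    linear_combination this
  refine ⟨jv, jw, jφ, jχ, hdiv, ?_, hlφ, hlχ⟩
  intro t θ hθ
  have hP := fun y : ℝ × ℝ => fun hy : y ∈ (univ : Set ℝ) ×ˢ Ioo α β =>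
    hasFDerivAt_pressure hΩ hu hp hsol hmem hF hG hu0 hu1 (t := y.1) (θ := y.2) hy.2
  have dv0 : DifferentiableAt ℝ v (t, θ).2 := (jv.d0 θ hθ).differentiableAt
  have dv1 : DifferentiableAt ℝ v₁ (t, θ).2 := (jv.d1 θ hθ).differentiableAt
  have dv2 : DifferentiableAt ℝ v₂ (t, θ).2 := (jv.d2 θ hθ).differentiableAt
  have dw0 : DifferentiableAt ℝ w (t, θ).2 := (jw.d0 θ hθ).differentiableAt
  have dw1 : DifferentiableAt ℝ w₁ (t, θ).2 := (jw.d1 θ hθ).differentiableAt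
  have dw2 : DifferentiableAt ℝ w₂ (t, θ).2 := (jw.d2 θ hθ).differentiableAt
  have dp0 : DifferentiableAt ℝ φ (t, θ).1 := (jφ.d0 t trivial).differentiableAt
  have dp1 : DifferentiableAt ℝ φ₁ (t, θ).1 := (jφ.d1 t trivial).differentiableAt
  have dp2 : DifferentiableAt ℝ φ₂ (t, θ).1 := (jφ.d2 t trivial).differentiableAt
  have dc0 : DifferentiableAt ℝ χ (t, θ).1 := (jχ.d0 t trivial).differentiableAt
  have dc1 : DifferentiableAt ℝ χ₁ (t, θ).1 := (jχ.d1 t trivial).differentiableAt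
  have dc2 : DifferentiableAt ℝ χ₂ (t, θ).1 := (jχ.d2 t trivial).differentiableAt
  have hc := Real.hasDerivAt_cos θ
  have hs := Real.hasDerivAt_sin θ
  have he := Real.hasDerivAt_exp t
  have hen : HasDerivAt (fun τ => Real.exp (-τ)) (-Real.exp (-t)) t := by
    simpa using (hasDerivAt_neg t).exp
  have hv0 := jv.d0 θ hθ
  have hv1 := jv.d1 θ hθ
  have hv2 := jv.d2 θ hθ
  have hw0 := jw.d0 θ hθ
  have hw1 := jw.d1 θ hθ
  have hw2 := jw.d2 θ hθ
  have hφ0 := jφ.d0 t trivial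
  have hφ1 := jφ.d1 t trivial
  have hφ2 := jφ.d2 t trivial
  have hχ0 := jχ.d0 t trivial
  have hχ1 := jχ.d1 t trivial
  have hχ2 := jχ.d2 t trivial
  have hrθ := ((hc.mul (hv0.mul_const (φ t))).add (hs.mul (hw0.mul_const (χ t))))
  have htθ := ((hs.neg.mul (hv0.mul_const (φ t))).add (hc.mul (hw0.mul_const (χ t))))
  have fFθ := ((hv0.mul_const (φ₂ t)).add (hv2.mul_const (φ t))).sub
    (((hrθ.mul (hv0.mul_const (φ₁ t))).add (htθ.mul (hv1.mul_const (φ t)))).const_mul (Real.exp t))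
  have fGθ := ((hw0.mul_const (χ₂ t)).add (hw2.mul_const (χ t))).sub
    (((hrθ.mul (hw0.mul_const (χ₁ t))).add (htθ.mul (hw1.mul_const (χ t)))).const_mul (Real.exp t))
  have hrt := (((hφ0.const_mul (v θ)).const_mul (Real.cos θ)).add
    ((hχ0.const_mul (w θ)).const_mul (Real.sin θ)))
  have htt := (((hφ0.const_mul (v θ)).const_mul (-Real.sin θ)).add
    ((hχ0.const_mul (w θ)).const_mul (Real.cos θ)))
  have fFt := ((hφ2.const_mul (v θ)).add (hφ0.const_mul (v₂ θ))).sub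
    (he.mul ((hrt.mul (hφ1.const_mul (v θ))).add (htt.mul (hφ0.const_mul (v₁ θ)))))
  have fGt := ((hχ2.const_mul (w θ)).add (hχ0.const_mul (w₂ θ))).sub
    (he.mul ((hrt.mul (hχ1.const_mul (w θ))).add (htt.mul (hχ0.const_mul (w₁ θ)))))
  have hA := ((hc.mul fFθ).add (hs.mul fGθ)).const_mul (Real.exp (-t))
  have hB := hen.mul ((fFt.const_mul (-Real.sin θ)).add (fGt.const_mul (Real.cos θ)))
  have key := mixed_partials_eq (isOpen_univ.prod isOpen_Ioo) hP (t := t) (θ := θ) ⟨trivial, hθ⟩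
    (by unfold forcing; fun_prop) (by unfold forcing; fun_prop) hA hB
  have hpos := (Real.exp_pos (-t)).ne'
  have hd := hdiv t θ hθ
  apply mul_left_cancel₀ hpos
  simp only [Pi.add_apply, Pi.mul_apply, Pi.sub_apply, Pi.neg_apply] at key
  -- The curl of the convective term contains the product of vorticity and divergence; the second
  -- summand removes it.
  linear_combination (-1 : ℝ) * key + (Real.exp (-t) * Real.exp t *
    (Real.cos θ * w θ * χ₁ t - Real.sin θ * w₁ θ * χ t
      - Real.sin θ * v θ * φ₁ t - Real.cos θ * v₁ θ * φ t)) * hd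

end

/-! ### Elementary calculus on an interval of angles -/

section Calculus

variable {α β : ℝ}

lemma const_of_hasDerivAt_zero {f : ℝ → ℝ} (h : ∀ x ∈ Ioo α β, HasDerivAt f 0 x)
    {x y : ℝ} (hx : x ∈ Ioo α β) (hy : y ∈ Ioo α β) : f x = f y :=
  isOpen_Ioo.is_const_of_deriv_eq_zero isPreconnected_Ioo
    (fun z hz => (h z hz).differentiableAt.differentiableWithinAt) (fun z hz => (h z hz).deriv) hx hy

lemma const_of_hasDerivAt_zero_univ {f : ℝ → ℝ} (h : ∀ x, HasDerivAt f 0 x) (x y : ℝ) :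
    f x = f y :=
  is_const_of_deriv_eq_zero (fun z => (h z).differentiableAt) (fun z => (h z).deriv) x y

lemma hasDerivAt_eq_zero_of_eqOn {f : ℝ → ℝ} {f' c x : ℝ} {I : Set ℝ} (hI : IsOpen I)
    (h0 : ∀ y ∈ I, f y = c) (hx : x ∈ I) (hf : HasDerivAt f f' x) : f' = 0 := by
  have h : f =ᶠ[𝓝 x] fun _ => c := by
    filter_upwards [hI.mem_nhds hx] with y hy using h0 y hy
  exact hf.unique ((hasDerivAt_const x c).congr_of_eventuallyEq h)

/-- A continuous function vanishing wherever `sin θ * cos θ ≠ 0` vanishes. -/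
lemma eq_zero_of_sin_mul_cos_mul {F : ℝ → ℝ} {I : Set ℝ} (hI : IsOpen I) (hF : ContinuousOn F I)
    (h : ∀ θ ∈ I, Real.sin θ * Real.cos θ * F θ = 0) {θ : ℝ} (hθ : θ ∈ I) :
    F θ = 0 := by
  by_cases h0 : Real.sin θ * Real.cos θ = 0
  -- The derivative of `sin θ cos θ` is `cos² θ - sin² θ`, nonzero at every zero of the product. The
  -- zeros are therefore isolated and continuity fills them in.
  · have hd : HasDerivAt (fun x => Real.sin x * Real.cos x)
        (Real.cos θ * Real.cos θ + Real.sin θ * (-Real.sin θ)) θ :=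
      (Real.hasDerivAt_sin θ).mul (Real.hasDerivAt_cos θ)
    have hne : Real.cos θ * Real.cos θ + Real.sin θ * (-Real.sin θ) ≠ 0 := by
      intro h1
      have h2 := Real.sin_sq_add_cos_sq θ
      rcases mul_eq_zero.1 h0 with h3 | h3 <;> rw [h3] at h1 h2 <;> nlinarith
    have hev := hd.eventually_ne (c := 0) hne
    have hev2 : ∀ᶠ x in 𝓝[≠] θ, F x = 0 := by
      filter_upwards [hev, nhdsWithin_le_nhds (hI.mem_nhds hθ)] with x hx hxI
      exact (mul_eq_zero.1 (h x hxI)).resolve_left hx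
    have hc : Tendsto F (𝓝[≠] θ) (𝓝 (F θ)) :=
      (hF.continuousAt (hI.mem_nhds hθ)).mono_left nhdsWithin_le_nhds
    exact tendsto_nhds_unique hc ((tendsto_congr' hev2).2 tendsto_const_nhds)
  · exact (mul_eq_zero.1 (h θ hθ)).resolve_left h0

lemma Jet.contOn {I : Set ℝ} {f f₁ f₂ f₃ : ℝ → ℝ} (h : Jet I f f₁ f₂ f₃) : ContinuousOn f I :=
  fun x hx => (h.d0 x hx).continuousAt.continuousWithinAt

lemma Jet.contOn₁ {I : Set ℝ} {f f₁ f₂ f₃ : ℝ → ℝ} (h : Jet I f f₁ f₂ f₃) : ContinuousOn f₁ I :=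
  fun x hx => (h.d1 x hx).continuousAt.continuousWithinAt

lemma Jet.contOn₂ {I : Set ℝ} {f f₁ f₂ f₃ : ℝ → ℝ} (h : Jet I f f₁ f₂ f₃) : ContinuousOn f₂ I :=
  fun x hx => (h.d2 x hx).continuousAt.continuousWithinAt

/-- Solutions of the harmonic oscillator equation. -/
lemma oscillator {n : ℝ} (hn : n ≠ 0) {f g : ℝ → ℝ} (hαβ : α < β)
    (hf : ∀ x ∈ Ioo α β, HasDerivAt f (g x) x)
    (hg : ∀ x ∈ Ioo α β, HasDerivAt g (-n ^ 2 * f x) x) :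
    ∃ A B, ∀ x ∈ Ioo α β, f x = A * Real.cos (n * x) + B * Real.sin (n * x) ∧
      g x = -n * A * Real.sin (n * x) + n * B * Real.cos (n * x) := by
  have hc : ∀ x, HasDerivAt (fun y => Real.cos (n * y)) (-Real.sin (n * x) * n) x := fun x => by
    simpa using ((hasDerivAt_id x).const_mul n).cos
  have hs : ∀ x, HasDerivAt (fun y => Real.sin (n * y)) (Real.cos (n * x) * n) x := fun x => by
    simpa using ((hasDerivAt_id x).const_mul n).sin
  obtain ⟨x₀, hx₀⟩ := nonempty_Ioo.2 hαβ
  have h1 : ∀ x ∈ Ioo α β,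
      HasDerivAt (fun y => n * f y * Real.cos (n * y) - g y * Real.sin (n * y)) 0 x := by
    intro x hx
    have := (((hf x hx).const_mul n).mul (hc x)).sub ((hg x hx).mul (hs x))
    refine this.congr_deriv ?_
    ring
  have h2 : ∀ x ∈ Ioo α β,
      HasDerivAt (fun y => n * f y * Real.sin (n * y) + g y * Real.cos (n * y)) 0 x := by
    intro x hx
    have := (((hf x hx).const_mul n).mul (hs x)).add ((hg x hx).mul (hc x))
    refine this.congr_deriv ?_
    ring
  refine ⟨(n * f x₀ * Real.cos (n * x₀) - g x₀ * Real.sin (n * x₀)) / n,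
    (n * f x₀ * Real.sin (n * x₀) + g x₀ * Real.cos (n * x₀)) / n, fun x hx => ?_⟩
  rw [← const_of_hasDerivAt_zero h1 hx hx₀, ← const_of_hasDerivAt_zero h2 hx hx₀]
  have := Real.sin_sq_add_cos_sq (n * x)
  constructor
  · field_simp
    linear_combination -f x * n * this
  · field_simp
    linear_combination -g x * this

end Calculus

/-! ### Homogeneous flows -/

/-- The list of admissible velocity fields in logarithmic polar coordinates. -/
def IsClassified (α β : ℝ) (U V : ℝ → ℝ → ℝ) : Prop :=
  (∃ C₁ C₂ : ℝ, ∀ t, ∀ θ ∈ Ioo α β, U t θ = C₁ ∧ V t θ = C₂) ∨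
  (∃ C₁ C₂ C₃ : ℝ, ∀ t, ∀ θ ∈ Ioo α β,
    U t θ = Real.exp t * (C₁ * Real.cos θ + C₂ * Real.sin θ) ∧
    V t θ = Real.exp t * (C₃ * Real.cos θ - C₁ * Real.sin θ)) ∨
  (∃ C₁ C₂ C₃ C₄ : ℝ, C₁ * C₃ + C₂ * C₄ - 2 * C₁ * C₂ = 0 ∧
    C₁ * C₄ - C₂ * C₃ + C₁ ^ 2 - C₂ ^ 2 = 0 ∧ ∀ t, ∀ θ ∈ Ioo α β,
    U t θ = Real.exp (2 * t) * ((C₂ + C₃) * Real.cos θ ^ 2 + (3 * C₂ - C₃) * Real.sin θ ^ 2 +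
      2 * (C₁ + C₄) * (Real.cos θ * Real.sin θ)) ∧
    V t θ = Real.exp (2 * t) * ((C₄ - 3 * C₁) * Real.cos θ ^ 2 - (C₁ + C₄) * Real.sin θ ^ 2 -
      2 * (C₂ + C₃) * (Real.cos θ * Real.sin θ))) ∨
  (∃ C₁ C₂ lam : ℝ, lam ∈ Ioo (0 : ℝ) 1 ∪ Ioo (1 : ℝ) 2 ∪ Ioi (2 : ℝ) ∧ ∀ t, ∀ θ ∈ Ioo α β,
    U t θ = Real.exp (lam * t) * (C₁ * Real.cos (lam * θ) + C₂ * Real.sin (lam * θ)) ∧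
    V t θ = Real.exp (lam * t) * (C₂ * Real.cos (lam * θ) - C₁ * Real.sin (lam * θ))) ∨
  (∃ C₁ C₂ : ℝ, ∀ t, ∀ θ ∈ Ioo α β,
    U t θ = -((C₁ + C₂ * t) * (Real.exp t * Real.sin θ)) ∧
    V t θ = (C₁ + C₂ * t) * (Real.exp t * Real.cos θ)) ∨
  (∃ C₁ C₂ : ℝ, ∀ t, ∀ θ ∈ Ioo α β, U t θ = C₁ ∧ V t θ = C₂ * (Real.exp t * Real.cos θ)) ∨
  (∃ C₁ C₂ : ℝ, ∀ t, ∀ θ ∈ Ioo α β, U t θ = C₁ * (Real.exp t * Real.sin θ) ∧ V t θ = C₂)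

section Homogeneous

variable {α β : ℝ}

/-- Angular profiles `Ψ` of the stream function and `Q` of the vorticity of a homogeneous steady
solution: the vorticity is harmonic and transported by the flow. -/
lemma homogeneous_profiles (hαβ : α < β) {n k : ℝ} (hnk : n = k + 2) (hn : 1 < n)
    {Ψ Ψ₁ Q Q₁ : ℝ → ℝ} (dΨ : ∀ x ∈ Ioo α β, HasDerivAt Ψ (Ψ₁ x) x)
    (dΨ₁ : ∀ x ∈ Ioo α β, HasDerivAt Ψ₁ (Q x - n ^ 2 * Ψ x) x)
    (dQ : ∀ x ∈ Ioo α β, HasDerivAt Q (Q₁ x) x)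
    (dQ₁ : ∀ x ∈ Ioo α β, HasDerivAt Q₁ (-k ^ 2 * Q x) x)
    (htr : ∀ x ∈ Ioo α β, n * Ψ x * Q₁ x = k * Ψ₁ x * Q x) :
    (∀ x ∈ Ioo α β, Q x = 0) ∨ (k = 0 ∧ ∃ q, ∀ x ∈ Ioo α β, Q x = q) ∨
      (k = 1 ∧ ∃ E, 0 < E ∧ ∀ x ∈ Ioo α β, Q₁ x ^ 2 + Q x ^ 2 = E ∧ 6 * E * Ψ x = Q x ^ 3) := by
  obtain ⟨x₀, hx₀⟩ := nonempty_Ioo.2 hαβ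
  by_cases hk : k = 0
  · subst hk
    have hQ1 : ∀ x ∈ Ioo α β, Q₁ x = Q₁ x₀ := fun x hx =>
      const_of_hasDerivAt_zero (fun y hy => by simpa using dQ₁ y hy) hx hx₀
    -- For `k = 0` the profile `Q` is affine. A nonzero slope would make the transport relation read
    -- `Ψ = 0`, and then `Q = Ψ'' + n² Ψ = 0`.
    by_cases hm : Q₁ x₀ = 0
    · refine Or.inr (Or.inl ⟨rfl, Q x₀, fun x hx => const_of_hasDerivAt_zero (fun y hy => ?_) hx hx₀⟩)
      have := dQ y hy
      rwa [hQ1 y hy, hm] at this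
    · left
      have hΨ : ∀ x ∈ Ioo α β, Ψ x = 0 := by
        intro x hx
        have := htr x hx
        rw [hQ1 x hx] at this
        have h2 : n * Q₁ x₀ * Ψ x = 0 := by linear_combination this
        exact (mul_eq_zero.1 h2).resolve_left (mul_ne_zero (by linarith) hm)
      have hΨ1 : ∀ x ∈ Ioo α β, Ψ₁ x = 0 := fun x hx =>
        hasDerivAt_eq_zero_of_eqOn isOpen_Ioo hΨ hx (dΨ x hx)
      intro x hx
      have := hasDerivAt_eq_zero_of_eqOn isOpen_Ioo hΨ1 hx (dΨ₁ x hx)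
      rw [hΨ x hx] at this
      linarith
  · have hE : ∀ x ∈ Ioo α β, Q₁ x ^ 2 + k ^ 2 * Q x ^ 2 = Q₁ x₀ ^ 2 + k ^ 2 * Q x₀ ^ 2 := by
      intro x hx
      refine const_of_hasDerivAt_zero (f := fun y => Q₁ y ^ 2 + k ^ 2 * Q y ^ 2)
        (fun y hy => ?_) hx hx₀
      have := ((dQ₁ y hy).pow 2).add (((dQ y hy).pow 2).const_mul (k ^ 2))
      refine this.congr_deriv ?_
      simp; ring
    set E := Q₁ x₀ ^ 2 + k ^ 2 * Q x₀ ^ 2 with hEdef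
    -- Differentiating the transport relation, with `n - k = 2`, gives `2 Ψ' Q' + 2 n k Ψ Q = k Q²`.
    -- Multiplying by `k Q` and replacing `k Ψ' Q` by `n Ψ Q'` makes the conserved `E` appear.
    have hΨQ : ∀ x ∈ Ioo α β, 2 * n * E * Ψ x = k ^ 2 * Q x ^ 3 := by
      intro x hx
      have hd := ((((dΨ x hx).const_mul n).mul (dQ₁ x hx))).sub
        (((dΨ₁ x hx).const_mul k).mul (dQ x hx))
      have hz := hasDerivAt_eq_zero_of_eqOn isOpen_Ioo
        (fun y hy => sub_eq_zero.2 (htr y hy)) hx hd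
      have ht := htr x hx
      rw [← hE x hx]
      subst hnk
      linear_combination (k * Q x) * hz + 2 * Q₁ x * ht
    have hE0 : 0 ≤ E := by positivity
    rcases hE0.eq_or_lt with hE0 | hE0
    · left
      intro x hx
      have := hΨQ x hx
      rw [← hE0] at this
      have h3 : k ^ 2 * Q x ^ 3 = 0 := by linarith
      simpa [hk] using h3
    · right; right
      have hn0 : n ≠ 0 := by linarith
      have hΨ1 : ∀ x ∈ Ioo α β, 2 * n * E * Ψ₁ x = 3 * k ^ 2 * Q x ^ 2 * Q₁ x := by
        intro x hx
        have hd := ((dΨ x hx).const_mul (2 * n * E)).sub (((dQ x hx).pow 3).const_mul (k ^ 2))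
        have hz := hasDerivAt_eq_zero_of_eqOn isOpen_Ioo
          (fun y hy => sub_eq_zero.2 (hΨQ y hy)) hx hd
        simp at hz
        linear_combination hz
      -- The expression of `Ψ` as a multiple of `Q³` is put into `Ψ'' + n² Ψ = Q`, giving a linear
      -- term equal to a cubic one. One more derivative multiplies them by different factors, `1`
      -- and `3`, so both coefficients vanish where `Q Q' ≠ 0`: `n = 3 k²` and `n² = 9 k²`, whence
      -- `n = 3`.
      have hpoly : ∀ x ∈ Ioo α β, 2 * n * E * Q x - 6 * k ^ 2 * E * Q x =
          k ^ 2 * (n ^ 2 - 9 * k ^ 2) * Q x ^ 3 := by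
        intro x hx
        have hd := ((dΨ₁ x hx).const_mul (2 * n * E)).sub
          ((((dQ x hx).pow 2).const_mul (3 * k ^ 2)).mul (dQ₁ x hx))
        have hz := hasDerivAt_eq_zero_of_eqOn isOpen_Ioo
          (fun y hy => sub_eq_zero.2 (hΨ1 y hy)) hx hd
        have h1 := hE x hx
        have h2 := hΨQ x hx
        simp at hz
        linear_combination hz + n ^ 2 * h2 + 6 * k ^ 2 * Q x * h1
      have hpoly1 : ∀ x ∈ Ioo α β, 2 * n * E * Q₁ x - 6 * k ^ 2 * E * Q₁ x =
          3 * k ^ 2 * (n ^ 2 - 9 * k ^ 2) * Q x ^ 2 * Q₁ x := by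
        intro x hx
        have hd := (((dQ x hx).const_mul (2 * n * E)).sub ((dQ x hx).const_mul (6 * k ^ 2 * E))).sub
          (((dQ x hx).pow 3).const_mul (k ^ 2 * (n ^ 2 - 9 * k ^ 2)))
        have hz := hasDerivAt_eq_zero_of_eqOn isOpen_Ioo
          (fun y hy => sub_eq_zero.2 (hpoly y hy)) hx hd
        simp at hz
        linear_combination hz
      -- a nonconstant profile forces both coefficients to vanish
      have hQQ : ∃ x ∈ Ioo α β, Q x * Q₁ x ≠ 0 := by
        by_contra! hcon
        have hd : ∀ x ∈ Ioo α β, Q₁ x ^ 2 = k ^ 2 * Q x ^ 2 := by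
          intro x hx
          have hz := hasDerivAt_eq_zero_of_eqOn isOpen_Ioo hcon hx ((dQ x hx).mul (dQ₁ x hx))
          linear_combination hz
        have h1 := hd x₀ hx₀
        have h2 := hcon x₀ hx₀
        have h3 : Q x₀ ^ 2 * Q₁ x₀ ^ 2 = 0 := by rw [← mul_pow, h2]; ring
        rw [h1] at h3
        have h4 : Q x₀ = 0 := by
          have : k ^ 2 * Q x₀ ^ 4 = 0 := by linear_combination h3
          simpa [hk] using this
        rw [h4] at h1
        have h5 : Q₁ x₀ = 0 := by simpa using h1
        rw [h4, h5] at hEdef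
        simp at hEdef
        linarith
      obtain ⟨x, hx, hxQ⟩ := hQQ
      have hx0 : Q x ≠ 0 := left_ne_zero_of_mul hxQ
      have hx1 : Q₁ x ≠ 0 := right_ne_zero_of_mul hxQ
      have e1 : 2 * n * E - 6 * k ^ 2 * E = k ^ 2 * (n ^ 2 - 9 * k ^ 2) * Q x ^ 2 :=
        mul_right_cancel₀ hx0 (by linear_combination hpoly x hx)
      have e2 : 2 * n * E - 6 * k ^ 2 * E = 3 * (k ^ 2 * (n ^ 2 - 9 * k ^ 2) * Q x ^ 2) :=
        mul_right_cancel₀ hx1 (by linear_combination hpoly1 x hx)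
      have e3 : 2 * E * (n - 3 * k ^ 2) = 0 := by linear_combination (3 / 2 : ℝ) * e1 - 1 / 2 * e2
      have e4 : n - 3 * k ^ 2 = 0 := (mul_eq_zero.1 e3).resolve_left (by positivity)
      have e5 : k ^ 2 * Q x ^ 2 * (n ^ 2 - 9 * k ^ 2) = 0 := by
        linear_combination (1 / 2 : ℝ) * e1 - 1 / 2 * e2
      have e6 : n ^ 2 - 9 * k ^ 2 = 0 := (mul_eq_zero.1 e5).resolve_left (by positivity)
      have e7 : n * (n - 3) = 0 := by linear_combination e6 - 3 * e4
      have e8 : n = 3 := by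
        have := (mul_eq_zero.1 e7).resolve_left hn0
        linarith
      have e9 : k = 1 := by linarith
      refine ⟨e9, E, hE0, fun y hy => ⟨?_, ?_⟩⟩
      · have := hE y hy
        rw [e9] at this
        linarith
      · have := hΨQ y hy
        rw [e9, e8] at this
        linarith

/-- The stream function is `r^(lam+1) Ψ` and the vorticity `r^(lam-1) Q`; `hlin` says that the
vorticity is harmonic and `hquad` that it is transported. Irrotational fields of degree one and two
belong to the linear and quadratic families, which is why the power family omits these degrees. -/
lemma homogeneous_classified (hαβ : α < β) {lam : ℝ} (hlam : 0 < lam)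
    {a a₁ a₂ a₃ b b₁ b₂ b₃ : ℝ → ℝ} (ja : Jet (Ioo α β) a a₁ a₂ a₃)
    (jb : Jet (Ioo α β) b b₁ b₂ b₃)
    (hdiv : ∀ θ ∈ Ioo α β, lam * Real.cos θ * a θ - Real.sin θ * a₁ θ + lam * Real.sin θ * b θ +
      Real.cos θ * b₁ θ = 0)
    (hlin : ∀ θ ∈ Ioo α β, (lam - 1) ^ 2 * (lam * (Real.cos θ * b θ - Real.sin θ * a θ)
      - Real.sin θ * b₁ θ - Real.cos θ * a₁ θ) +
      (lam * ((-Real.cos θ * b θ - 2 * Real.sin θ * b₁ θ + Real.cos θ * b₂ θ)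
        - (-Real.sin θ * a θ + 2 * Real.cos θ * a₁ θ + Real.sin θ * a₂ θ))
      - (-Real.sin θ * b₁ θ + 2 * Real.cos θ * b₂ θ + Real.sin θ * b₃ θ)
      - (-Real.cos θ * a₁ θ - 2 * Real.sin θ * a₂ θ + Real.cos θ * a₃ θ)) = 0)
    (hquad : ∀ θ ∈ Ioo α β, (Real.cos θ * a θ + Real.sin θ * b θ) * ((lam - 1) *
      (lam * (Real.cos θ * b θ - Real.sin θ * a θ) - Real.sin θ * b₁ θ - Real.cos θ * a₁ θ)) +
      (-Real.sin θ * a θ + Real.cos θ * b θ) *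
      (lam * ((-Real.sin θ * b θ + Real.cos θ * b₁ θ) - (Real.cos θ * a θ + Real.sin θ * a₁ θ))
        - (Real.cos θ * b₁ θ + Real.sin θ * b₂ θ) - (-Real.sin θ * a₁ θ + Real.cos θ * a₂ θ)) = 0) :
    IsClassified α β (fun t θ => Real.exp (lam * t) * a θ) (fun t θ => Real.exp (lam * t) * b θ) := by
  have hn : lam + 1 ≠ 0 := by positivity
  set Ψ : ℝ → ℝ := fun θ => (Real.cos θ * b θ - Real.sin θ * a θ) / (lam + 1) with hΨ
  set Ψ₁ : ℝ → ℝ := fun θ => -(Real.cos θ * a θ + Real.sin θ * b θ) with hΨ₁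
  set Q : ℝ → ℝ := fun θ => lam * (Real.cos θ * b θ - Real.sin θ * a θ)
    - Real.sin θ * b₁ θ - Real.cos θ * a₁ θ with hQ
  set Q₁ : ℝ → ℝ := fun θ => lam * ((-Real.sin θ * b θ + Real.cos θ * b₁ θ)
    - (Real.cos θ * a θ + Real.sin θ * a₁ θ))
        - (Real.cos θ * b₁ θ + Real.sin θ * b₂ θ) - (-Real.sin θ * a₁ θ + Real.cos θ * a₂ θ) with hQ₁
  have hWa : ∀ θ, a θ = -Real.cos θ * Ψ₁ θ - (lam + 1) * Real.sin θ * Ψ θ := by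
    intro θ
    simp only [hΨ, hΨ₁]
    field_simp
    linear_combination -a θ * Real.sin_sq_add_cos_sq θ
  have hWb : ∀ θ, b θ = -Real.sin θ * Ψ₁ θ + (lam + 1) * Real.cos θ * Ψ θ := by
    intro θ
    simp only [hΨ, hΨ₁]
    field_simp
    linear_combination -b θ * Real.sin_sq_add_cos_sq θ
  have hc := Real.hasDerivAt_cos
  have hs := Real.hasDerivAt_sin
  have dΨ : ∀ x ∈ Ioo α β, HasDerivAt Ψ (Ψ₁ x) x := by
    intro x hx
    have := (((hc x).mul (jb.d0 x hx)).sub ((hs x).mul (ja.d0 x hx))).div_const (lam + 1)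
    refine this.congr_deriv ?_
    simp only [hΨ₁]
    field_simp
    linear_combination hdiv x hx
  have dΨ₁ : ∀ x ∈ Ioo α β, HasDerivAt Ψ₁ (Q x - (lam + 1) ^ 2 * Ψ x) x := by
    intro x hx
    have := (((hc x).mul (ja.d0 x hx)).add ((hs x).mul (jb.d0 x hx))).neg
    refine this.congr_deriv ?_
    simp only [hQ, hΨ]
    field_simp
    ring
  have dQ : ∀ x ∈ Ioo α β, HasDerivAt Q (Q₁ x) x := by
    intro x hx
    have := (((((hc x).mul (jb.d0 x hx)).sub ((hs x).mul (ja.d0 x hx))).const_mul lam).sub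
      ((hs x).mul (jb.d1 x hx))).sub ((hc x).mul (ja.d1 x hx))
    refine this.congr_deriv ?_
    simp only [hQ₁]
  have dQ₁ : ∀ x ∈ Ioo α β, HasDerivAt Q₁ (-(lam - 1) ^ 2 * Q x) x := by
    intro x hx
    have := ((((((hs x).neg.mul (jb.d0 x hx)).add ((hc x).mul (jb.d1 x hx))).sub
      (((hc x).mul (ja.d0 x hx)).add ((hs x).mul (ja.d1 x hx)))).const_mul lam).sub
      (((hc x).mul (jb.d1 x hx)).add ((hs x).mul (jb.d2 x hx)))).sub
      (((hs x).neg.mul (ja.d1 x hx)).add ((hc x).mul (ja.d2 x hx)))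
    refine this.congr_deriv ?_
    simp only [hQ, Pi.neg_apply]
    linear_combination hlin x hx
  have htr : ∀ x ∈ Ioo α β, (lam + 1) * Ψ x * Q₁ x = (lam - 1) * Ψ₁ x * Q x := by
    intro x hx
    have h1 : (lam + 1) * Ψ x = Real.cos x * b x - Real.sin x * a x := by
      simp only [hΨ]; field_simp
    rw [h1]
    simp only [hΨ₁]
    linear_combination hquad x hx
  rcases homogeneous_profiles hαβ (by ring) (by linarith) dΨ dΨ₁ dQ dQ₁ htr with
    h0 | ⟨hk, q, hq⟩ | ⟨hk, E, hE, hQE⟩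
  · obtain ⟨A, B, hAB⟩ := oscillator hn hαβ dΨ (fun x hx => by
      simpa [h0 x hx] using dΨ₁ x hx)
    have hab : ∀ θ ∈ Ioo α β,
        a θ = -((lam + 1) * B) * Real.cos (lam * θ) + (lam + 1) * A * Real.sin (lam * θ) ∧
        b θ = (lam + 1) * A * Real.cos (lam * θ) - -((lam + 1) * B) * Real.sin (lam * θ) := by
      intro θ hθ
      obtain ⟨e1, e2⟩ := hAB θ hθ
      have e3 : lam * θ = (lam + 1) * θ - θ := by ring
      constructor
      · rw [hWa θ, e1, e2, e3, Real.cos_sub, Real.sin_sub]; ring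
      · rw [hWb θ, e1, e2, e3, Real.cos_sub, Real.sin_sub]; ring
    rcases eq_or_ne lam 1 with h1 | h1
    · subst h1
      refine Or.inr (Or.inl ⟨-((1 + 1) * B), (1 + 1) * A, (1 + 1) * A, fun t θ hθ => ?_⟩)
      obtain ⟨e1, e2⟩ := hab θ hθ
      simp only [e1, e2, one_mul, and_self]
    · rcases eq_or_ne lam 2 with h2 | h2
      · subst h2
        refine Or.inr (Or.inr (Or.inl ⟨0, 0, -((2 + 1) * B), (2 + 1) * A, by ring, by ring,
          fun t θ hθ => ?_⟩))
        obtain ⟨e1, e2⟩ := hab θ hθ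
        simp only [e1, e2, Real.cos_two_mul', Real.sin_two_mul]
        constructor <;> ring
      · refine Or.inr (Or.inr (Or.inr (Or.inl ⟨-((lam + 1) * B), (lam + 1) * A, lam, ?_, fun t θ hθ => ?_⟩)))
        rotate_left
        · exact ⟨congrArg (Real.exp (lam * t) * ·) (hab θ hθ).1,
            congrArg (Real.exp (lam * t) * ·) (hab θ hθ).2⟩
        · rcases lt_or_gt_of_ne h1 with h1 | h1
          · exact Or.inl (Or.inl ⟨hlam, h1⟩)
          · rcases lt_or_gt_of_ne h2 with h2 | h2
            · exact Or.inl (Or.inr ⟨h1, h2⟩)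
            · exact Or.inr h2
  · have hl : lam = 1 := by linarith
    subst hl
    obtain ⟨A, B, hAB⟩ := oscillator (f := fun x => Ψ x - q / 4) hn hαβ
      (fun x hx => (dΨ x hx).sub_const _) (fun x hx => (dΨ₁ x hx).congr_deriv (by
        rw [hq x hx]; ring))
    refine Or.inr (Or.inl ⟨-2 * B, 2 * A - q / 2, 2 * A + q / 2, fun t θ hθ => ?_⟩)
    obtain ⟨e1, e2⟩ := hAB θ hθ
    have e4 : Ψ θ = A * Real.cos ((1 + 1) * θ) + B * Real.sin ((1 + 1) * θ) + q / 4 := by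
      linear_combination e1
    have e3 : (1 + 1) * θ = 2 * θ := by ring
    have hcs := Real.sin_sq_add_cos_sq θ
    simp only [hWa θ, hWb θ, e4, e2, e3, Real.cos_two_mul', Real.sin_two_mul, one_mul]
    constructor
    · linear_combination (Real.exp t * (2 * A * Real.sin θ - 2 * B * Real.cos θ)) * hcs
    · linear_combination (Real.exp t * (2 * A * Real.cos θ + 2 * B * Real.sin θ)) * hcs
  · have hl : lam = 2 := by linarith
    subst hl
    obtain ⟨A, B, hAB⟩ := oscillator (f := Q) one_ne_zero hαβ dQ (fun x hx => by
      refine (dQ₁ x hx).congr_deriv ?_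
      ring)
    simp only [one_mul, neg_mul] at hAB
    have hEAB : E = A ^ 2 + B ^ 2 := by
      obtain ⟨x, hx⟩ := nonempty_Ioo.2 hαβ
      rw [← (hQE x hx).1, (hAB x hx).1, (hAB x hx).2]
      linear_combination (A ^ 2 + B ^ 2) * Real.sin_sq_add_cos_sq x
    have hE' : A ^ 2 + B ^ 2 ≠ 0 := by rw [← hEAB]; exact hE.ne'
    have hΨ1' : ∀ x ∈ Ioo α β, 2 * E * Ψ₁ x = Q x ^ 2 * Q₁ x := by
      intro x hx
      have hd := ((dΨ x hx).const_mul (6 * E)).sub ((dQ x hx).pow 3)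
      have hz := hasDerivAt_eq_zero_of_eqOn isOpen_Ioo
        (fun y hy => sub_eq_zero.2 (hQE y hy).2) hx hd
      simp at hz
      linear_combination (1 / 3 : ℝ) * hz
    -- Here `r Q = A x + B y`, and the velocity turns out to be `(-B, A) (A x + B y)² / (2 (A² +
    -- B²))`, a parallel flow with parabolic profile. The four constants come from matching its
    -- coefficients with the quadratic family.
    refine Or.inr (Or.inr (Or.inl ⟨-A / 8, -B / 8, -B * A ^ 2 / (2 * (A ^ 2 + B ^ 2)) + B / 8,
      -A * B ^ 2 / (2 * (A ^ 2 + B ^ 2)) + A / 8, by field_simp; ring, by field_simp; ring,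
      fun t θ hθ => ?_⟩))
    have e1 : Ψ θ = Q θ ^ 3 / (6 * (A ^ 2 + B ^ 2)) := by
      rw [← hEAB, eq_div_iff (by positivity), ← (hQE θ hθ).2]; ring
    have e2 : Ψ₁ θ = Q θ ^ 2 * Q₁ θ / (2 * (A ^ 2 + B ^ 2)) := by
      rw [← hEAB, eq_div_iff (by positivity), ← hΨ1' θ hθ]; ring
    have hcs := Real.sin_sq_add_cos_sq θ
    have hab : a θ = -B * Q θ ^ 2 / (2 * (A ^ 2 + B ^ 2)) ∧
        b θ = A * Q θ ^ 2 / (2 * (A ^ 2 + B ^ 2)) := by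
      have g1 : Real.cos θ * Q₁ θ + Real.sin θ * Q θ = B := by
        rw [(hAB θ hθ).1, (hAB θ hθ).2]; linear_combination B * hcs
      have g2 : -Real.sin θ * Q₁ θ + Real.cos θ * Q θ = A := by
        rw [(hAB θ hθ).1, (hAB θ hθ).2]; linear_combination A * hcs
      constructor
      · rw [hWa, e1, e2, ← g1]
        generalize (A ^ 2 + B ^ 2) = D at hE' ⊢
        field_simp
        ring
      · rw [hWb, e1, e2, ← g2]
        generalize (A ^ 2 + B ^ 2) = D at hE' ⊢
        field_simp
        ring
    simp only [hab.1, hab.2, (hAB θ hθ).1]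
    constructor
    · field_simp; ring
    · field_simp; ring

end Homogeneous

/-! ### Swirling flows and dependent radial factors -/

section

variable {α β : ℝ}

lemma exists_sin_mul_cos_ne_zero (hαβ : α < β) :
    ∃ θ ∈ Ioo α β, Real.sin θ * Real.cos θ ≠ 0 := by
  by_contra! h
  obtain ⟨x, hx⟩ := nonempty_Ioo.2 hαβ
  have := eq_zero_of_sin_mul_cos_mul (F := fun _ => 1) isOpen_Ioo continuousOn_const
    (fun θ hθ => by rw [h θ hθ]; ring) hx
  exact one_ne_zero this

lemma eq_exp_of_deriv {f f₁ : ℝ → ℝ} {lam : ℝ} (hf : ∀ x, HasDerivAt f (f₁ x) x)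
    (h : ∀ x, f₁ x = lam * f x) (x : ℝ) : f x = f 0 * Real.exp (lam * x) := by
  have he : ∀ y, HasDerivAt (fun z => Real.exp (-(lam * z))) (-lam * Real.exp (-(lam * y))) y := by
    intro y
    have := ((hasDerivAt_id y).const_mul lam).neg.exp
    refine this.congr_deriv ?_
    simp; ring
  have hz : ∀ y, HasDerivAt (fun z => f z * Real.exp (-(lam * z))) 0 y := by
    intro y
    refine ((hf y).mul (he y)).congr_deriv ?_
    rw [h y]; ring
  have := const_of_hasDerivAt_zero_univ hz x 0
  simp only [mul_zero, neg_zero, Real.exp_zero, mul_one] at this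
  rw [← this, mul_assoc, ← Real.exp_add]
  simp

lemma tendsto_exp_const_mul_atBot {lam : ℝ} (h : 0 < lam) :
    Tendsto (fun t => Real.exp (lam * t)) atBot (𝓝 0) :=
  Real.tendsto_exp_atBot.comp (tendsto_id.const_mul_atBot h)

lemma not_tendsto_exp_neg {C lam l : ℝ} (hC : C ≠ 0) (h : lam < 0) :
    ¬ Tendsto (fun t => C * Real.exp (lam * t)) atBot (𝓝 l) := by
  intro ht
  have h1 := ht.mul (tendsto_exp_const_mul_atBot (lam := -lam) (by linarith))
  have h2 : (fun t => C * Real.exp (lam * t) * Real.exp (-lam * t)) = fun _ => C := by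
    funext t
    rw [mul_assoc, ← Real.exp_add]
    simp
  rw [h2, mul_zero] at h1
  exact hC (tendsto_nhds_unique tendsto_const_nhds h1)

lemma tendsto_mul_exp_two_atBot :
    Tendsto (fun t : ℝ => t * Real.exp (2 * t)) atBot (𝓝 0) := by
  have h1 := (Real.tendsto_pow_mul_exp_neg_atTop_nhds_zero 1).comp tendsto_neg_atBot_atTop
  have h2 := (h1.neg).mul (Real.tendsto_exp_atBot)
  simp only [neg_zero, mul_zero] at h2
  refine h2.congr fun t => ?_
  simp only [Function.comp, pow_one, neg_neg]
  rw [show 2 * t = t + t by ring, Real.exp_add]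
  ring

variable {v v₁ v₂ v₃ w w₁ w₂ w₃ φ φ₁ φ₂ φ₃ χ χ₁ χ₂ χ₃ : ℝ → ℝ}

/-- Differentiating `h2` leaves `cos θ (w'' + w) = 0`, hence `w'' + w = 0` because the zeros of
`cos` are isolated. Then `h2` itself kills the sine component. -/
lemma swirl_profiles (hαβ : α < β) (jv : Jet (Ioo α β) v v₁ v₂ v₃) (jw : Jet (Ioo α β) w w₁ w₂ w₃)
    {k : ℝ} (h1 : ∀ θ ∈ Ioo α β, Real.cos θ * v θ = k * (Real.sin θ * w θ))
    (h2 : ∀ θ ∈ Ioo α β, Real.cos θ * w₁ θ + Real.sin θ * w θ = 0) :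
    ∃ a, ∀ θ ∈ Ioo α β, w θ = a * Real.cos θ ∧ w₁ θ = -a * Real.sin θ ∧
      v θ = k * a * Real.sin θ := by
  have hw2 : ∀ θ ∈ Ioo α β, w₂ θ + w θ = 0 := by
    intro θ hθ
    refine eq_zero_of_sin_mul_cos_mul (F := fun θ => w₂ θ + w θ) isOpen_Ioo
      (jw.contOn₂.add jw.contOn) (fun x hx => ?_) hθ
    have hd := ((Real.hasDerivAt_cos x).mul (jw.d1 x hx)).add
      ((Real.hasDerivAt_sin x).mul (jw.d0 x hx))
    have := hasDerivAt_eq_zero_of_eqOn isOpen_Ioo h2 hx hd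
    linear_combination Real.sin x * this
  obtain ⟨A, B, hAB⟩ := oscillator one_ne_zero hαβ jw.d0 (fun x hx => (jw.d1 x hx).congr_deriv (by
    linear_combination hw2 x hx))
  have hB : B = 0 := by
    obtain ⟨x, hx⟩ := nonempty_Ioo.2 hαβ
    obtain ⟨e1, e2⟩ := hAB x hx
    have := h2 x hx
    rw [e1, e2] at this
    simp only [one_mul] at this
    linear_combination this - B * Real.sin_sq_add_cos_sq x
  refine ⟨A, fun θ hθ => ?_⟩
  have e0 : ∀ θ ∈ Ioo α β, w θ = A * Real.cos θ := fun θ hθ => by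
    simpa [hB] using (hAB θ hθ).1
  refine ⟨e0 θ hθ, by simpa [hB] using (hAB θ hθ).2, ?_⟩
  have := eq_zero_of_sin_mul_cos_mul (F := fun θ => v θ - k * A * Real.sin θ) isOpen_Ioo
      (jv.contOn.sub (by fun_prop)) (fun x hx => ?_) hθ
  · linarith
  · have h := h1 x hx
    rw [e0 x hx] at h
    linear_combination Real.sin x * h

/-- The field is `(P(t) sin θ, X(t) cos θ)`, and incompressibility says that `P + X` is a multiple
`K exp t`. The vorticity equation gives `P'' - P = m exp t` with `K m = 0`. If `K = 0` the flow is
circular and may contain a logarithm; if `m = 0` it is linear. -/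
lemma swirl_classified (hαβ : α < β)
    (S : SepSystem α β v v₁ v₂ v₃ w w₁ w₂ w₃ φ φ₁ φ₂ φ₃ χ χ₁ χ₂ χ₃)
    {k : ℝ} (h1 : ∀ θ ∈ Ioo α β, Real.cos θ * v θ = k * (Real.sin θ * w θ))
    (h2 : ∀ θ ∈ Ioo α β, Real.cos θ * w₁ θ + Real.sin θ * w θ = 0) :
    IsClassified α β (fun t θ => v θ * φ t) (fun t θ => w θ * χ t) := by
  obtain ⟨a, ha⟩ := swirl_profiles hαβ S.jv S.jw h1 h2
  obtain ⟨θ₀, hθ₀, hsc⟩ := exists_sin_mul_cos_ne_zero hαβ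
  have hw : ∀ θ ∈ Ioo α β, w θ = a * Real.cos θ := fun θ hθ => (ha θ hθ).1
  have hw1 : ∀ θ ∈ Ioo α β, w₁ θ = -a * Real.sin θ := fun θ hθ => (ha θ hθ).2.1
  have hv : ∀ θ ∈ Ioo α β, v θ = k * a * Real.sin θ := fun θ hθ => (ha θ hθ).2.2
  have hw2 : ∀ θ ∈ Ioo α β, w₂ θ = -a * Real.cos θ := fun θ hθ => by
    have := hasDerivAt_eq_zero_of_eqOn isOpen_Ioo (c := 0)
      (fun y hy => sub_eq_zero.2 (hw1 y hy)) hθ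
      ((S.jw.d1 θ hθ).sub ((Real.hasDerivAt_sin θ).const_mul (-a)))
    linarith
  have hw3 : ∀ θ ∈ Ioo α β, w₃ θ = a * Real.sin θ := fun θ hθ => by
    have := hasDerivAt_eq_zero_of_eqOn isOpen_Ioo (c := 0)
      (fun y hy => sub_eq_zero.2 (hw2 y hy)) hθ
      ((S.jw.d2 θ hθ).sub ((Real.hasDerivAt_cos θ).const_mul (-a)))
    linarith
  have hv1 : ∀ θ ∈ Ioo α β, v₁ θ = k * a * Real.cos θ := fun θ hθ => by
    have := hasDerivAt_eq_zero_of_eqOn isOpen_Ioo (c := 0)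
      (fun y hy => sub_eq_zero.2 (hv y hy)) hθ
      ((S.jv.d0 θ hθ).sub ((Real.hasDerivAt_sin θ).const_mul (k * a)))
    linarith
  have hv2 : ∀ θ ∈ Ioo α β, v₂ θ = -(k * a) * Real.sin θ := fun θ hθ => by
    have := hasDerivAt_eq_zero_of_eqOn isOpen_Ioo (c := 0)
      (fun y hy => sub_eq_zero.2 (hv1 y hy)) hθ
      ((S.jv.d1 θ hθ).sub ((Real.hasDerivAt_cos θ).const_mul (k * a)))
    linarith
  have hv3 : ∀ θ ∈ Ioo α β, v₃ θ = -(k * a) * Real.cos θ := fun θ hθ => by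
    have := hasDerivAt_eq_zero_of_eqOn isOpen_Ioo (c := 0)
      (fun y hy => sub_eq_zero.2 (hv2 y hy)) hθ
      ((S.jv.d2 θ hθ).sub ((Real.hasDerivAt_sin θ).const_mul (-(k * a))))
    linarith
  -- the two radial profiles `P = k a φ` and `X = a χ` satisfy `(P + X)' = P + X`
  have hS : ∀ t, k * a * φ₁ t + a * χ₁ t - (k * a * φ t + a * χ t) = 0 := by
    intro t
    have := S.div t θ₀ hθ₀
    rw [hv θ₀ hθ₀, hw θ₀ hθ₀, hv1 θ₀ hθ₀, hw1 θ₀ hθ₀] at this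
    refine (mul_eq_zero.1 ?_).resolve_left hsc
    linear_combination this
  have dP0 : ∀ t, HasDerivAt (fun t => k * a * φ t) (k * a * φ₁ t) t :=
    fun t => (S.jφ.d0 t trivial).const_mul _
  have dP1 : ∀ t, HasDerivAt (fun t => k * a * φ₁ t) (k * a * φ₂ t) t :=
    fun t => (S.jφ.d1 t trivial).const_mul _
  have dP2 : ∀ t, HasDerivAt (fun t => k * a * φ₂ t) (k * a * φ₃ t) t :=
    fun t => (S.jφ.d2 t trivial).const_mul _
  have dX0 : ∀ t, HasDerivAt (fun t => a * χ t) (a * χ₁ t) t :=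
    fun t => (S.jχ.d0 t trivial).const_mul _
  have dX1 : ∀ t, HasDerivAt (fun t => a * χ₁ t) (a * χ₂ t) t :=
    fun t => (S.jχ.d1 t trivial).const_mul _
  have dX2 : ∀ t, HasDerivAt (fun t => a * χ₂ t) (a * χ₃ t) t :=
    fun t => (S.jχ.d2 t trivial).const_mul _
  have hS1 : ∀ t, k * a * φ₂ t + a * χ₂ t - (k * a * φ₁ t + a * χ₁ t) = 0 := fun t =>
    hasDerivAt_eq_zero_of_eqOn isOpen_univ (fun y _ => hS y) (mem_univ t)
      (((dP1 t).add (dX1 t)).sub ((dP0 t).add (dX0 t)))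
  have hS2 : ∀ t, k * a * φ₃ t + a * χ₃ t - (k * a * φ₂ t + a * χ₂ t) = 0 := fun t =>
    hasDerivAt_eq_zero_of_eqOn isOpen_univ (fun y _ => hS1 y) (mem_univ t)
      (((dP2 t).add (dX2 t)).sub ((dP1 t).add (dX1 t)))
  obtain ⟨K, hK⟩ : ∃ K, ∀ t, k * a * φ t + a * χ t = K * Real.exp t := by
    refine ⟨k * a * φ 0 + a * χ 0, fun t => ?_⟩
    have := eq_exp_of_deriv (lam := 1) (fun t => (dP0 t).add (dX0 t))
      (fun t => by simp only [Pi.add_apply]; linear_combination hS t) t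
    simpa using this
  set P : ℝ → ℝ := fun t => k * a * φ t with hP
  set P₁ : ℝ → ℝ := fun t => k * a * φ₁ t with hP₁
  set P₂ : ℝ → ℝ := fun t => k * a * φ₂ t with hP₂
  set P₃ : ℝ → ℝ := fun t => k * a * φ₃ t with hP₃
  have hvort : ∀ t, ∀ θ ∈ Ioo α β, (P₁ t - P₃ t) - (P t - P₂ t) =
      (Real.sin θ * Real.cos θ) * (K * Real.exp t ^ 2 * (P t - P₂ t)) := by
    intro t θ hθ
    have h := S.vort t θ hθ
    rw [hv θ hθ, hw θ hθ, hv1 θ hθ, hw1 θ hθ, hv2 θ hθ, hw2 θ hθ, hv3 θ hθ, hw3 θ hθ] at h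
    have e0 : a * χ t = K * Real.exp t - P t := by linear_combination hK t
    have e1 : a * χ₁ t = K * Real.exp t - P₁ t := by linear_combination hK t + hS t
    have e2 : a * χ₂ t = K * Real.exp t - P₂ t := by linear_combination hK t + hS t + hS1 t
    have e3 : a * χ₃ t = K * Real.exp t - P₃ t := by
      linear_combination hK t + hS t + hS1 t + hS2 t
    have hc2 : Real.cos θ ^ 2 = 1 - Real.sin θ ^ 2 := by
      linear_combination Real.sin_sq_add_cos_sq θ
    have h' : (Real.cos θ ^ 2 * (a * χ₃ t) + Real.sin θ ^ 2 * (a * χ₂ t)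
        - Real.sin θ ^ 2 * P₃ t - Real.cos θ ^ 2 * P₂ t)
      - 2 * (Real.cos θ ^ 2 * (a * χ₂ t) + Real.sin θ ^ 2 * (a * χ₁ t)
        - Real.sin θ ^ 2 * P₂ t - Real.cos θ ^ 2 * P₁ t)
      + (Real.cos θ ^ 2 * (a * χ₁ t) + Real.sin θ ^ 2 * (a * χ t)
        - Real.sin θ ^ 2 * P₁ t - Real.cos θ ^ 2 * P t)
      + ((-2 * Real.cos θ ^ 2 + 2 * Real.sin θ ^ 2) * (a * χ₁ t)
        - (2 * Real.sin θ ^ 2 - 2 * Real.cos θ ^ 2) * (a * χ t)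
        - (-2 * Real.sin θ ^ 2 + 2 * Real.cos θ ^ 2) * P₁ t
        - (2 * Real.sin θ ^ 2 - 2 * Real.cos θ ^ 2) * P t)
      = Real.exp t * ((Real.sin θ * Real.cos θ) * (P t + a * χ t) *
        ((Real.cos θ ^ 2 * (a * χ₂ t) + Real.sin θ ^ 2 * (a * χ₁ t)
          - Real.sin θ ^ 2 * P₂ t - Real.cos θ ^ 2 * P₁ t)
        - (Real.cos θ ^ 2 * (a * χ₁ t) + Real.sin θ ^ 2 * (a * χ t)
          - Real.sin θ ^ 2 * P₁ t - Real.cos θ ^ 2 * P t))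
        + (-Real.sin θ ^ 2 * P t + Real.cos θ ^ 2 * (a * χ t)) *
          (-2 * (Real.sin θ * Real.cos θ) * (a * χ₁ t) + 2 * (Real.sin θ * Real.cos θ) * (a * χ t)
          - 2 * (Real.sin θ * Real.cos θ) * P₁ t + 2 * (Real.sin θ * Real.cos θ) * P t)) := by
      simp only [hP, hP₁, hP₂, hP₃]
      linear_combination h
    rw [e0, e1, e2, e3, hc2] at h'
    linear_combination h'
  -- The left side of `hvort` is independent of `θ`, so `sin θ cos θ · Z` is constant in `θ`. Its
  -- second derivative is `-4 sin θ cos θ · Z`, hence `Z = 0`.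
  have hKH : ∀ t, K * Real.exp t ^ 2 * (P t - P₂ t) = 0 := by
    intro t
    set Z := K * Real.exp t ^ 2 * (P t - P₂ t) with hZ
    have d1 : ∀ θ ∈ Ioo α β, (Real.cos θ * Real.cos θ + Real.sin θ * -Real.sin θ) * Z = 0 := by
      intro θ hθ
      exact hasDerivAt_eq_zero_of_eqOn isOpen_Ioo (fun y hy => (hvort t y hy).symm) hθ
        (((Real.hasDerivAt_sin θ).mul (Real.hasDerivAt_cos θ)).mul_const Z)
    have d2 := hasDerivAt_eq_zero_of_eqOn isOpen_Ioo d1 hθ₀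
      ((((Real.hasDerivAt_cos θ₀).mul (Real.hasDerivAt_cos θ₀)).add
        ((Real.hasDerivAt_sin θ₀).mul (Real.hasDerivAt_sin θ₀).neg)).mul_const Z)
    have d3 := d1 θ₀ hθ₀
    have : (Real.sin θ₀ * Real.cos θ₀) * Z = 0 := by
      simp only [Pi.neg_apply] at d2
      linear_combination (-1 / 4 : ℝ) * d2
    exact (mul_eq_zero.1 this).resolve_left hsc
  have hH : ∀ t, (P₁ t - P₃ t) = 1 * (P t - P₂ t) := by
    intro t
    have := hvort t θ₀ hθ₀
    rw [hKH t] at this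
    linear_combination this
  have hm := eq_exp_of_deriv (fun t => (dP0 t).sub (dP2 t)) hH
  simp only [Pi.sub_apply, one_mul] at hm
  set m := -(P 0 - P₂ 0) with hmdef
  have hm' : ∀ t, P₂ t - P t = m * Real.exp t := fun t => by
    have := hm t
    linear_combination -this
  have hKm : K * m = 0 := by
    have := hKH 0
    simp only [Real.exp_zero, one_pow, mul_one] at this
    rw [hmdef]; linear_combination -this
  have hexp : ∀ t, Real.exp (-t) * Real.exp t = 1 := fun t => by rw [← Real.exp_add]; simp
  have hen : ∀ t, HasDerivAt (fun τ => Real.exp (-τ)) (-Real.exp (-t)) t := fun t => by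
    simpa using (hasDerivAt_neg t).exp
  -- The operator factors as `(D - 1)(D + 1)`: `P + P'` and `P - P'` each solve a first-order
  -- equation, integrated here and in `hb`. Together they give `P` explicitly.
  have hq : ∀ t, (P t + P₁ t) * Real.exp (-t) - m * t = P 0 + P₁ 0 := by
    intro t
    have hz : ∀ t, HasDerivAt (fun t => (P t + P₁ t) * Real.exp (-t) - m * t) 0 t := by
      intro t
      refine ((((dP0 t).add (dP1 t)).mul (hen t)).sub ((hasDerivAt_id t).const_mul m)).congr_deriv ?_
      simp only [Pi.add_apply]
      linear_combination Real.exp (-t) * hm' t + m * hexp t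
    have := const_of_hasDerivAt_zero_univ hz t 0
    simpa using this
  have hb : ∀ t, (P t - P₁ t) * Real.exp t + m / 2 * Real.exp t ^ 2 = P 0 - P₁ 0 + m / 2 := by
    intro t
    have hz : ∀ t, HasDerivAt (fun t => (P t - P₁ t) * Real.exp t + m / 2 * Real.exp t ^ 2) 0 t := by
      intro t
      refine ((((dP0 t).sub (dP1 t)).mul (Real.hasDerivAt_exp t)).add
        (((Real.hasDerivAt_exp t).pow 2).const_mul (m / 2))).congr_deriv ?_
      simp only [Pi.sub_apply]
      push_cast
      linear_combination -Real.exp t * hm' t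
    have := const_of_hasDerivAt_zero_univ hz t 0
    simpa using this
  set q := P 0 + P₁ 0 with hqdef
  set b := P 0 - P₁ 0 + m / 2 with hbdef
  have hPt : ∀ t, 2 * P t * Real.exp t = (m * t + q - m / 2) * Real.exp t ^ 2 + b := by
    intro t
    linear_combination Real.exp t ^ 2 * hq t + hb t - (P t + P₁ t) * Real.exp t * hexp t
  -- The constant `b` is the amplitude of the `exp (-t)` mode in `P`, incompatible with a finite
  -- limit at the vertex.
  have hb0 : b = 0 := by
    obtain ⟨l, hl, -⟩ := S.limφ
    have t1 : Tendsto (fun t => 2 * (k * a * φ t) * Real.exp t) atBot (𝓝 0) := by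
      have := ((hl.const_mul (k * a)).const_mul 2).mul Real.tendsto_exp_atBot
      simpa using this
    have e2 : ∀ t, Real.exp t ^ 2 = Real.exp (2 * t) := fun t => by
      rw [← Real.exp_nat_mul]; norm_num
    have t2 : Tendsto (fun t => (m * t + q - m / 2) * Real.exp t ^ 2) atBot (𝓝 0) := by
      have := (tendsto_mul_exp_two_atBot.const_mul m).add
        ((tendsto_exp_const_mul_atBot (lam := 2) (by norm_num)).const_mul (q - m / 2))
      simp only [mul_zero, add_zero] at this
      refine this.congr fun t => ?_
      rw [e2]; ring
    have t3 := t1.sub t2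
    have : (fun t => 2 * (k * a * φ t) * Real.exp t - (m * t + q - m / 2) * Real.exp t ^ 2) =
        fun _ => b := by
      funext t
      have := hPt t
      simp only [hP] at this
      linarith
    rw [this, sub_zero] at t3
    exact tendsto_nhds_unique tendsto_const_nhds t3
  have hPf : ∀ t, P t = ((q - m / 2) / 2 + m / 2 * t) * Real.exp t := by
    intro t
    have := hPt t
    rw [hb0] at this
    apply mul_right_cancel₀ (Real.exp_pos t).ne'
    linear_combination this / 2
  have hU : ∀ t, ∀ θ ∈ Ioo α β, v θ * φ t = Real.sin θ * P t := fun t θ hθ => by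
    rw [hv θ hθ]; simp only [hP]; ring
  have hV : ∀ t, ∀ θ ∈ Ioo α β, w θ * χ t = Real.cos θ * (K * Real.exp t - P t) := fun t θ hθ => by
    rw [hw θ hθ]; linear_combination Real.cos θ * hK t
  rcases mul_eq_zero.1 hKm with h0 | h0
  · refine Or.inr (Or.inr (Or.inr (Or.inr (Or.inl ⟨-((q - m / 2) / 2), -(m / 2),
      fun t θ hθ => ⟨?_, ?_⟩⟩))))
    · simp only [hU t θ hθ, hPf t]; ring
    · simp only [hV t θ hθ, hPf t, h0]; ring
  · refine Or.inr (Or.inl ⟨0, q / 2, K - q / 2, fun t θ hθ => ⟨?_, ?_⟩⟩)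
    · simp only [hU t θ hθ, hPf t, h0]; ring
    · simp only [hV t θ hθ, hPf t, h0]; ring

/-- If the radial velocity vanishes, the flow is a swirl with `k = -1`. Otherwise the divergence
equation at an angle where its profile is nonzero makes `φ` an exponential. A negative exponent
contradicts `limφ`. For exponent zero the limit is nonzero, so `limφ` and `limχ` make the velocity
constant. -/
lemma dependent_classified (hαβ : α < β)
    (S : SepSystem α β v v₁ v₂ v₃ w w₁ w₂ w₃ φ φ₁ φ₂ φ₃ φ φ₁ φ₂ φ₃) :
    IsClassified α β (fun t θ => v θ * φ t) (fun t θ => w θ * φ t) := by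
  by_cases hφ : ∀ t, φ t = 0
  · exact Or.inl ⟨0, 0, fun t θ _ => by simp [hφ t]⟩
  push Not at hφ
  obtain ⟨t₀, ht₀⟩ := hφ
  by_cases hα : ∀ θ ∈ Ioo α β, Real.cos θ * v θ + Real.sin θ * w θ = 0
  · have hβ : ∀ θ ∈ Ioo α β, Real.cos θ * w₁ θ - Real.sin θ * v₁ θ = 0 := by
      intro θ hθ
      have := S.div t₀ θ hθ
      have h : (Real.cos θ * w₁ θ - Real.sin θ * v₁ θ) * φ t₀ = 0 := by
        linear_combination this - φ₁ t₀ * hα θ hθ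
      exact (mul_eq_zero.1 h).resolve_right ht₀
    refine swirl_classified hαβ S (k := -1) (fun θ hθ => by linear_combination hα θ hθ) ?_
    intro θ hθ
    have hd := hasDerivAt_eq_zero_of_eqOn isOpen_Ioo hα hθ
      (((Real.hasDerivAt_cos θ).mul (S.jv.d0 θ hθ)).add
        ((Real.hasDerivAt_sin θ).mul (S.jw.d0 θ hθ)))
    have hvw : v₁ θ + w θ = 0 := by
      linear_combination Real.cos θ * hd + Real.sin θ * hα θ hθ - Real.sin θ * hβ θ hθ -
        (v₁ θ + w θ) * Real.sin_sq_add_cos_sq θ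
    linear_combination hβ θ hθ + Real.sin θ * hvw
  · push Not at hα
    obtain ⟨θ₀, hθ₀, hne⟩ := hα
    obtain ⟨lam, hlam⟩ : ∃ lam, ∀ t, φ₁ t = lam * φ t := by
      refine ⟨-(Real.cos θ₀ * w₁ θ₀ - Real.sin θ₀ * v₁ θ₀) /
        (Real.cos θ₀ * v θ₀ + Real.sin θ₀ * w θ₀), fun t => ?_⟩
      rw [div_mul_eq_mul_div, eq_div_iff hne]
      linear_combination S.div t θ₀ hθ₀
    have hlam2 : ∀ t, φ₂ t = lam * φ₁ t := fun t => by
      have := hasDerivAt_eq_zero_of_eqOn isOpen_univ (fun y _ => sub_eq_zero.2 (hlam y)) (mem_univ t)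
        ((S.jφ.d1 t trivial).sub ((S.jφ.d0 t trivial).const_mul lam))
      linarith
    have hlam3 : ∀ t, φ₃ t = lam * φ₂ t := fun t => by
      have := hasDerivAt_eq_zero_of_eqOn isOpen_univ (fun y _ => sub_eq_zero.2 (hlam2 y))
        (mem_univ t) ((S.jφ.d2 t trivial).sub ((S.jφ.d1 t trivial).const_mul lam))
      linarith
    have hexp := eq_exp_of_deriv (fun t => S.jφ.d0 t trivial) hlam
    have hC : φ 0 ≠ 0 := fun h => ht₀ (by rw [hexp, h, zero_mul])
    obtain ⟨l, hl, hcv⟩ := S.limφ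
    obtain ⟨l', hl', hcw⟩ := S.limχ
    have hll : l' = l := tendsto_nhds_unique hl' hl
    subst hll
    have hfun : φ = fun t => φ 0 * Real.exp (lam * t) := funext hexp
    rcases lt_trichotomy lam 0 with hneg | hzero | hpos
    · rw [hfun] at hl
      exact absurd hl (not_tendsto_exp_neg hC hneg)
    · subst hzero
      simp only [zero_mul, Real.exp_zero, mul_one] at hexp
      have : l' = φ 0 := by
        have h2 : φ = fun _ => φ 0 := funext hexp
        rw [h2] at hl
        exact tendsto_nhds_unique hl tendsto_const_nhds
      subst this
      exact Or.inl ⟨v θ₀ * φ 0, w θ₀ * φ 0, fun t θ hθ =>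
        ⟨by simp only [hexp t]; exact hcv θ hθ θ₀ hθ₀, by simp only [hexp t]; exact hcw θ hθ θ₀ hθ₀⟩⟩
    · set C := φ 0 with hCdef
      -- Dividing by `φ` gives `L = C R exp ((1 + lam) t)`. Comparing `t = 0` with `t = 1` suffices,
      -- because `exp (1 + lam) ≠ 1`.
      have key : ∀ L R : ℝ, (∀ t, φ t * L = Real.exp t * (φ t ^ 2 * R)) →
          L = 0 ∧ C * R = 0 := by
        intro L R h
        have h0 := h 0
        have h1 := h 1
        rw [hexp 1] at h1
        simp only [Real.exp_zero, one_mul, mul_one] at h0 h1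
        have e0 : L = C * R := mul_left_cancel₀ hC (by linear_combination h0)
        have e1 : C * R * (1 - Real.exp (1 + lam)) = 0 := by
          rw [Real.exp_add]
          have : C * Real.exp lam * (C * R * (1 - Real.exp 1 * Real.exp lam)) = 0 := by
            rw [e0] at h1; linear_combination h1
          exact (mul_eq_zero.1 this).resolve_left (mul_ne_zero hC (Real.exp_pos _).ne')
        have e2 : 1 - Real.exp (1 + lam) ≠ 0 := by
          have := Real.add_one_lt_exp (x := 1 + lam) (by linarith)
          linarith
        have e3 := (mul_eq_zero.1 e1).resolve_right e2
        exact ⟨by rw [e0, e3], e3⟩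
      have hvort := fun t θ hθ => S.vort t θ hθ
      simp only [hlam3, hlam2, hlam] at hvort
      have hdiv := S.div 0
      simp only [hlam] at hdiv
      have hLR : ∀ θ ∈ Ioo α β, (lam - 1) ^ 2 * (lam * (Real.cos θ * w θ - Real.sin θ * v θ)
            - Real.sin θ * w₁ θ - Real.cos θ * v₁ θ) +
          (lam * ((-Real.cos θ * w θ - 2 * Real.sin θ * w₁ θ + Real.cos θ * w₂ θ)
              - (-Real.sin θ * v θ + 2 * Real.cos θ * v₁ θ + Real.sin θ * v₂ θ))
            - (-Real.sin θ * w₁ θ + 2 * Real.cos θ * w₂ θ + Real.sin θ * w₃ θ)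
            - (-Real.cos θ * v₁ θ - 2 * Real.sin θ * v₂ θ + Real.cos θ * v₃ θ)) = 0 ∧
          C * ((Real.cos θ * v θ + Real.sin θ * w θ) * ((lam - 1) *
          (lam * (Real.cos θ * w θ - Real.sin θ * v θ) - Real.sin θ * w₁ θ - Real.cos θ * v₁ θ)) +
          (-Real.sin θ * v θ + Real.cos θ * w θ) *
          (lam * ((-Real.sin θ * w θ + Real.cos θ * w₁ θ)
            - (Real.cos θ * v θ + Real.sin θ * v₁ θ))
            - (Real.cos θ * w₁ θ + Real.sin θ * w₂ θ)
            - (-Real.sin θ * v₁ θ + Real.cos θ * v₂ θ))) = 0 :=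
        fun θ hθ => key _ _ fun t => by linear_combination hvort t θ hθ
      have main := homogeneous_classified hαβ hpos (S.jv.const_mul C) (S.jw.const_mul C)
        (fun θ hθ => by linear_combination hdiv θ hθ)
        (fun θ hθ => by linear_combination C * (hLR θ hθ).1)
        (fun θ hθ => by linear_combination C * (hLR θ hθ).2)
      have e1 : (fun t θ => Real.exp (lam * t) * (C * v θ)) = fun t θ => v θ * φ t := by
        funext t θ; rw [hexp t]; ring
      have e2 : (fun t θ => Real.exp (lam * t) * (C * w θ)) = fun t θ => w θ * φ t := by
        funext t θ; rw [hexp t]; ring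
      rw [e1, e2] at main
      exact main

end

/-! ### Planar linear systems with a limit at minus infinity -/

section PlanarLinearSystem

/-- Uniqueness for the scalar linear equation `f'' = d f + e f'`. -/
lemma second_order_unique {f f₁ : ℝ → ℝ} {d e t₀ : ℝ} (hf : ∀ t, HasDerivAt f (f₁ t) t)
    (hf₁ : ∀ t, HasDerivAt f₁ (d * f t + e * f₁ t) t) (h0 : f t₀ = 0) (h1 : f₁ t₀ = 0) (t : ℝ) :
    f t = 0 := by
  let L : ℝ × ℝ →L[ℝ] ℝ × ℝ := (ContinuousLinearMap.snd ℝ ℝ ℝ).prod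
    (d • ContinuousLinearMap.fst ℝ ℝ ℝ + e • ContinuousLinearMap.snd ℝ ℝ ℝ)
  have hL : ∀ p : ℝ × ℝ, L p = (p.2, d * p.1 + e * p.2) := fun p => by simp [L]
  have key : (fun t => (f t, f₁ t)) = fun _ => ((0, 0) : ℝ × ℝ) := by
    refine ODE_solution_unique_univ (v := fun _ => L) (s := fun _ => univ) (K := ‖L‖₊) (t₀ := t₀)
      (fun _ => L.lipschitz.lipschitzOnWith) (fun t => ⟨?_, trivial⟩) (fun t => ⟨?_, trivial⟩) ?_
    · rw [hL]
      exact (hf t).prodMk (hf₁ t)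
    · rw [hL]
      convert hasDerivAt_const t ((0, 0) : ℝ × ℝ) using 1
      simp
    · simp [h0, h1]
  exact congrArg Prod.fst (congrFun key t)

/-- If a function and its derivative both converge at `-∞`, the derivative converges to zero. -/
lemma deriv_limit_eq_zero {f f₁ : ℝ → ℝ} {l d : ℝ} (hf : ∀ t, HasDerivAt f (f₁ t) t)
    (hl : Tendsto f atBot (𝓝 l)) (hd : Tendsto f₁ atBot (𝓝 d)) : d = 0 := by
  -- By the mean value theorem on `[t - 1, t]`, `f t - f (t - 1)` is a value of the derivative at a
  -- point that goes to `-∞` with `t`, while the difference itself tends to zero.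
  have hex : ∀ t : ℝ, ∃ c ∈ Ioo (t - 1) t, f₁ c = (f t - f (t - 1)) / (t - (t - 1)) := fun t =>
    exists_hasDerivAt_eq_slope f f₁ (by linarith)
      (fun x _ => (hf x).continuousAt.continuousWithinAt) (fun x _ => hf x)
  choose c hc hcs using hex
  have h1 : Tendsto c atBot atBot := tendsto_atBot_mono (fun t => (hc t).2.le) tendsto_id
  have h2 := hd.comp h1
  have h3 : Tendsto (fun t => f t - f (t - 1)) atBot (𝓝 (l - l)) :=
    hl.sub (hl.comp (tendsto_atBot_add_const_right _ (-1) tendsto_id))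
  rw [sub_self] at h3
  refine tendsto_nhds_unique h2 (h3.congr fun t => ?_)
  simp only [Function.comp, hcs t]
  ring

variable {φ φ₁ χ χ₁ : ℝ → ℝ} {m₁₁ m₁₂ m₂₁ m₂₂ : ℝ}

lemma hasDerivAt_linear_comb (hφ : ∀ t, HasDerivAt φ (φ₁ t) t) (hχ : ∀ t, HasDerivAt χ (χ₁ t) t)
    (x y t : ℝ) : HasDerivAt (fun t => x * φ t + y * χ t) (x * φ₁ t + y * χ₁ t) t :=
  ((hφ t).const_mul x).add ((hχ t).const_mul y)

/-- If the Wronskian vanished at `t`, some nontrivial combination of `φ` and `χ` would have zero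
Cauchy data there. By Cayley–Hamilton every combination solves the same scalar second-order
equation, so this one would vanish identically, against independence. -/
lemma wronskian_ne_zero (hφ : ∀ t, HasDerivAt φ (φ₁ t) t) (hχ : ∀ t, HasDerivAt χ (χ₁ t) t)
    (eφ : ∀ t, φ₁ t = m₁₁ * φ t + m₁₂ * χ t) (eχ : ∀ t, χ₁ t = m₂₁ * φ t + m₂₂ * χ t)
    (hind : ∀ x y, (∀ t, x * φ t + y * χ t = 0) → x = 0 ∧ y = 0) (t : ℝ) :
    φ t * χ₁ t - χ t * φ₁ t ≠ 0 := by
  intro hW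
  obtain ⟨x, y, hxy, h0, h1⟩ : ∃ x y, ¬ (x = 0 ∧ y = 0) ∧ x * φ t + y * χ t = 0 ∧
      x * φ₁ t + y * χ₁ t = 0 := by
    by_cases h : χ t = 0 ∧ φ t = 0
    · exact ⟨1, 0, by simp, by simp [h], by simp [eφ, h]⟩
    · refine ⟨χ t, -φ t, fun hh => h ⟨hh.1, neg_eq_zero.1 hh.2⟩, by ring, by linear_combination -hW⟩
  refine hxy (hind x y fun s => ?_)
  refine second_order_unique (d := -(m₁₁ * m₂₂ - m₁₂ * m₂₁)) (e := m₁₁ + m₂₂)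
    (hasDerivAt_linear_comb hφ hχ x y) (fun r => ?_) h0 h1 s
  have hfun : (fun t => x * φ₁ t + y * χ₁ t) = fun t =>
      (x * m₁₁ + y * m₂₁) * φ t + (x * m₁₂ + y * m₂₂) * χ t := by
    funext r; rw [eφ, eχ]; ring
  rw [hfun]
  refine (hasDerivAt_linear_comb hφ hχ _ _ r).congr_deriv ?_
  rw [eφ, eχ]; ring

/-- The Wronskian is a nonzero multiple of `exp` of the trace times `t`. It tends to zero at `-∞`,
since the factors converge and hence their derivatives tend to zero. -/
lemma trace_pos (hφ : ∀ t, HasDerivAt φ (φ₁ t) t) (hχ : ∀ t, HasDerivAt χ (χ₁ t) t)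
    (eφ : ∀ t, φ₁ t = m₁₁ * φ t + m₁₂ * χ t) (eχ : ∀ t, χ₁ t = m₂₁ * φ t + m₂₂ * χ t)
    (hind : ∀ x y, (∀ t, x * φ t + y * χ t = 0) → x = 0 ∧ y = 0)
    {l l' : ℝ} (hl : Tendsto φ atBot (𝓝 l)) (hl' : Tendsto χ atBot (𝓝 l')) :
    0 < m₁₁ + m₂₂ := by
  have hW := wronskian_ne_zero hφ hχ eφ eχ hind
  have tφ : Tendsto φ₁ atBot (𝓝 (m₁₁ * l + m₁₂ * l')) := by
    rw [funext eφ]; exact (hl.const_mul _).add (hl'.const_mul _)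
  have tχ : Tendsto χ₁ atBot (𝓝 (m₂₁ * l + m₂₂ * l')) := by
    rw [funext eχ]; exact (hl.const_mul _).add (hl'.const_mul _)
  rw [deriv_limit_eq_zero hφ hl tφ] at tφ
  rw [deriv_limit_eq_zero hχ hl' tχ] at tχ
  have tW : Tendsto (fun t => φ t * χ₁ t - χ t * φ₁ t) atBot (𝓝 0) := by
    simpa using (hl.mul tχ).sub (hl'.mul tφ)
  have dW : ∀ t, HasDerivAt (fun t => φ t * χ₁ t - χ t * φ₁ t)
      ((m₁₁ + m₂₂) * (φ t * χ₁ t - χ t * φ₁ t)) t := by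
    intro t
    have h1 : HasDerivAt φ₁ (m₁₁ * φ₁ t + m₁₂ * χ₁ t) t := by
      have := hasDerivAt_linear_comb hφ hχ m₁₁ m₁₂ t
      rwa [← funext eφ] at this
    have h2 : HasDerivAt χ₁ (m₂₁ * φ₁ t + m₂₂ * χ₁ t) t := by
      have := hasDerivAt_linear_comb hφ hχ m₂₁ m₂₂ t
      rwa [← funext eχ] at this
    refine (((hφ t).mul h2).sub ((hχ t).mul h1)).congr_deriv ?_
    rw [eφ, eχ]; ring
  have hexp := eq_exp_of_deriv dW (fun _ => rfl)
  rw [funext hexp] at tW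
  by_contra hneg
  rcases (not_lt.1 hneg).lt_or_eq with h | h
  · exact not_tendsto_exp_neg (hW 0) h tW
  · rw [h] at tW
    simp only [zero_mul, Real.exp_zero, mul_one] at tW
    exact hW 0 (tendsto_nhds_unique tendsto_const_nhds tW)

/-- A left eigenvector for the eigenvalue `-1` would produce a nonzero combination of `φ` and `χ`
proportional to `exp (-t)`, which has no limit at `-∞`. -/
lemma neg_one_not_eigenvalue (hφ : ∀ t, HasDerivAt φ (φ₁ t) t)
    (hχ : ∀ t, HasDerivAt χ (χ₁ t) t)
    (eφ : ∀ t, φ₁ t = m₁₁ * φ t + m₁₂ * χ t) (eχ : ∀ t, χ₁ t = m₂₁ * φ t + m₂₂ * χ t)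
    (hind : ∀ x y, (∀ t, x * φ t + y * χ t = 0) → x = 0 ∧ y = 0)
    {l l' : ℝ} (hl : Tendsto φ atBot (𝓝 l)) (hl' : Tendsto χ atBot (𝓝 l')) :
    (1 + m₁₁) * (1 + m₂₂) - m₁₂ * m₂₁ ≠ 0 := by
  intro hdet
  obtain ⟨x, y, hxy, h1, h2⟩ : ∃ x y : ℝ, ¬ (x = 0 ∧ y = 0) ∧ x * (1 + m₁₁) + y * m₂₁ = 0 ∧
      x * m₁₂ + y * (1 + m₂₂) = 0 := by
    by_cases h : m₂₁ = 0 ∧ 1 + m₁₁ = 0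
    · by_cases h' : 1 + m₂₂ = 0 ∧ m₁₂ = 0
      · exact ⟨1, 0, by simp, by simp [h], by simp [h']⟩
      · refine ⟨1 + m₂₂, -m₁₂, fun hh => h' ⟨hh.1, neg_eq_zero.1 hh.2⟩, ?_, by ring⟩
        rw [h.1, h.2]; ring
    · refine ⟨m₂₁, -(1 + m₁₁), fun hh => h ⟨hh.1, neg_eq_zero.1 hh.2⟩, by ring, ?_⟩
      linear_combination -hdet
  refine hxy (hind x y fun t => ?_)
  have hexp := eq_exp_of_deriv (lam := -1) (hasDerivAt_linear_comb hφ hχ x y) (fun t => by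
    rw [eφ, eχ]; linear_combination φ t * h1 + χ t * h2)
  have ht : Tendsto (fun t => x * φ t + y * χ t) atBot (𝓝 (x * l + y * l')) :=
    (hl.const_mul _).add (hl'.const_mul _)
  rw [hexp t]
  by_cases h0 : x * φ 0 + y * χ 0 = 0
  · rw [h0, zero_mul]
  · rw [funext hexp] at ht
    exact absurd ht (not_tendsto_exp_neg h0 (by norm_num))

/-- Write `B` for the form and `x = (φ, χ)`. Along the curve `B(x, x) = 0`, and differentiation
gives `B(x, x') = 0`. As `x` and `x'` span the plane, `B x = 0` for every `t`, and independence
gives `B = 0`. -/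
lemma quadratic_form_eq_zero (hφ : ∀ t, HasDerivAt φ (φ₁ t) t) (hχ : ∀ t, HasDerivAt χ (χ₁ t) t)
    (hW : ∀ t, φ t * χ₁ t - χ t * φ₁ t ≠ 0)
    (hind : ∀ x y, (∀ t, x * φ t + y * χ t = 0) → x = 0 ∧ y = 0) {p₁ p₂ p₃ : ℝ}
    (h : ∀ t, p₁ * φ t ^ 2 + 2 * p₂ * (φ t * χ t) + p₃ * χ t ^ 2 = 0) :
    p₁ = 0 ∧ p₂ = 0 ∧ p₃ = 0 := by
  have hd : ∀ t, (p₁ * φ t + p₂ * χ t) * φ₁ t + (p₂ * φ t + p₃ * χ t) * χ₁ t = 0 := by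
    intro t
    have := hasDerivAt_eq_zero_of_eqOn isOpen_univ (fun y _ => h y) (mem_univ t)
      (((((hφ t).pow 2).const_mul p₁).add (((hφ t).mul (hχ t)).const_mul (2 * p₂))).add
      (((hχ t).pow 2).const_mul p₃))
    simp at this
    linear_combination this / 2
  have h1 := hind p₁ p₂ fun t => by
    refine (mul_eq_zero.1 ?_).resolve_right (hW t)
    linear_combination χ₁ t * h t - χ t * hd t
  have h2 := hind p₂ p₃ fun t => by
    refine (mul_eq_zero.1 ?_).resolve_right (hW t)
    linear_combination φ t * hd t - φ₁ t * h t
  exact ⟨h1.1, h1.2, h2.2⟩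

/-- Differentiation of a relation between a linear form and `exp t` times a quadratic form along
a solution of a planar linear system. -/
lemma deriv_linear_eq_quadratic (hφ : ∀ t, HasDerivAt φ (φ₁ t) t)
    (hχ : ∀ t, HasDerivAt χ (χ₁ t) t)
    (eφ : ∀ t, φ₁ t = m₁₁ * φ t + m₁₂ * χ t) (eχ : ∀ t, χ₁ t = m₂₁ * φ t + m₂₂ * χ t)
    {h₁ h₂ q₁ q₂ q₃ : ℝ}
    (h : ∀ t, h₁ * φ t + h₂ * χ t =
      Real.exp t * (q₁ * φ t ^ 2 + 2 * q₂ * (φ t * χ t) + q₃ * χ t ^ 2)) (t : ℝ) :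
    (h₁ * m₁₁ + h₂ * m₂₁) * φ t + (h₁ * m₁₂ + h₂ * m₂₂) * χ t =
      Real.exp t * ((q₁ + 2 * (m₁₁ * q₁ + m₂₁ * q₂)) * φ t ^ 2 +
        2 * (q₂ + (m₁₂ * q₁ + (m₁₁ + m₂₂) * q₂ + m₂₁ * q₃)) * (φ t * χ t) +
        (q₃ + 2 * (m₁₂ * q₂ + m₂₂ * q₃)) * χ t ^ 2) := by
  have hd := hasDerivAt_eq_zero_of_eqOn isOpen_univ (fun y _ => sub_eq_zero.2 (h y)) (mem_univ t)
    ((hasDerivAt_linear_comb hφ hχ h₁ h₂ t).sub ((Real.hasDerivAt_exp t).mul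
      (((((hφ t).pow 2).const_mul q₁).add (((hφ t).mul (hχ t)).const_mul (2 * q₂))).add
      (((hχ t).pow 2).const_mul q₃))))
  simp at hd
  rw [eφ, eχ] at hd
  linear_combination hd

/-- The algebraic consequences of a balance between a linear form and `exp t` times a quadratic
form whose extreme coefficients are `κ m₂₁` and `-κ m₁₂`. -/
lemma balance_consequences (hφ : ∀ t, HasDerivAt φ (φ₁ t) t) (hχ : ∀ t, HasDerivAt χ (χ₁ t) t)
    (eφ : ∀ t, φ₁ t = m₁₁ * φ t + m₁₂ * χ t) (eχ : ∀ t, χ₁ t = m₂₁ * φ t + m₂₂ * χ t)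
    (hind : ∀ x y, (∀ t, x * φ t + y * χ t = 0) → x = 0 ∧ y = 0)
    {l l' : ℝ} (hl : Tendsto φ atBot (𝓝 l)) (hl' : Tendsto χ atBot (𝓝 l')) {h₁ h₂ κ r : ℝ}
    (h : ∀ t, h₁ * φ t + h₂ * χ t =
      Real.exp t * (m₂₁ * κ * φ t ^ 2 + 2 * r * (φ t * χ t) + -m₁₂ * κ * χ t ^ 2)) :
    (m₁₂ * m₂₁ = 0 ∨ κ = 0) ∧
    (m₁₂ * m₂₁ = 0 → r = 0) ∧
    (m₂₁ = 0 → m₁₂ ≠ 0 → κ ≠ 0 → m₁₁ = 1 + 2 * m₂₂) ∧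
    (m₁₂ = 0 → m₂₁ ≠ 0 → κ ≠ 0 → m₂₂ = 1 + 2 * m₁₁) := by
  have hW := wronskian_ne_zero hφ hχ eφ eχ hind
  have hτ := trace_pos hφ hχ eφ eχ hind hl hl'
  have he := neg_one_not_eigenvalue hφ hχ eφ eχ hind hl hl'
  have d1 := deriv_linear_eq_quadratic hφ hχ eφ eχ h
  have d2 := deriv_linear_eq_quadratic hφ hχ eφ eχ d1
  set m := (m₁₁ - m₂₂) / 2 with hm
  set η := r + κ * m with hη
  set e := (1 + m₁₁) * (1 + m₂₂) - m₁₂ * m₂₁ with he'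
  -- By Cayley–Hamilton `D² - (trace) D + det` annihilates the linear side. Applied to the right
  -- side it leaves `exp t` times a quadratic form with the coefficients written here. The number
  -- `e` is the determinant of identity plus matrix, nonzero because `-1` is not an eigenvalue.
  have hq : ∀ t, (-m₂₁ * (-e * κ - 4 * η * m - 2 * (2 + (m₁₁ + m₂₂)) * η)) * φ t ^ 2 +
      2 * (e * r + 4 * (m₁₂ * m₂₁) * η) * (φ t * χ t) +
      (m₁₂ * (-e * κ - 4 * η * m + 2 * (2 + (m₁₁ + m₂₂)) * η)) * χ t ^ 2 = 0 := by
    intro t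
    refine (mul_eq_zero.1 ?_).resolve_left (Real.exp_pos t).ne'
    rw [hη, he', hm]
    linear_combination -d2 t + (m₁₁ + m₂₂) * d1 t - (m₁₁ * m₂₂ - m₁₂ * m₂₁) * h t
  obtain ⟨p1, p2, p3⟩ := quadratic_form_eq_zero hφ hχ hW hind hq
  have hr : m₁₂ * m₂₁ = 0 → r = 0 := fun h0 => by
    rw [h0] at p2
    exact (mul_eq_zero.1 (by linear_combination p2 : e * r = 0)).resolve_left he
  refine ⟨?_, hr, fun h0 hne hκ => ?_, fun h0 hne hκ => ?_⟩
  -- With both off-diagonal entries nonzero, the brackets in the two extreme coefficients vanish.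
  -- Their difference gives `(2 + trace) η = 0`, so `η = 0`; what remains is `e κ = 0`.
  · by_contra! hcon
    obtain ⟨h1, hκ⟩ := hcon
    have e1 := (mul_eq_zero.1 p1).resolve_left (neg_ne_zero.2 (right_ne_zero_of_mul h1))
    have e3 := (mul_eq_zero.1 p3).resolve_left (left_ne_zero_of_mul h1)
    have h4 : (2 + (m₁₁ + m₂₂)) * η = 0 := by linear_combination (e3 - e1) / 4
    have hη0 : η = 0 := (mul_eq_zero.1 h4).resolve_left (by linarith)
    rw [hη0] at e1
    exact mul_ne_zero he hκ (by linear_combination -e1)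
  · have e3 := (mul_eq_zero.1 p3).resolve_left hne
    have hr0 := hr (by rw [h0, mul_zero])
    have h5 : κ * (1 + m₂₂) * (1 + 2 * m₂₂ - m₁₁) = 0 := by
      rw [hη, he', hm, hr0, h0] at e3
      linear_combination -e3
    have h6 : 1 + m₂₂ ≠ 0 := fun h6 => he (by rw [he', h0, h6]; ring)
    have := (mul_eq_zero.1 h5).resolve_left (mul_ne_zero hκ h6)
    linarith
  · have e1 := (mul_eq_zero.1 p1).resolve_left (neg_ne_zero.2 hne)
    have hr0 := hr (by rw [h0, zero_mul])
    have h5 : κ * (1 + m₁₁) * (1 + 2 * m₁₁ - m₂₂) = 0 := by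
      rw [hη, he', hm, hr0, h0] at e1
      linear_combination -e1
    have h6 : 1 + m₁₁ ≠ 0 := fun h6 => he (by rw [he', h0, h6]; ring)
    have := (mul_eq_zero.1 h5).resolve_left (mul_ne_zero hκ h6)
    linarith

end PlanarLinearSystem

/-! ### Linearly independent radial factors -/

section IndependentFactors

variable {α β : ℝ} {v v₁ v₂ v₃ w w₁ w₂ w₃ φ φ₁ φ₂ φ₃ χ χ₁ χ₂ χ₃ : ℝ → ℝ}
  {m₁₁ m₁₂ m₂₁ m₂₂ : ℝ}

lemma exists_ne_zero_sin_mul_cos {F : ℝ → ℝ} (hF : ContinuousOn F (Ioo α β))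
    (h : ∃ θ ∈ Ioo α β, F θ ≠ 0) :
    ∃ θ ∈ Ioo α β, Real.sin θ * Real.cos θ ≠ 0 ∧ F θ ≠ 0 := by
  by_contra! hcon
  obtain ⟨θ, hθ, h0⟩ := h
  refine h0 (eq_zero_of_sin_mul_cos_mul isOpen_Ioo hF (fun x hx => ?_) hθ)
  by_cases hx0 : Real.sin x * Real.cos x = 0
  · rw [hx0, zero_mul]
  · rw [hcon x hx hx0, mul_zero]

/-- The vorticity equation when the radial factors solve a planar linear system. -/
lemma vorticity_linear_system
    (S : SepSystem α β v v₁ v₂ v₃ w w₁ w₂ w₃ φ φ₁ φ₂ φ₃ χ χ₁ χ₂ χ₃)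
    (eφ : ∀ t, φ₁ t = m₁₁ * φ t + m₁₂ * χ t) (eχ : ∀ t, χ₁ t = m₂₁ * φ t + m₂₂ * χ t)
    (sv : ∀ θ ∈ Ioo α β, Real.sin θ * v₁ θ =
      m₁₁ * (Real.cos θ * v θ) + m₂₁ * (Real.sin θ * w θ))
    (sw : ∀ θ ∈ Ioo α β, Real.cos θ * w₁ θ =
      -(m₁₂ * (Real.cos θ * v θ)) - m₂₂ * (Real.sin θ * w θ))
    {θ : ℝ} (hθ : θ ∈ Ioo α β) (hsc : Real.sin θ * Real.cos θ ≠ 0) :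
    ∃ h₁ h₂ r : ℝ, (∀ t, h₁ * φ t + h₂ * χ t = Real.exp t *
        (m₂₁ * ((m₁₁ + m₂₂) * (v θ * w θ)) * φ t ^ 2 + 2 * r * (φ t * χ t) +
          -m₁₂ * ((m₁₁ + m₂₂) * (v θ * w θ)) * χ t ^ 2)) ∧
      2 * r * (Real.sin θ * Real.cos θ) ^ 2 =
        -m₁₁ * m₁₂ * Real.cos θ ^ 3 * Real.sin θ * v θ ^ 2
        + m₂₂ * (m₂₂ - 1) * (Real.sin θ * Real.cos θ) ^ 2 * (v θ * w θ)
        - m₁₁ * (m₁₁ - 1) * (Real.sin θ * Real.cos θ) ^ 2 * (v θ * w θ)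
        + m₂₁ * m₂₂ * Real.sin θ ^ 3 * Real.cos θ * w θ ^ 2
        + m₂₂ * Real.sin θ ^ 3 * v θ *
          (m₁₂ * Real.cos θ * v θ + (m₂₂ - 1) * Real.sin θ * w θ)
        - m₁₁ * Real.cos θ ^ 3 * w θ *
          ((m₁₁ - 1) * Real.cos θ * v θ + m₂₁ * Real.sin θ * w θ) ∧
      (m₁₂ = 0 → m₂₁ = 0 →
        Real.sin θ ^ 3 * h₁ = -(m₁₁ * (m₁₁ - 1) * (m₁₁ - 2)) * v θ ∧
        Real.cos θ ^ 3 * h₂ = m₂₂ * (m₂₂ - 1) * (m₂₂ - 2) * w θ) := by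
  have hS := Real.hasDerivAt_sin
  have hC := Real.hasDerivAt_cos
  have e2φ : ∀ t, φ₂ t = m₁₁ * φ₁ t + m₁₂ * χ₁ t := fun t => by
    have := hasDerivAt_eq_zero_of_eqOn isOpen_univ (fun y _ => sub_eq_zero.2 (eφ y)) (mem_univ t)
      ((S.jφ.d1 t trivial).sub
        (((S.jφ.d0 t trivial).const_mul m₁₁).add ((S.jχ.d0 t trivial).const_mul m₁₂)))
    linarith
  have e2χ : ∀ t, χ₂ t = m₂₁ * φ₁ t + m₂₂ * χ₁ t := fun t => by
    have := hasDerivAt_eq_zero_of_eqOn isOpen_univ (fun y _ => sub_eq_zero.2 (eχ y)) (mem_univ t)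
      ((S.jχ.d1 t trivial).sub
        (((S.jφ.d0 t trivial).const_mul m₂₁).add ((S.jχ.d0 t trivial).const_mul m₂₂)))
    linarith
  have e3φ : ∀ t, φ₃ t = m₁₁ * φ₂ t + m₁₂ * χ₂ t := fun t => by
    have := hasDerivAt_eq_zero_of_eqOn isOpen_univ (fun y _ => sub_eq_zero.2 (e2φ y)) (mem_univ t)
      ((S.jφ.d2 t trivial).sub
        (((S.jφ.d1 t trivial).const_mul m₁₁).add ((S.jχ.d1 t trivial).const_mul m₁₂)))
    linarith
  have e3χ : ∀ t, χ₃ t = m₂₁ * φ₂ t + m₂₂ * χ₂ t := fun t => by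
    have := hasDerivAt_eq_zero_of_eqOn isOpen_univ (fun y _ => sub_eq_zero.2 (e2χ y)) (mem_univ t)
      ((S.jχ.d2 t trivial).sub
        (((S.jφ.d1 t trivial).const_mul m₂₁).add ((S.jχ.d1 t trivial).const_mul m₂₂)))
    linarith
  have sv1 : ∀ θ ∈ Ioo α β, Real.cos θ * v₁ θ + Real.sin θ * v₂ θ =
      m₁₁ * (-Real.sin θ * v θ + Real.cos θ * v₁ θ) +
      m₂₁ * (Real.cos θ * w θ + Real.sin θ * w₁ θ) := fun θ hθ => by
    have := hasDerivAt_eq_zero_of_eqOn isOpen_Ioo (fun y hy => sub_eq_zero.2 (sv y hy)) hθ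
      (((hS θ).mul (S.jv.d1 θ hθ)).sub ((((hC θ).mul (S.jv.d0 θ hθ)).const_mul m₁₁).add
        (((hS θ).mul (S.jw.d0 θ hθ)).const_mul m₂₁)))
    linarith
  have sw1 : ∀ θ ∈ Ioo α β, -Real.sin θ * w₁ θ + Real.cos θ * w₂ θ =
      -(m₁₂ * (-Real.sin θ * v θ + Real.cos θ * v₁ θ)) -
      m₂₂ * (Real.cos θ * w θ + Real.sin θ * w₁ θ) := fun θ hθ => by
    have := hasDerivAt_eq_zero_of_eqOn isOpen_Ioo (fun y hy => sub_eq_zero.2 (sw y hy)) hθ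
      (((hC θ).mul (S.jw.d1 θ hθ)).sub ((((hC θ).mul (S.jv.d0 θ hθ)).const_mul m₁₂).neg.sub
        (((hS θ).mul (S.jw.d0 θ hθ)).const_mul m₂₂)))
    linarith
  have sv2 : -Real.sin θ * v₁ θ + 2 * (Real.cos θ * v₂ θ) + Real.sin θ * v₃ θ =
      m₁₁ * (-Real.cos θ * v θ - 2 * (Real.sin θ * v₁ θ) + Real.cos θ * v₂ θ) +
      m₂₁ * (-Real.sin θ * w θ + 2 * (Real.cos θ * w₁ θ) + Real.sin θ * w₂ θ) := by
    have := hasDerivAt_eq_zero_of_eqOn isOpen_Ioo (fun y hy => sub_eq_zero.2 (sv1 y hy)) hθ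
      ((((hC θ).mul (S.jv.d1 θ hθ)).add ((hS θ).mul (S.jv.d2 θ hθ))).sub
        (((((hS θ).neg.mul (S.jv.d0 θ hθ)).add ((hC θ).mul (S.jv.d1 θ hθ))).const_mul m₁₁).add
        ((((hC θ).mul (S.jw.d0 θ hθ)).add ((hS θ).mul (S.jw.d1 θ hθ))).const_mul m₂₁)))
    simp only [Pi.neg_apply] at this
    linarith
  have sw2 : -Real.cos θ * w₁ θ - 2 * (Real.sin θ * w₂ θ) + Real.cos θ * w₃ θ =
      -(m₁₂ * (-Real.cos θ * v θ - 2 * (Real.sin θ * v₁ θ) + Real.cos θ * v₂ θ)) -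
      m₂₂ * (-Real.sin θ * w θ + 2 * (Real.cos θ * w₁ θ) + Real.sin θ * w₂ θ) := by
    have := hasDerivAt_eq_zero_of_eqOn isOpen_Ioo (fun y hy => sub_eq_zero.2 (sw1 y hy)) hθ
      ((((hS θ).neg.mul (S.jw.d1 θ hθ)).add ((hC θ).mul (S.jw.d2 θ hθ))).sub
        (((((hS θ).neg.mul (S.jv.d0 θ hθ)).add ((hC θ).mul (S.jv.d1 θ hθ))).const_mul m₁₂).neg.sub
        ((((hC θ).mul (S.jw.d0 θ hθ)).add ((hS θ).mul (S.jw.d1 θ hθ))).const_mul m₂₂)))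
    simp only [Pi.neg_apply] at this
    linarith
  have E0 := sv θ hθ
  have E1 := sv1 θ hθ
  have F0 := sw θ hθ
  have F1 := sw1 θ hθ
  have hV := fun t => S.vort t θ hθ
  simp only [e3φ, e3χ, e2φ, e2χ, eφ, eχ] at hV
  have hcs := Real.sin_sq_add_cos_sq θ
  have hs0 : Real.sin θ ≠ 0 := left_ne_zero_of_mul hsc
  have hc0 : Real.cos θ ≠ 0 := right_ne_zero_of_mul hsc
  generalize Real.sin θ = s at *
  generalize Real.cos θ = c at *
  generalize v θ = V at *
  generalize v₁ θ = V1 at *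
  generalize v₂ θ = V2 at *
  generalize v₃ θ = V3 at *
  generalize w θ = W at *
  generalize w₁ θ = W1 at *
  generalize w₂ θ = W2 at *
  generalize w₃ θ = W3 at *
  -- `g₁` and `g₂` are the coefficients of `φ` and `χ` in `r · curl u`; the `k` and `n` pairs are
  -- their first and second derivatives in `θ`.
  obtain ⟨g₁, hg₁⟩ : ∃ x, x = c * W * m₂₁ - s * V * m₁₁ - c * V1 := ⟨_, rfl⟩
  obtain ⟨g₂, hg₂⟩ : ∃ x, x = c * W * m₂₂ - s * W1 - s * V * m₁₂ := ⟨_, rfl⟩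
  obtain ⟨k₁, hk₁⟩ : ∃ x, x = (-s * W + c * W1) * m₂₁ - (c * V + s * V1) * m₁₁
    - (-s * V1 + c * V2) := ⟨_, rfl⟩
  obtain ⟨k₂, hk₂⟩ : ∃ x, x = (-s * W + c * W1) * m₂₂ - (c * W1 + s * W2)
    - (c * V + s * V1) * m₁₂ := ⟨_, rfl⟩
  obtain ⟨n₁, hn₁⟩ : ∃ x, x = (-c * W - 2 * s * W1 + c * W2) * m₂₁
    - (-s * V + 2 * c * V1 + s * V2) * m₁₁ - (-c * V1 - 2 * s * V2 + c * V3) := ⟨_, rfl⟩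
  obtain ⟨n₂, hn₂⟩ : ∃ x, x = (-c * W - 2 * s * W1 + c * W2) * m₂₂
    - (-s * W1 + 2 * c * W2 + s * W3) - (-s * V + 2 * c * V1 + s * V2) * m₁₂ := ⟨_, rfl⟩
  -- The angular system collapses these coefficients: `sin θ · g₁ = -m₁₁ v` and `cos θ · g₂ = m₂₂
  -- w`. The `K` and `N` identities are the first and second derivatives of these two.
  have G1 : s * g₁ = -m₁₁ * V := by
    rw [hg₁]; linear_combination -c * E0 - m₁₁ * V * hcs
  have G2 : c * g₂ = m₂₂ * W := by
    rw [hg₂]; linear_combination -s * F0 + m₂₂ * W * hcs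
  have K1 : s * k₁ + c * g₁ = -m₁₁ * V1 := by
    rw [hg₁, hk₁]; linear_combination s * E0 - c * E1 - m₁₁ * V1 * hcs
  have K2 : c * k₂ - s * g₂ = m₂₂ * W1 := by
    rw [hg₂, hk₂]; linear_combination -c * F0 - s * F1 + m₂₂ * W1 * hcs
  have N1 : s * n₁ + 2 * c * k₁ - s * g₁ = -m₁₁ * V2 := by
    rw [hg₁, hk₁, hn₁]; linear_combination c * E0 + 2 * s * E1 - c * sv2 - m₁₁ * V2 * hcs
  have N2 : c * n₂ - 2 * s * k₂ - c * g₂ = m₂₂ * W2 := by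
    rw [hg₂, hk₂, hn₂]; linear_combination s * F0 - 2 * c * F1 - s * sw2 + m₂₂ * W2 * hcs
  -- `A1` and `A3` evaluate the coefficients of `φ²` and `χ²` in the convective term. They have the
  -- shape required by `balance_consequences`, with `κ = (m₁₁ + m₂₂) v w`.
  have A1 : c * V * (g₁ * (m₁₁ - 1) + g₂ * m₂₁) - s * V * k₁ = m₂₁ * ((m₁₁ + m₂₂) * (V * W)) := by
    apply mul_left_cancel₀ hs0
    linear_combination c * V * m₁₁ * G1 + s * V * m₂₁ * G2 - s * V * K1 + m₁₁ * V * E0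
  have A3 : s * W * (g₁ * m₁₂ + g₂ * (m₂₂ - 1)) + c * W * k₂ =
      -m₁₂ * ((m₁₁ + m₂₂) * (V * W)) := by
    apply mul_left_cancel₀ hc0
    linear_combination c * W * m₁₂ * G1 + s * W * m₂₂ * G2 + c * W * K2 + m₂₂ * W * F0
  refine ⟨(m₁₁ ^ 2 + m₁₂ * m₂₁) * g₁ + (m₁₁ + m₂₂) * m₂₁ * g₂ - 2 * (m₁₁ * g₁ + m₂₁ * g₂) + g₁ + n₁,
    (m₁₁ + m₂₂) * m₁₂ * g₁ + (m₂₂ ^ 2 + m₁₂ * m₂₁) * g₂ - 2 * (m₁₂ * g₁ + m₂₂ * g₂) + g₂ + n₂,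
    (c * V * (g₁ * m₁₂ + g₂ * (m₂₂ - 1)) + s * W * (g₁ * (m₁₁ - 1) + g₂ * m₂₁)
      - s * V * k₂ + c * W * k₁) / 2, fun t => ?_, ?_, ?_⟩
  · rw [← A1, ← A3, hn₁, hn₂, hk₁, hk₂, hg₁, hg₂]
    linear_combination hV t
  · have hk1 : s ^ 2 * k₁ = -m₁₁ * s * V1 + c * m₁₁ * V := by
      linear_combination s * K1 - c * G1
    have hk2 : c ^ 2 * k₂ = m₂₂ * c * W1 + s * m₂₂ * W := by
      linear_combination c * K2 + s * G2
    linear_combination (c ^ 3 * V * s * m₁₂ + s ^ 2 * W * c ^ 2 * (m₁₁ - 1)) * G1 +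
      (s ^ 2 * c ^ 2 * V * (m₂₂ - 1) + s ^ 3 * c * W * m₂₁) * G2 - s ^ 3 * V * hk2 +
      c ^ 3 * W * hk1 - s ^ 3 * V * m₂₂ * F0 - c ^ 3 * W * m₁₁ * E0
  · intro h12 h21
    subst h12 h21
    constructor
    · have hk1 : s ^ 2 * k₁ = -m₁₁ * (m₁₁ - 1) * c * V := by
        linear_combination s * K1 - c * G1 - m₁₁ * E0
      have hv2 : s ^ 2 * V2 = -m₁₁ * s ^ 2 * V + (m₁₁ - 1) * c * m₁₁ * c * V := by
        linear_combination s * E1 + (m₁₁ - 1) * c * E0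
      linear_combination (s ^ 2 * (m₁₁ ^ 2 - 2 * m₁₁ + 1) + s ^ 2) * G1 + s ^ 2 * N1
        - 2 * c * hk1 - m₁₁ * hv2 - m₁₁ * (m₁₁ - 1) * (m₁₁ - 2) * V * hcs
    · have hk2 : c ^ 2 * k₂ = -m₂₂ * (m₂₂ - 1) * s * W := by
        linear_combination c * K2 + s * G2 + m₂₂ * F0
      have hw2 : c ^ 2 * W2 = -m₂₂ * c ^ 2 * W + (m₂₂ - 1) * s * m₂₂ * s * W := by
        linear_combination c * F1 + (1 - m₂₂) * s * F0
      linear_combination (c ^ 2 * (m₂₂ ^ 2 - 2 * m₂₂ + 1) + c ^ 2) * G2 + c ^ 2 * N2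
        + 2 * s * hk2 + m₂₂ * hw2 + m₂₂ * (m₂₂ - 1) * (m₂₂ - 2) * W * hcs

/-- A nonconstant function cannot satisfy a nontrivial cubic relation: successive derivatives, each
divided by `X'`, remove the coefficients from the top down. -/
lemma cubic_constant_coeff_eq_zero {X X₁ : ℝ → ℝ} {J : Set ℝ} (hJ : IsOpen J) {θ₀ : ℝ}
    (hθ₀ : θ₀ ∈ J) (hX : ∀ θ ∈ J, HasDerivAt X (X₁ θ) θ) (hX₁ : ∀ θ ∈ J, X₁ θ ≠ 0)
    {a b c d : ℝ} (h : ∀ θ ∈ J, a + b * X θ + c * X θ ^ 2 + d * X θ ^ 3 = 0) : a = 0 := by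
  have h1 : ∀ θ ∈ J, b + 2 * c * X θ + 3 * d * X θ ^ 2 = 0 := fun θ hθ => by
    have := hasDerivAt_eq_zero_of_eqOn hJ h hθ (((((hX θ hθ).const_mul b).const_add a).add
      (((hX θ hθ).pow 2).const_mul c)).add (((hX θ hθ).pow 3).const_mul d))
    push_cast at this
    exact (mul_eq_zero.1 (by linear_combination this :
      X₁ θ * (b + 2 * c * X θ + 3 * d * X θ ^ 2) = 0)).resolve_left (hX₁ θ hθ)
  have h2 : ∀ θ ∈ J, 2 * c + 6 * d * X θ = 0 := fun θ hθ => by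
    have := hasDerivAt_eq_zero_of_eqOn hJ h1 hθ ((((hX θ hθ).const_mul (2 * c)).const_add b).add
      (((hX θ hθ).pow 2).const_mul (3 * d)))
    push_cast at this
    exact (mul_eq_zero.1 (by linear_combination this :
      X₁ θ * (2 * c + 6 * d * X θ) = 0)).resolve_left (hX₁ θ hθ)
  have h3 := hasDerivAt_eq_zero_of_eqOn hJ h2 hθ₀ (((hX θ₀ hθ₀).const_mul (6 * d)).const_add (2 * c))
  have hd : d = 0 := by
    have := (mul_eq_zero.1 h3).resolve_right (hX₁ θ₀ hθ₀)
    linarith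
  have hc : c = 0 := by have := h2 θ₀ hθ₀; rw [hd] at this; linarith
  have hb : b = 0 := by have := h1 θ₀ hθ₀; rw [hd, hc] at this; linarith
  have := h θ₀ hθ₀
  rw [hd, hc, hb] at this
  linarith

/-- A system of angular equations with a genuinely triangular matrix is inconsistent. -/
lemma triangular_false {S C V V₁ W W₁ : ℝ → ℝ} {J : Set ℝ} (hJ : IsOpen J) (hne : J.Nonempty)
    {ε lam μ m : ℝ} (hε : ε ^ 2 = 1) (hS : ∀ θ ∈ J, HasDerivAt S (ε * C θ) θ)
    (hC : ∀ θ ∈ J, HasDerivAt C (-(ε * S θ)) θ) (hSC : ∀ θ ∈ J, S θ ^ 2 + C θ ^ 2 = 1)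
    (hV : ∀ θ ∈ J, HasDerivAt V (V₁ θ) θ) (hW : ∀ θ ∈ J, HasDerivAt W (W₁ θ) θ)
    (eV : ∀ θ ∈ J, S θ * V₁ θ = ε * lam * (C θ * V θ))
    (eW : ∀ θ ∈ J, C θ * W₁ θ = ε * (-(m * (C θ * V θ)) - μ * (S θ * W θ)))
    (hm : m ≠ 0) (hlam : lam = 1 + 2 * μ) (hτ : 0 < lam + μ)
    (h0 : ∀ θ ∈ J, S θ ≠ 0 ∧ C θ ≠ 0 ∧ V θ ≠ 0 ∧ W θ ≠ 0)
    (hG : ∀ θ ∈ J, m * (S θ * C θ * V θ) * (μ * S θ ^ 2 - lam * C θ ^ 2) +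
      W θ * (μ * (μ - 1) * S θ ^ 2 - lam * (lam - 1) * C θ ^ 2) = 0) : False := by
  have hε0 : ε ≠ 0 := fun h => by rw [h] at hε; norm_num at hε
  obtain ⟨P, hP⟩ : ∃ P, P = μ * (μ - 1) := ⟨_, rfl⟩
  obtain ⟨L, hL⟩ : ∃ L, L = lam * (lam - 1) := ⟨_, rfl⟩
  simp only [← hP, ← hL] at hG
  -- `hG` and its derivative are two homogeneous linear relations in the nonzero quantities `m C V`
  -- and `S W`. Their determinant vanishes, and with `C² = 1 - S²` it is a cubic polynomial in `S²`.
  have hD : ∀ θ ∈ J, L * (-(2 * lam)) +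
      (-lam * (2 * (P + L) + μ * L) + L * ((1 + lam) * (μ + lam) + (2 + lam) * lam +
        2 * (μ + lam) - (P + L)) + (P + L) * (2 * lam)) * (S θ ^ 2) +
      ((μ + lam) * (2 * (P + L) + μ * L) + lam * ((μ + 2) * (P + L)) -
        L * ((4 + lam) * (μ + lam)) - (P + L) * ((1 + lam) * (μ + lam) + (2 + lam) * lam +
        2 * (μ + lam) - (P + L))) * (S θ ^ 2) ^ 2 +
      (-(μ + lam) * ((μ + 2) * (P + L)) + (P + L) * ((4 + lam) * (μ + lam))) *
        (S θ ^ 2) ^ 3 = 0 := by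
    intro θ hθ
    obtain ⟨s0, c0, v0, w0⟩ := h0 θ hθ
    have hd := hasDerivAt_eq_zero_of_eqOn hJ hG hθ
      ((((((hS θ hθ).mul (hC θ hθ)).mul (hV θ hθ)).const_mul m).mul
        ((((hS θ hθ).pow 2).const_mul μ).sub (((hC θ hθ).pow 2).const_mul lam))).add
      ((hW θ hθ).mul ((((hS θ hθ).pow 2).const_mul P).sub (((hC θ hθ).pow 2).const_mul L))))
    simp only [Pi.mul_apply, Pi.pow_apply, Pi.sub_apply] at hd
    push_cast at hd
    have g := hG θ hθ
    have ev := eV θ hθ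
    have ew := eW θ hθ
    have sc := hSC θ hθ
    generalize S θ = s at *
    generalize C θ = c at *
    generalize V θ = x at *
    generalize W θ = y at *
    generalize V₁ θ = x1 at *
    generalize W₁ θ = y1 at *
    have k1 : (m * c * x) * ((c ^ 2 - s ^ 2 + lam * c ^ 2) * (μ * s ^ 2 - lam * c ^ 2) +
        2 * s ^ 2 * c ^ 2 * (μ + lam) - (P * s ^ 2 - L * c ^ 2)) +
        (s * y) * (-μ * (P * s ^ 2 - L * c ^ 2) + 2 * c ^ 2 * (P + L)) = 0 := by
      linear_combination ε * c * hd - ε * m * c ^ 2 * (μ * s ^ 2 - lam * c ^ 2) * ev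
        - ε * (P * s ^ 2 - L * c ^ 2) * ew
        - ((m * c * x) * ((c ^ 2 - s ^ 2 + lam * c ^ 2) * (μ * s ^ 2 - lam * c ^ 2) +
        2 * s ^ 2 * c ^ 2 * (μ + lam) - (P * s ^ 2 - L * c ^ 2)) +
        (s * y) * (-μ * (P * s ^ 2 - L * c ^ 2) + 2 * c ^ 2 * (P + L))) * hε
    have k2 : (m * c * x) * (s ^ 2 * (μ * s ^ 2 - lam * c ^ 2)) +
        (s * y) * (P * s ^ 2 - L * c ^ 2) = 0 := by linear_combination s * g
    have hc2 : c ^ 2 = 1 - s ^ 2 := by linear_combination sc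
    rw [hc2] at k1 k2
    apply mul_left_cancel₀ (mul_ne_zero s0 w0)
    apply mul_left_cancel₀ (mul_ne_zero (mul_ne_zero hm c0) v0)
    linear_combination -(m * c * x * (s * y) * (L - s ^ 2 * (L + P))) * hL +
      (m * c * x) * (s ^ 2 * (μ * s ^ 2 - lam * (1 - s ^ 2))) * k1 -
      (m * c * x) * ((1 - s ^ 2 - s ^ 2 + lam * (1 - s ^ 2)) * (μ * s ^ 2 - lam * (1 - s ^ 2)) +
        2 * s ^ 2 * (1 - s ^ 2) * (μ + lam) - (P * s ^ 2 - L * (1 - s ^ 2))) * k2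
  obtain ⟨θ, hθ⟩ := hne
  obtain ⟨s0, c0, v0, -⟩ := h0 θ hθ
  -- The constant coefficient is `-2 lam² (lam - 1)`. The root `lam = 0` makes `lam + μ` negative.
  -- The root `lam = 1` gives `μ = 0`, and `hG` reduces to `m S C³ V = 0`.
  have hcoef := cubic_constant_coeff_eq_zero hJ hθ (fun θ hθ => (hS θ hθ).pow 2) (fun θ hθ => by
    have := h0 θ hθ
    simp [this.1, this.2.1, hε0]) hD
  have h3 : lam ^ 2 * (lam - 1) = 0 := by rw [hL] at hcoef; linear_combination -hcoef / 2
  rcases mul_eq_zero.1 h3 with h | h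
  · have := pow_eq_zero_iff (two_ne_zero) |>.1 h
    linarith
  · have hl1 : lam = 1 := by linarith
    have hμ : μ = 0 := by linarith
    have g := hG θ hθ
    rw [hP, hL, hl1, hμ] at g
    have : m * S θ * C θ ^ 3 * V θ = 0 := by linear_combination -g
    simp [hm, s0, c0, v0] at this

/-- Profiles of degree `0`, `1`, `2` for the equation `S V' = ε lam C V`. -/
lemma diagonal_profile {I : Set ℝ} {S C V V₁ V₂ V₃ : ℝ → ℝ} (hI : I = Ioo α β) (hαβ : α < β)
    {ε lam : ℝ} (hε : ε ^ 2 = 1) (hS : ∀ θ, HasDerivAt S (ε * C θ) θ)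
    (hC : ∀ θ, HasDerivAt C (-(ε * S θ)) θ) (hSC : ∀ θ, S θ ^ 2 + C θ ^ 2 = 1)
    (hdens : ∀ F : ℝ → ℝ, ContinuousOn F I → (∀ θ ∈ I, S θ * F θ = 0) → ∀ θ ∈ I, F θ = 0)
    (j : Jet I V V₁ V₂ V₃) (e : ∀ θ ∈ I, S θ * V₁ θ = ε * lam * (C θ * V θ))
    (hlam : lam * (lam - 1) * (lam - 2) = 0) :
    (lam = 0 ∧ ∃ k, ∀ θ ∈ I, V θ = k) ∨ (lam = 1 ∧ ∃ k, ∀ θ ∈ I, V θ = k * S θ) ∨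
      (lam = 2 ∧ ∃ k, ∀ θ ∈ I, V θ = k * S θ ^ 2) := by
  subst hI
  obtain ⟨x, hx⟩ := nonempty_Ioo.2 hαβ
  have e1 : ∀ θ ∈ Ioo α β, ε * C θ * V₁ θ + S θ * V₂ θ =
      ε * lam * (-(ε * S θ) * V θ + C θ * V₁ θ) := fun θ hθ =>
    sub_eq_zero.1 (hasDerivAt_eq_zero_of_eqOn isOpen_Ioo (fun y hy => sub_eq_zero.2 (e y hy)) hθ
      (((hS θ).mul (j.d1 θ hθ)).sub (((hC θ).mul (j.d0 θ hθ)).const_mul (ε * lam))))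
  rcases mul_eq_zero.1 hlam with h | h2
  · rcases mul_eq_zero.1 h with h0 | h1
    · refine Or.inl ⟨h0, V x, fun θ hθ => const_of_hasDerivAt_zero (fun y hy => ?_) hθ hx⟩
      have := hdens V₁ j.contOn₁ (fun y hy => by rw [e y hy, h0]; ring) y hy
      exact this ▸ j.d0 y hy
    · have h1 : lam = 1 := by linarith
      subst h1
      -- In degree one the differentiated equation becomes `S (V'' + V) = 0`. Then `ε V' C + V S` is
      -- constant, and this constant is the amplitude.
      have hV2 := hdens (fun θ => V₂ θ + V θ) (j.contOn₂.add j.contOn) (fun y hy => by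
        linear_combination e1 y hy - S y * V y * hε)
      refine Or.inr (Or.inl ⟨rfl, ε * V₁ x * C x + V x * S x, fun θ hθ => ?_⟩)
      have : ε * V₁ θ * C θ + V θ * S θ = ε * V₁ x * C x + V x * S x :=
        const_of_hasDerivAt_zero (f := fun θ => ε * V₁ θ * C θ + V θ * S θ) (fun y hy => by
          refine ((((j.d1 y hy).const_mul ε).mul (hC y)).add ((j.d0 y hy).mul (hS y))).congr_deriv ?_
          linear_combination ε * C y * hV2 y hy - V₁ y * S y * hε) hθ hx
      rw [← this]
      linear_combination -V θ * hSC θ - ε * C θ * e θ hθ - C θ ^ 2 * V θ * hε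
  · have h2 : lam = 2 := by linarith
    subst h2
    have e2 : ∀ θ ∈ Ioo α β, S θ * V₂ θ = -2 * (S θ * V θ) + ε * (C θ * V₁ θ) := fun θ hθ => by
      linear_combination e1 θ hθ - 2 * S θ * V θ * hε
    have e3 : ∀ θ ∈ Ioo α β, ε * C θ * V₂ θ + S θ * V₃ θ = -2 * (ε * C θ * V θ + S θ * V₁ θ) +
        ε * (-(ε * S θ) * V₁ θ + C θ * V₂ θ) := fun θ hθ =>
      sub_eq_zero.1 (hasDerivAt_eq_zero_of_eqOn isOpen_Ioo (fun y hy => sub_eq_zero.2 (e2 y hy)) hθ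
        (((hS θ).mul (j.d2 θ hθ)).sub ((((hS θ).mul (j.d0 θ hθ)).const_mul (-2)).add
          (((hC θ).mul (j.d1 θ hθ)).const_mul ε))))
    -- In degree two a further derivative yields `S (V''' + 4 V') = 0`. Thus `V'' + 4 V` is
    -- constant, equal to twice the amplitude.
    have hV3 := hdens (fun θ => V₃ θ + 4 * V₁ θ) (j.cont.add (j.contOn₁.const_smul (4 : ℝ)))
      (fun y hy => by linear_combination e3 y hy + e y hy - S y * V₁ y * hε)
    refine Or.inr (Or.inr ⟨rfl, (V₂ x + 4 * V x) / 2, fun θ hθ => ?_⟩)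
    have : V₂ θ + 4 * V θ = V₂ x + 4 * V x :=
      const_of_hasDerivAt_zero (f := fun θ => V₂ θ + 4 * V θ) (fun y hy => by
        refine ((j.d2 y hy).add ((j.d0 y hy).const_mul 4)).congr_deriv (hV3 y hy)) hθ hx
    rw [← this]
    linear_combination -S θ / 2 * e2 θ hθ - ε * C θ / 2 * e θ hθ - V θ * hSC θ
      - C θ ^ 2 * V θ * hε

end IndependentFactors

section IndependentFactors

variable {α β : ℝ} {v v₁ v₂ v₃ w w₁ w₂ w₃ φ φ₁ φ₂ φ₃ χ χ₁ χ₂ χ₃ : ℝ → ℝ}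
  {m₁₁ m₁₂ m₂₁ m₂₂ : ℝ}

lemma isOpen_ne_zero_inter {I : Set ℝ} (hI : IsOpen I) {F : ℝ → ℝ} (hF : ContinuousOn F I) :
    IsOpen {θ | θ ∈ I ∧ F θ ≠ 0} :=
  hF.isOpen_inter_preimage hI isOpen_ne

/-- The matrix of the radial system is diagonal. -/
lemma offdiag_eq_zero
    (S : SepSystem α β v v₁ v₂ v₃ w w₁ w₂ w₃ φ φ₁ φ₂ φ₃ χ χ₁ χ₂ χ₃)
    (hind : ∀ x y, (∀ t, x * φ t + y * χ t = 0) → x = 0 ∧ y = 0)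
    (hv : ∃ θ ∈ Ioo α β, v θ ≠ 0) (hw : ∃ θ ∈ Ioo α β, w θ ≠ 0)
    (eφ : ∀ t, φ₁ t = m₁₁ * φ t + m₁₂ * χ t) (eχ : ∀ t, χ₁ t = m₂₁ * φ t + m₂₂ * χ t)
    (sv : ∀ θ ∈ Ioo α β, Real.sin θ * v₁ θ =
      m₁₁ * (Real.cos θ * v θ) + m₂₁ * (Real.sin θ * w θ))
    (sw : ∀ θ ∈ Ioo α β, Real.cos θ * w₁ θ =
      -(m₁₂ * (Real.cos θ * v θ)) - m₂₂ * (Real.sin θ * w θ)) :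
    m₁₂ = 0 ∧ m₂₁ = 0 := by
  obtain ⟨l, hl, -⟩ := S.limφ
  obtain ⟨l', hl', -⟩ := S.limχ
  have hφ := fun t => S.jφ.d0 t trivial
  have hχ := fun t => S.jχ.d0 t trivial
  have hτ := trace_pos hφ hχ eφ eχ hind hl hl'
  -- When the product vanishes identically, `w` is zero on the open set where `v ≠ 0`, and so is
  -- `w'`. There the second angular equation reads `m₁₂ cos θ v = 0`. The other entry is treated
  -- alike.
  by_cases hvw : ∀ θ ∈ Ioo α β, v θ * w θ = 0
  · constructor
    · obtain ⟨θ, hθ, hsc, hne⟩ := exists_ne_zero_sin_mul_cos S.jv.contOn hv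
      have hw0 : ∀ y ∈ {y | y ∈ Ioo α β ∧ v y ≠ 0}, w y = 0 := fun y hy =>
        (mul_eq_zero.1 (hvw y hy.1)).resolve_left hy.2
      have h1 := hasDerivAt_eq_zero_of_eqOn (isOpen_ne_zero_inter isOpen_Ioo S.jv.contOn) hw0
        ⟨hθ, hne⟩ (S.jw.d0 θ hθ)
      have := sw θ hθ
      rw [h1, hw0 θ ⟨hθ, hne⟩] at this
      exact (mul_eq_zero.1 (by linear_combination this : m₁₂ * (Real.cos θ * v θ) = 0)).resolve_right
        (mul_ne_zero (right_ne_zero_of_mul hsc) hne)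
    · obtain ⟨θ, hθ, hsc, hne⟩ := exists_ne_zero_sin_mul_cos S.jw.contOn hw
      have hv0 : ∀ y ∈ {y | y ∈ Ioo α β ∧ w y ≠ 0}, v y = 0 := fun y hy =>
        (mul_eq_zero.1 (hvw y hy.1)).resolve_right hy.2
      have h1 := hasDerivAt_eq_zero_of_eqOn (isOpen_ne_zero_inter isOpen_Ioo S.jw.contOn) hv0
        ⟨hθ, hne⟩ (S.jv.d0 θ hθ)
      have := sv θ hθ
      rw [h1, hv0 θ ⟨hθ, hne⟩] at this
      exact (mul_eq_zero.1 (by linear_combination -this :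
        m₂₁ * (Real.sin θ * w θ) = 0)).resolve_right
        (mul_ne_zero (left_ne_zero_of_mul hsc) hne)
  push Not at hvw
  have hcont : ContinuousOn (fun θ => Real.sin θ * Real.cos θ * (v θ * w θ)) (Ioo α β) :=
    ContinuousOn.mul (by fun_prop) (S.jv.contOn.mul S.jw.contOn)
  obtain ⟨θ₀, hθ₀, hsc₀, hvw₀⟩ := exists_ne_zero_sin_mul_cos (S.jv.contOn.mul S.jw.contOn) hvw
  set J := {θ | θ ∈ Ioo α β ∧ Real.sin θ * Real.cos θ * (v θ * w θ) ≠ 0} with hJdef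
  have hJ : IsOpen J := isOpen_ne_zero_inter isOpen_Ioo hcont
  have hJne : J.Nonempty := ⟨θ₀, hθ₀, mul_ne_zero hsc₀ hvw₀⟩
  have hJ0 : ∀ θ ∈ J, Real.sin θ ≠ 0 ∧ Real.cos θ ≠ 0 ∧ v θ ≠ 0 ∧ w θ ≠ 0 := fun θ hθ =>
    ⟨left_ne_zero_of_mul (left_ne_zero_of_mul hθ.2), right_ne_zero_of_mul (left_ne_zero_of_mul hθ.2),
      left_ne_zero_of_mul (right_ne_zero_of_mul hθ.2), right_ne_zero_of_mul (right_ne_zero_of_mul hθ.2)⟩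
  have key := fun θ (hθ : θ ∈ J) => vorticity_linear_system S eφ eχ sv sw hθ.1
    (left_ne_zero_of_mul hθ.2)
  have hκ : ∀ θ ∈ J, (m₁₁ + m₂₂) * (v θ * w θ) ≠ 0 := fun θ hθ =>
    mul_ne_zero hτ.ne' (right_ne_zero_of_mul hθ.2)
  obtain ⟨θ, hθ⟩ := hJne
  obtain ⟨h₁, h₂, r, hb, -, -⟩ := key θ hθ
  obtain ⟨b1, -, b3, b4⟩ := balance_consequences hφ hχ eφ eχ hind hl hl' hb
  have h12 : m₁₂ * m₂₁ = 0 := b1.resolve_right (hκ θ hθ)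
  have hr : ∀ θ ∈ J, -m₁₁ * m₁₂ * Real.cos θ ^ 3 * Real.sin θ * v θ ^ 2
        + m₂₂ * (m₂₂ - 1) * (Real.sin θ * Real.cos θ) ^ 2 * (v θ * w θ)
        - m₁₁ * (m₁₁ - 1) * (Real.sin θ * Real.cos θ) ^ 2 * (v θ * w θ)
        + m₂₁ * m₂₂ * Real.sin θ ^ 3 * Real.cos θ * w θ ^ 2
        + m₂₂ * Real.sin θ ^ 3 * v θ *
          (m₁₂ * Real.cos θ * v θ + (m₂₂ - 1) * Real.sin θ * w θ)
        - m₁₁ * Real.cos θ ^ 3 * w θ *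
          ((m₁₁ - 1) * Real.cos θ * v θ + m₂₁ * Real.sin θ * w θ) = 0 := by
    intro θ hθ
    obtain ⟨h₁, h₂, r, hb, hr, -⟩ := key θ hθ
    rw [← hr, (balance_consequences hφ hχ eφ eχ hind hl hl' hb).2.1 h12]
    ring
  by_contra hcon
  -- The two triangular shapes are exchanged by swapping sine with cosine and `v` with `w`; the sign
  -- `ε` of `triangular_false` records the orientation.
  rcases mul_eq_zero.1 h12 with h0 | h0
  · have hm : m₂₁ ≠ 0 := fun h => hcon ⟨h0, h⟩
    refine triangular_false (S := Real.cos) (C := Real.sin) (ε := -1) (V := w) (W := v)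
      (V₁ := w₁) (W₁ := v₁) (lam := m₂₂) (μ := m₁₁) (m := m₂₁) hJ ⟨θ, hθ⟩ (by norm_num)
      (fun x _ => by simpa using Real.hasDerivAt_cos x)
      (fun x _ => by simpa using Real.hasDerivAt_sin x) (fun x _ => Real.cos_sq_add_sin_sq x)
      (fun x hx => S.jw.d0 x hx.1) (fun x hx => S.jv.d0 x hx.1) (fun x hx => ?_) (fun x hx => ?_)
      hm (b4 h0 hm (hκ θ hθ)) (by linarith) (fun x hx => ?_) (fun x hx => ?_)
    · rw [sw x hx.1, h0]; ring
    · rw [sv x hx.1]; ring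
    · obtain ⟨a1, a2, a3, a4⟩ := hJ0 x hx
      exact ⟨a2, a1, a4, a3⟩
    · obtain ⟨a1, a2, a3, a4⟩ := hJ0 x hx
      have := hr x hx
      rw [h0] at this
      apply mul_left_cancel₀ a4
      linear_combination -this + v x * w x * (m₂₂ * (m₂₂ - 1) * Real.sin x ^ 2
        - m₁₁ * (m₁₁ - 1) * Real.cos x ^ 2) * Real.sin_sq_add_cos_sq x
  · have hm : m₁₂ ≠ 0 := fun h => hcon ⟨h, h0⟩
    refine triangular_false (S := Real.sin) (C := Real.cos) (ε := 1) (V := v) (W := w)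
      (V₁ := v₁) (W₁ := w₁) (lam := m₁₁) (μ := m₂₂) (m := m₁₂) hJ ⟨θ, hθ⟩ (by norm_num)
      (fun x _ => by simpa using Real.hasDerivAt_sin x)
      (fun x _ => by simpa using Real.hasDerivAt_cos x) (fun x _ => Real.sin_sq_add_cos_sq x)
      (fun x hx => S.jv.d0 x hx.1) (fun x hx => S.jw.d0 x hx.1) (fun x hx => ?_) (fun x hx => ?_)
      hm (b3 h0 hm (hκ θ hθ)) (by linarith) hJ0 (fun x hx => ?_)
    · rw [sv x hx.1, h0]; ring
    · rw [sw x hx.1]; ring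
    · obtain ⟨a1, a2, a3, a4⟩ := hJ0 x hx
      have := hr x hx
      rw [h0] at this
      apply mul_left_cancel₀ a3
      linear_combination this - v x * w x * (m₂₂ * (m₂₂ - 1) * Real.sin x ^ 2
        - m₁₁ * (m₁₁ - 1) * Real.cos x ^ 2) * Real.sin_sq_add_cos_sq x

lemma ne_zero_of_diagonal_profile {I : Set ℝ} {S V : ℝ → ℝ} {lam : ℝ}
    (h : (lam = 0 ∧ ∃ k, ∀ θ ∈ I, V θ = k) ∨ (lam = 1 ∧ ∃ k, ∀ θ ∈ I, V θ = k * S θ) ∨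
      (lam = 2 ∧ ∃ k, ∀ θ ∈ I, V θ = k * S θ ^ 2)) (hV : ∃ θ ∈ I, V θ ≠ 0) {θ : ℝ} (hθ : θ ∈ I)
    (hS : S θ ≠ 0) : V θ ≠ 0 := by
  obtain ⟨x, hx, hne⟩ := hV
  rcases h with ⟨-, k, hk⟩ | ⟨-, k, hk⟩ | ⟨-, k, hk⟩ <;> rw [hk x hx] at hne <;> rw [hk θ hθ]
  · exact hne
  · exact mul_ne_zero (left_ne_zero_of_mul hne) hS
  · exact mul_ne_zero (left_ne_zero_of_mul hne) (pow_ne_zero 2 hS)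

/-- The linear part of the vorticity equation puts `lam` and `μ` in `{0, 1, 2}`, so the profiles are
explicit and nonzero wherever `sin θ cos θ ≠ 0`. The quadratic part then says `μ (μ - 1) sin² θ =
lam (lam - 1) cos² θ` on an interval, so both coefficients vanish. Independence gives `lam ≠ μ`, and
`(0, 1)` and `(1, 0)` are the two shear families. -/
lemma diagonal_classified (hαβ : α < β)
    (S : SepSystem α β v v₁ v₂ v₃ w w₁ w₂ w₃ φ φ₁ φ₂ φ₃ χ χ₁ χ₂ χ₃)
    (hind : ∀ x y, (∀ t, x * φ t + y * χ t = 0) → x = 0 ∧ y = 0)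
    (hv : ∃ θ ∈ Ioo α β, v θ ≠ 0) (hw : ∃ θ ∈ Ioo α β, w θ ≠ 0) {lam μ : ℝ}
    (eφ : ∀ t, φ₁ t = lam * φ t) (eχ : ∀ t, χ₁ t = μ * χ t)
    (sv : ∀ θ ∈ Ioo α β, Real.sin θ * v₁ θ = lam * (Real.cos θ * v θ))
    (sw : ∀ θ ∈ Ioo α β, Real.cos θ * w₁ θ = -(μ * (Real.sin θ * w θ))) :
    IsClassified α β (fun t θ => v θ * φ t) (fun t θ => w θ * χ t) := by
  obtain ⟨l, hl, -⟩ := S.limφ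
  obtain ⟨l', hl', -⟩ := S.limχ
  have hφ := fun t => S.jφ.d0 t trivial
  have hχ := fun t => S.jχ.d0 t trivial
  have Eφ := eq_exp_of_deriv hφ eφ
  have Eχ := eq_exp_of_deriv hχ eχ
  have hne : lam ≠ μ := by
    intro h
    obtain ⟨h1, h2⟩ := hind (χ 0) (-φ 0) fun t => by rw [Eφ t, Eχ t, h]; ring
    have := hind 1 0 fun t => by rw [Eφ t, neg_eq_zero.1 h2]; ring
    exact one_ne_zero this.1
  have key : ∀ θ ∈ Ioo α β, Real.sin θ * Real.cos θ ≠ 0 →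
      lam * (lam - 1) * (lam - 2) * v θ = 0 ∧ μ * (μ - 1) * (μ - 2) * w θ = 0 ∧
      v θ * w θ * (μ * (μ - 1) * Real.sin θ ^ 2 - lam * (lam - 1) * Real.cos θ ^ 2) = 0 := by
    intro θ hθ hsc
    obtain ⟨h₁, h₂, r, hb, hr, hh⟩ := vorticity_linear_system (m₁₁ := lam) (m₁₂ := 0) (m₂₁ := 0)
      (m₂₂ := μ) S (fun t => by rw [eφ]; ring) (fun t => by rw [eχ]; ring)
      (fun θ hθ => by rw [sv θ hθ]; ring) (fun θ hθ => by rw [sw θ hθ]; ring) hθ hsc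
    have hr0 := (balance_consequences (m₁₁ := lam) (m₁₂ := 0) (m₂₁ := 0) (m₂₂ := μ) hφ hχ
      (fun t => by rw [eφ]; ring) (fun t => by rw [eχ]; ring) hind hl hl' hb).2.1 (by ring)
    obtain ⟨z1, z2⟩ := hind h₁ h₂ fun t => by rw [hb t, hr0]; ring
    obtain ⟨q1, q2⟩ := hh rfl rfl
    rw [z1] at q1
    rw [z2] at q2
    rw [hr0] at hr
    refine ⟨by linear_combination q1, by linear_combination -q2, ?_⟩
    linear_combination -hr - v θ * w θ * (μ * (μ - 1) * Real.sin θ ^ 2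
        - lam * (lam - 1) * Real.cos θ ^ 2) * Real.sin_sq_add_cos_sq θ
  have plam : lam * (lam - 1) * (lam - 2) = 0 := by
    obtain ⟨θ, hθ, hsc, h0⟩ := exists_ne_zero_sin_mul_cos S.jv.contOn hv
    exact (mul_eq_zero.1 (key θ hθ hsc).1).resolve_right h0
  have pμ : μ * (μ - 1) * (μ - 2) = 0 := by
    obtain ⟨θ, hθ, hsc, h0⟩ := exists_ne_zero_sin_mul_cos S.jw.contOn hw
    exact (mul_eq_zero.1 (key θ hθ hsc).2.1).resolve_right h0
  have profv := diagonal_profile (S := Real.sin) (C := Real.cos) (ε := 1) rfl hαβ (by norm_num)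
    (fun x => by simpa using Real.hasDerivAt_sin x) (fun x => by simpa using Real.hasDerivAt_cos x)
    Real.sin_sq_add_cos_sq (fun F hF h θ hθ => eq_zero_of_sin_mul_cos_mul isOpen_Ioo hF
      (fun y hy => by linear_combination Real.cos y * h y hy) hθ) S.jv
    (fun θ hθ => by rw [sv θ hθ]; ring) plam
  have profw := diagonal_profile (S := Real.cos) (C := Real.sin) (ε := -1) rfl hαβ (by norm_num)
    (fun x => by simpa using Real.hasDerivAt_cos x) (fun x => by simpa using Real.hasDerivAt_sin x)
    Real.cos_sq_add_sin_sq (fun F hF h θ hθ => eq_zero_of_sin_mul_cos_mul isOpen_Ioo hF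
      (fun y hy => by linear_combination Real.sin y * h y hy) hθ) S.jw
    (fun θ hθ => by rw [sw θ hθ]; ring) pμ
  have hPL : ∀ θ ∈ Ioo α β, μ * (μ - 1) * Real.sin θ ^ 2 - lam * (lam - 1) * Real.cos θ ^ 2 = 0 := by
    intro θ hθ
    refine eq_zero_of_sin_mul_cos_mul (F := fun θ => μ * (μ - 1) * Real.sin θ ^ 2 -
      lam * (lam - 1) * Real.cos θ ^ 2) isOpen_Ioo (by fun_prop) (fun y hy => ?_) hθ
    by_cases hsc : Real.sin y * Real.cos y = 0
    · rw [hsc, zero_mul]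
    · have h1 := ne_zero_of_diagonal_profile profv hv hy (left_ne_zero_of_mul hsc)
      have h2 := ne_zero_of_diagonal_profile profw hw hy (right_ne_zero_of_mul hsc)
      rw [(mul_eq_zero.1 (key y hy hsc).2.2).resolve_left (mul_ne_zero h1 h2), mul_zero]
  obtain ⟨θ, hθ, hsc⟩ := exists_sin_mul_cos_ne_zero hαβ
  have hd := hasDerivAt_eq_zero_of_eqOn isOpen_Ioo hPL hθ
    ((((Real.hasDerivAt_sin θ).pow 2).const_mul (μ * (μ - 1))).sub
    (((Real.hasDerivAt_cos θ).pow 2).const_mul (lam * (lam - 1))))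
  push_cast at hd
  have hsum : μ * (μ - 1) + lam * (lam - 1) = 0 :=
    (mul_eq_zero.1 (by linear_combination hd / 2 : (Real.sin θ * Real.cos θ) *
      (μ * (μ - 1) + lam * (lam - 1)) = 0)).resolve_left hsc
  have hP : μ * (μ - 1) = 0 := by
    linear_combination hPL θ hθ + Real.cos θ ^ 2 * hsum
      - μ * (μ - 1) * Real.sin_sq_add_cos_sq θ
  have hL : lam * (lam - 1) = 0 := by linarith
  rcases profv with ⟨h, a, ha⟩ | ⟨h, a, ha⟩ | ⟨h, a, ha⟩ <;>
    rcases profw with ⟨h', b, hb⟩ | ⟨h', b, hb⟩ | ⟨h', b, hb⟩ <;> subst h h' <;>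
    (try norm_num at hne) <;> (try norm_num at hP) <;> (try norm_num at hL)
  · refine Or.inr (Or.inr (Or.inr (Or.inr (Or.inr (Or.inl ⟨a * φ 0, b * χ 0,
      fun t θ hθ => ⟨?_, ?_⟩⟩)))))
    · simp only [ha θ hθ, Eφ t, zero_mul, Real.exp_zero, mul_one]
    · simp only [hb θ hθ, Eχ t, one_mul]; ring
  · refine Or.inr (Or.inr (Or.inr (Or.inr (Or.inr (Or.inr ⟨a * φ 0, b * χ 0,
      fun t θ hθ => ⟨?_, ?_⟩⟩)))))
    · simp only [ha θ hθ, Eφ t, one_mul]; ring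
    · simp only [hb θ hθ, Eχ t, zero_mul, Real.exp_zero, mul_one]

/-- Incompressibility now yields only the single relation `k φ' + χ' = p φ + q χ`, but independence
still separates the angular equations. Their compatibility with the derivative of `h` forces `p = k
q` and `q = 1`, which is the hypothesis of `swirl_classified`. -/
lemma proportional_classified (hαβ : α < β)
    (S : SepSystem α β v v₁ v₂ v₃ w w₁ w₂ w₃ φ φ₁ φ₂ φ₃ χ χ₁ χ₂ χ₃)
    (hind : ∀ x y, (∀ t, x * φ t + y * χ t = 0) → x = 0 ∧ y = 0)
    (hw : ∃ θ ∈ Ioo α β, w θ ≠ 0) {k : ℝ} (hk : k ≠ 0)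
    (h : ∀ θ ∈ Ioo α β, Real.cos θ * v θ = k * (Real.sin θ * w θ)) :
    IsClassified α β (fun t θ => v θ * φ t) (fun t θ => w θ * χ t) := by
  obtain ⟨θ₀, hθ₀, hsc₀, hw₀⟩ := exists_ne_zero_sin_mul_cos S.jw.contOn hw
  have hs₀ : Real.sin θ₀ * w θ₀ ≠ 0 := mul_ne_zero (left_ne_zero_of_mul hsc₀) hw₀
  obtain ⟨p, hp⟩ : ∃ p, p = Real.sin θ₀ * v₁ θ₀ / (Real.sin θ₀ * w θ₀) := ⟨_, rfl⟩
  obtain ⟨q, hq⟩ : ∃ q, q = -(Real.cos θ₀ * w₁ θ₀) / (Real.sin θ₀ * w θ₀) := ⟨_, rfl⟩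
  have hp' : p * (Real.sin θ₀ * w θ₀) = Real.sin θ₀ * v₁ θ₀ := by rw [hp, div_mul_cancel₀ _ hs₀]
  have hq' : q * (Real.sin θ₀ * w θ₀) = -(Real.cos θ₀ * w₁ θ₀) := by rw [hq, div_mul_cancel₀ _ hs₀]
  have hrad : ∀ t, k * φ₁ t + χ₁ t = p * φ t + q * χ t := fun t => by
    apply mul_left_cancel₀ hs₀
    linear_combination S.div t θ₀ hθ₀ - φ₁ t * h θ₀ hθ₀ - φ t * hp' - χ t * hq'
  have hang : ∀ θ ∈ Ioo α β, Real.sin θ * w θ * p - Real.sin θ * v₁ θ = 0 ∧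
      Real.sin θ * w θ * q + Real.cos θ * w₁ θ = 0 := fun θ hθ => hind _ _ fun t => by
    linear_combination S.div t θ hθ - φ₁ t * h θ hθ - Real.sin θ * w θ * hrad t
  have hrel : ∀ θ ∈ Ioo α β, Real.sin θ * w θ * (-k * Real.sin θ ^ 2 + (p - k) * Real.cos θ ^ 2 +
      k * q * Real.sin θ ^ 2) = 0 := fun θ hθ => by
    have hd := hasDerivAt_eq_zero_of_eqOn isOpen_Ioo (fun y hy => sub_eq_zero.2 (h y hy)) hθ
      (((Real.hasDerivAt_cos θ).mul (S.jv.d0 θ hθ)).sub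
        (((Real.hasDerivAt_sin θ).mul (S.jw.d0 θ hθ)).const_mul k))
    linear_combination Real.cos θ * Real.sin θ * hd + Real.sin θ ^ 2 * h θ hθ +
      Real.cos θ ^ 2 * (hang θ hθ).1 + k * Real.sin θ ^ 2 * (hang θ hθ).2
  set J := {θ | θ ∈ Ioo α β ∧ Real.sin θ * w θ ≠ 0}
  have hJ : IsOpen J := isOpen_ne_zero_inter isOpen_Ioo
    (ContinuousOn.mul (by fun_prop) S.jw.contOn)
  have hJr : ∀ θ ∈ J, -k * Real.sin θ ^ 2 + (p - k) * Real.cos θ ^ 2 +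
      k * q * Real.sin θ ^ 2 = 0 := fun θ hθ => (mul_eq_zero.1 (hrel θ hθ.1)).resolve_left hθ.2
  have hd := hasDerivAt_eq_zero_of_eqOn hJ hJr ⟨hθ₀, hs₀⟩
    (((((Real.hasDerivAt_sin θ₀).pow 2).const_mul (-k)).add
    (((Real.hasDerivAt_cos θ₀).pow 2).const_mul (p - k))).add
    (((Real.hasDerivAt_sin θ₀).pow 2).const_mul (k * q)))
  push_cast at hd
  have h1 : k * q - p = 0 := (mul_eq_zero.1 (by linear_combination hd / 2 :
    (Real.sin θ₀ * Real.cos θ₀) * (k * q - p) = 0)).resolve_left hsc₀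
  have h2 : k * (q - 1) = 0 := by
    linear_combination hJr θ₀ ⟨hθ₀, hs₀⟩ + Real.cos θ₀ ^ 2 * h1
      - k * (q - 1) * Real.sin_sq_add_cos_sq θ₀
  have hq1 : q = 1 := by
    have := (mul_eq_zero.1 h2).resolve_left hk
    linarith
  refine swirl_classified hαβ S h fun θ hθ => ?_
  have := (hang θ hθ).2
  rw [hq1] at this
  linarith

/-- Classification when the two radial factors are linearly independent. -/
lemma independent_classified (hαβ : α < β)
    (S : SepSystem α β v v₁ v₂ v₃ w w₁ w₂ w₃ φ φ₁ φ₂ φ₃ χ χ₁ χ₂ χ₃)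
    (hind : ∀ x y, (∀ t, x * φ t + y * χ t = 0) → x = 0 ∧ y = 0)
    (hv : ∃ θ ∈ Ioo α β, v θ ≠ 0) (hw : ∃ θ ∈ Ioo α β, w θ ≠ 0) :
    IsClassified α β (fun t θ => v θ * φ t) (fun t θ => w θ * χ t) := by
  obtain ⟨x, hx, hscx, hvx⟩ := exists_ne_zero_sin_mul_cos S.jv.contOn hv
  have hax : Real.cos x * v x ≠ 0 := mul_ne_zero (right_ne_zero_of_mul hscx) hvx
  by_cases hdet : ∀ y ∈ Ioo α β,
      (Real.cos x * v x) * (Real.sin y * w y) - (Real.cos y * v y) * (Real.sin x * w x) = 0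
  · by_cases hb : Real.sin x * w x = 0
    · exfalso
      obtain ⟨y, hy, hscy, hwy⟩ := exists_ne_zero_sin_mul_cos S.jw.contOn hw
      have := hdet y hy
      rw [hb, mul_zero, sub_zero] at this
      exact mul_ne_zero hax (mul_ne_zero (left_ne_zero_of_mul hscy) hwy) this
    · refine proportional_classified hαβ S hind hw
        (k := (Real.cos x * v x) / (Real.sin x * w x)) (div_ne_zero hax hb) fun θ hθ => ?_
      rw [div_mul_eq_mul_div, eq_div_iff hb]
      linear_combination -hdet θ hθ
  push Not at hdet
  obtain ⟨y, hy, hD⟩ := hdet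
  set D := (Real.cos x * v x) * (Real.sin y * w y) - (Real.cos y * v y) * (Real.sin x * w x)
    with hDdef
  -- The divergence equations at `x` and `y` are linear in `(φ', χ')` with determinant `D`; Cramer's
  -- rule gives the four entries.
  have eφ : ∀ t, φ₁ t = ((Real.sin y * w y) * (Real.sin x * v₁ x) -
      (Real.sin x * w x) * (Real.sin y * v₁ y)) / D * φ t +
      ((Real.sin x * w x) * (Real.cos y * w₁ y) -
      (Real.sin y * w y) * (Real.cos x * w₁ x)) / D * χ t := fun t => by
    field_simp
    rw [hDdef]
    linear_combination (Real.sin y * w y) * S.div t x hx - (Real.sin x * w x) * S.div t y hy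
  have eχ : ∀ t, χ₁ t = ((Real.cos x * v x) * (Real.sin y * v₁ y) -
      (Real.cos y * v y) * (Real.sin x * v₁ x)) / D * φ t +
      ((Real.cos y * v y) * (Real.cos x * w₁ x) -
      (Real.cos x * v x) * (Real.cos y * w₁ y)) / D * χ t := fun t => by
    field_simp
    rw [hDdef]
    linear_combination (Real.cos x * v x) * S.div t y hy - (Real.cos y * v y) * S.div t x hx
  generalize ((Real.sin y * w y) * (Real.sin x * v₁ x) -
      (Real.sin x * w x) * (Real.sin y * v₁ y)) / D = m₁₁ at eφ
  generalize ((Real.sin x * w x) * (Real.cos y * w₁ y) -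
      (Real.sin y * w y) * (Real.cos x * w₁ x)) / D = m₁₂ at eφ
  generalize ((Real.cos x * v x) * (Real.sin y * v₁ y) -
      (Real.cos y * v y) * (Real.sin x * v₁ x)) / D = m₂₁ at eχ
  generalize ((Real.cos y * v y) * (Real.cos x * w₁ x) -
      (Real.cos x * v x) * (Real.cos y * w₁ y)) / D = m₂₂ at eχ
  -- The radial system is substituted back into the divergence equation at an arbitrary angle, and
  -- the coefficients of the independent `φ` and `χ` vanish.
  have hsys : ∀ θ ∈ Ioo α β, m₁₁ * (Real.cos θ * v θ) + m₂₁ * (Real.sin θ * w θ)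
      - Real.sin θ * v₁ θ = 0 ∧
      m₁₂ * (Real.cos θ * v θ) + m₂₂ * (Real.sin θ * w θ) + Real.cos θ * w₁ θ = 0 :=
    fun θ hθ => hind _ _ fun t => by
      linear_combination S.div t θ hθ - Real.cos θ * v θ * eφ t - Real.sin θ * w θ * eχ t
  have sv : ∀ θ ∈ Ioo α β, Real.sin θ * v₁ θ =
      m₁₁ * (Real.cos θ * v θ) + m₂₁ * (Real.sin θ * w θ) := fun θ hθ => by
    linarith [(hsys θ hθ).1]
  have sw : ∀ θ ∈ Ioo α β, Real.cos θ * w₁ θ =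
      -(m₁₂ * (Real.cos θ * v θ)) - m₂₂ * (Real.sin θ * w θ) := fun θ hθ => by
    linarith [(hsys θ hθ).2]
  obtain ⟨h12, h21⟩ := offdiag_eq_zero S hind hv hw eφ eχ sv sw
  subst h12 h21
  exact diagonal_classified hαβ S hind hv hw (fun t => by rw [eφ]; ring) (fun t => by rw [eχ]; ring)
    (fun θ hθ => by rw [sv θ hθ]; ring) (fun θ hθ => by rw [sw θ hθ]; ring)

end IndependentFactors

/-! ### Regular factors from a separated field -/

section Separated

variable {Ω : Set Plane} {u : Plane → Plane} {p : Plane → ℝ} {α β : ℝ}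

lemma contDiff_logPolar_left (θ : ℝ) : ContDiff ℝ 3 (fun t => logPolar t θ) := by
  rw [contDiff_euclidean]
  intro i
  fin_cases i
  · exact Real.contDiff_exp.mul contDiff_const
  · exact Real.contDiff_exp.mul contDiff_const

lemma contDiff_logPolar_right (t : ℝ) : ContDiff ℝ 3 (fun θ => logPolar t θ) := by
  rw [contDiff_euclidean]
  intro i
  fin_cases i
  · exact contDiff_const.mul Real.contDiff_cos
  · exact contDiff_const.mul Real.contDiff_sin

/-- The given factors may be irregular. Freezing one variable at a point `(t₀, θ₀)` where the
component is nonzero gives smooth ones: `φ = u(·, θ₀)` and `v = u(t₀, ·) / u(t₀, θ₀)`. All rays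
share the limit `u 0`, so `v θ` times the limit of `φ` does not depend on `θ`. -/
lemma exists_factor_jets (hu : ContDiffOn ℝ 3 u Ω)
    (hmem : ∀ t, ∀ θ ∈ Ioo α β, logPolar t θ ∈ Ω)
    (hlim : ∀ θ ∈ Ioo α β, Tendsto (fun t => u (logPolar t θ)) atBot (𝓝 (u 0))) (i : Fin 2)
    {f g : ℝ → ℝ} (hfg : ∀ t, ∀ θ ∈ Ioo α β, u (logPolar t θ) i = f θ * g t) :
    ∃ v v₁ v₂ v₃ φ φ₁ φ₂ φ₃ : ℝ → ℝ, Jet (Ioo α β) v v₁ v₂ v₃ ∧ Jet univ φ φ₁ φ₂ φ₃ ∧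
      (∀ t, ∀ θ ∈ Ioo α β, u (logPolar t θ) i = v θ * φ t) ∧
      ∃ l, Tendsto φ atBot (𝓝 l) ∧ ∀ θ ∈ Ioo α β, ∀ θ' ∈ Ioo α β, v θ * l = v θ' * l := by
  by_cases h0 : ∀ t, ∀ θ ∈ Ioo α β, u (logPolar t θ) i = 0
  · refine ⟨0, 0, 0, 0, 0, 0, 0, 0, jet_zero _, jet_zero _, fun t θ hθ => by simp [h0 t θ hθ],
      0, tendsto_const_nhds, fun _ _ _ _ => by simp⟩
  push Not at h0
  obtain ⟨t₀, θ₀, hθ₀, hne⟩ := h0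
  have cu : ContDiffOn ℝ 3 (fun z => u z i) Ω := contDiffOn_euclidean.1 hu i
  have cφ : ContDiffOn ℝ 3 (fun t => u (logPolar t θ₀) i) univ :=
    cu.comp (contDiff_logPolar_left θ₀).contDiffOn fun t _ => hmem t θ₀ hθ₀
  have cv : ContDiffOn ℝ 3 (fun θ => u (logPolar t₀ θ) i / u (logPolar t₀ θ₀) i) (Ioo α β) :=
    (cu.comp (contDiff_logPolar_right t₀).contDiffOn fun θ hθ => hmem t₀ θ hθ).div_const _
  obtain ⟨φ₁, φ₂, φ₃, jφ⟩ := exists_jet isOpen_univ cφ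
  obtain ⟨v₁, v₂, v₃, jv⟩ := exists_jet isOpen_Ioo cv
  have hprod : ∀ t, ∀ θ ∈ Ioo α β, u (logPolar t θ) i =
      u (logPolar t₀ θ) i / u (logPolar t₀ θ₀) i * u (logPolar t θ₀) i := by
    intro t θ hθ
    field_simp
    rw [hfg t θ hθ, hfg t₀ θ₀ hθ₀, hfg t₀ θ hθ, hfg t θ₀ hθ₀]
    ring
  have hlim' : ∀ θ ∈ Ioo α β, Tendsto (fun t => u (logPolar t θ) i) atBot (𝓝 (u 0 i)) :=
    fun θ hθ => ((EuclideanSpace.proj (𝕜 := ℝ) i).continuous.tendsto (u 0)).comp (hlim θ hθ)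
  refine ⟨_, v₁, v₂, v₃, _, φ₁, φ₂, φ₃, jv, jφ, hprod, u 0 i, hlim' θ₀ hθ₀, ?_⟩
  have hval : ∀ θ ∈ Ioo α β, u (logPolar t₀ θ) i / u (logPolar t₀ θ₀) i * u 0 i = u 0 i := by
    intro θ hθ
    refine tendsto_nhds_unique ((hlim' θ₀ hθ₀).const_mul _) ((hlim' θ hθ).congr fun t => ?_)
    exact hprod t θ hθ
  intro θ hθ θ' hθ'
  exact (hval θ hθ).trans (hval θ' hθ').symm

lemma IsClassified.congr {U V U' V' : ℝ → ℝ → ℝ} (h : IsClassified α β U V)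
    (hU : ∀ t, ∀ θ ∈ Ioo α β, U' t θ = U t θ) (hV : ∀ t, ∀ θ ∈ Ioo α β, V' t θ = V t θ) :
    IsClassified α β U' V' := by
  rcases h with ⟨a, b, h⟩ | ⟨a, b, c, h⟩ | ⟨a, b, c, d, e, f, h⟩ | ⟨a, b, c, d, h⟩ | ⟨a, b, h⟩ |
    ⟨a, b, h⟩ | ⟨a, b, h⟩
  · exact Or.inl ⟨a, b, fun t θ hθ => by rw [hU t θ hθ, hV t θ hθ]; exact h t θ hθ⟩
  · exact Or.inr (Or.inl ⟨a, b, c, fun t θ hθ => by rw [hU t θ hθ, hV t θ hθ]; exact h t θ hθ⟩)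
  · exact Or.inr (Or.inr (Or.inl ⟨a, b, c, d, e, f, fun t θ hθ => by
      rw [hU t θ hθ, hV t θ hθ]; exact h t θ hθ⟩))
  · exact Or.inr (Or.inr (Or.inr (Or.inl ⟨a, b, c, d, fun t θ hθ => by
      rw [hU t θ hθ, hV t θ hθ]; exact h t θ hθ⟩)))
  · exact Or.inr (Or.inr (Or.inr (Or.inr (Or.inl ⟨a, b, fun t θ hθ => by
      rw [hU t θ hθ, hV t θ hθ]; exact h t θ hθ⟩))))
  · exact Or.inr (Or.inr (Or.inr (Or.inr (Or.inr (Or.inl ⟨a, b, fun t θ hθ => by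
      rw [hU t θ hθ, hV t θ hθ]; exact h t θ hθ⟩)))))
  · exact Or.inr (Or.inr (Or.inr (Or.inr (Or.inr (Or.inr ⟨a, b, fun t θ hθ => by
      rw [hU t θ hθ, hV t θ hθ]; exact h t θ hθ⟩)))))

/-- Classification of separated solutions in logarithmic polar coordinates. -/
lemma separated_classified (hΩ : IsOpen Ω) (hu : ContDiffOn ℝ 3 u Ω) (hp : ContDiffOn ℝ 1 p Ω)
    (hsol : IsSolution Ω u p) (hαβ : α < β) (hmem : ∀ t, ∀ θ ∈ Ioo α β, logPolar t θ ∈ Ω)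
    (hlim : ∀ θ ∈ Ioo α β, Tendsto (fun t => u (logPolar t θ)) atBot (𝓝 (u 0)))
    {f g f' g' : ℝ → ℝ} (hfg : ∀ t, ∀ θ ∈ Ioo α β, u (logPolar t θ) 0 = f θ * g t)
    (hfg' : ∀ t, ∀ θ ∈ Ioo α β, u (logPolar t θ) 1 = f' θ * g' t) :
    IsClassified α β (fun t θ => u (logPolar t θ) 0) (fun t θ => u (logPolar t θ) 1) := by
  obtain ⟨v, v₁, v₂, v₃, φ, φ₁, φ₂, φ₃, jv, jφ, h0, hlφ⟩ := exists_factor_jets hu hmem hlim 0 hfg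
  obtain ⟨w, w₁, w₂, w₃, χ, χ₁, χ₂, χ₃, jw, jχ, h1, hlχ⟩ := exists_factor_jets hu hmem hlim 1 hfg'
  -- Every degenerate case, a zero component or dependent radial factors, can be rewritten with one
  -- radial factor `ψ` for both components.
  have common : ∀ {a a₁ a₂ a₃ b b₁ b₂ b₃ ψ ψ₁ ψ₂ ψ₃ : ℝ → ℝ}, Jet (Ioo α β) a a₁ a₂ a₃ →
      Jet (Ioo α β) b b₁ b₂ b₃ → Jet univ ψ ψ₁ ψ₂ ψ₃ →
      (∀ t, ∀ θ ∈ Ioo α β, u (logPolar t θ) 0 = a θ * ψ t) →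
      (∀ t, ∀ θ ∈ Ioo α β, u (logPolar t θ) 1 = b θ * ψ t) →
      (∃ l, Tendsto ψ atBot (𝓝 l) ∧ ∀ θ ∈ Ioo α β, ∀ θ' ∈ Ioo α β, a θ * l = a θ' * l) →
      (∃ l, Tendsto ψ atBot (𝓝 l) ∧ ∀ θ ∈ Ioo α β, ∀ θ' ∈ Ioo α β, b θ * l = b θ' * l) →
      IsClassified α β (fun t θ => u (logPolar t θ) 0) (fun t θ => u (logPolar t θ) 1) := by
    intro a a₁ a₂ a₃ b b₁ b₂ b₃ ψ ψ₁ ψ₂ ψ₃ ja jb jψ ha hb hla hlb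
    exact (dependent_classified hαβ (vorticity_of_separated hΩ hu hp hsol hmem ja jb jψ jψ ha hb
      hla hlb)).congr ha hb
  by_cases hv : ∃ θ ∈ Ioo α β, v θ ≠ 0
  swap
  · push Not at hv
    have ⟨l, hl, _⟩ := hlχ
    exact common (jet_zero _) jw jχ (fun t θ hθ => by rw [h0 t θ hθ, hv θ hθ]; simp) h1
      ⟨l, hl, fun _ _ _ _ => by simp⟩ hlχ
  by_cases hw : ∃ θ ∈ Ioo α β, w θ ≠ 0
  swap
  · push Not at hw
    have ⟨l, hl, _⟩ := hlφ
    exact common jv (jet_zero _) jφ h0 (fun t θ hθ => by rw [h1 t θ hθ, hw θ hθ]; simp)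
      hlφ ⟨l, hl, fun _ _ _ _ => by simp⟩
  by_cases hind : ∀ x y, (∀ t, x * φ t + y * χ t = 0) → x = 0 ∧ y = 0
  · exact (independent_classified hαβ (vorticity_of_separated hΩ hu hp hsol hmem jv jw jφ jχ h0 h1
      hlφ hlχ) hind hv hw).congr h0 h1
  push Not at hind
  obtain ⟨x, y, hxy, hne⟩ := hind
  obtain ⟨l, hl, hcl⟩ := hlφ
  obtain ⟨l', hl', hcl'⟩ := hlχ
  by_cases hy : y = 0
  · have hx : x ≠ 0 := fun hx => hne hx hy
    have hφ : ∀ t, φ t = 0 := fun t => by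
      have := hxy t
      rw [hy, zero_mul, add_zero] at this
      exact (mul_eq_zero.1 this).resolve_left hx
    exact common (jet_zero _) jw jχ (fun t θ hθ => by rw [h0 t θ hθ, hφ t]; simp) h1
      ⟨l', hl', fun _ _ _ _ => by simp⟩ ⟨l', hl', hcl'⟩
  · have hχ : ∀ t, χ t = -(x / y) * φ t := fun t => by
      have := hxy t
      field_simp
      linarith
    have hll : l' = -(x / y) * l :=
      tendsto_nhds_unique hl' ((hl.const_mul (-(x / y))).congr fun t => (hχ t).symm)
    refine common jv (jw.const_mul (-(x / y))) jφ h0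
      (fun t θ hθ => by rw [h1 t θ hθ, hχ t]; ring) ⟨l, hl, hcl⟩ ⟨l, hl, fun θ hθ θ' hθ' => ?_⟩
    have := hcl' θ hθ θ' hθ'
    rw [hll] at this
    linarith

end Separated

/-! ### Recovery of the pressure -/

/-- The list of admissible flows, velocity and pressure, in logarithmic polar coordinates. -/
def IsClassifiedFlow (α β : ℝ) (u : Plane → Plane) (p : Plane → ℝ) : Prop :=
  (∃ C₁ C₂ C₃ : ℝ, ∀ t, ∀ θ ∈ Ioo α β, (u (logPolar t θ) 0 = C₁ ∧ u (logPolar t θ) 1 = C₂) ∧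
    p (logPolar t θ) = C₃) ∨
  (∃ C₁ C₂ C₃ C₄ : ℝ, ∀ t, ∀ θ ∈ Ioo α β,
    (u (logPolar t θ) 0 = Real.exp t * (C₁ * Real.cos θ + C₂ * Real.sin θ) ∧
    u (logPolar t θ) 1 = Real.exp t * (C₃ * Real.cos θ - C₁ * Real.sin θ)) ∧
    p (logPolar t θ) = -(1 / 2) * (C₁ ^ 2 + C₂ * C₃) * Real.exp t ^ 2 + C₄) ∨
  (∃ C₁ C₂ C₃ C₄ C₅ : ℝ, C₁ * C₃ + C₂ * C₄ - 2 * C₁ * C₂ = 0 ∧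
    C₁ * C₄ - C₂ * C₃ + C₁ ^ 2 - C₂ ^ 2 = 0 ∧ ∀ t, ∀ θ ∈ Ioo α β,
    (u (logPolar t θ) 0 = Real.exp t ^ 2 * ((C₂ + C₃) * Real.cos θ ^ 2 +
      (3 * C₂ - C₃) * Real.sin θ ^ 2 + 2 * (C₁ + C₄) * (Real.cos θ * Real.sin θ)) ∧
    u (logPolar t θ) 1 = Real.exp t ^ 2 * ((C₄ - 3 * C₁) * Real.cos θ ^ 2 -
      (C₁ + C₄) * Real.sin θ ^ 2 - 2 * (C₂ + C₃) * (Real.cos θ * Real.sin θ))) ∧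
    p (logPolar t θ) = 1 / 2 * (C₁ ^ 2 + C₂ ^ 2 - C₃ ^ 2 - C₄ ^ 2) * Real.exp t ^ 4 +
      8 * C₂ * (Real.exp t * Real.cos θ) - 8 * C₁ * (Real.exp t * Real.sin θ) + C₅) ∨
  (∃ C₁ C₂ lam C₃ : ℝ, lam ∈ Ioo (0 : ℝ) 1 ∪ Ioo (1 : ℝ) 2 ∪ Ioi (2 : ℝ) ∧ ∀ t, ∀ θ ∈ Ioo α β,
    (u (logPolar t θ) 0 =
      Real.exp (lam * t) * (C₁ * Real.cos (lam * θ) + C₂ * Real.sin (lam * θ)) ∧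
    u (logPolar t θ) 1 =
      Real.exp (lam * t) * (C₂ * Real.cos (lam * θ) - C₁ * Real.sin (lam * θ))) ∧
    p (logPolar t θ) = -(1 / 2) * (C₁ ^ 2 + C₂ ^ 2) * Real.exp (lam * t) ^ 2 + C₃) ∨
  (∃ C₁ C₂ C₃ : ℝ, ∀ t, ∀ θ ∈ Ioo α β,
    (u (logPolar t θ) 0 = -((C₁ + C₂ * t) * (Real.exp t * Real.sin θ)) ∧
    u (logPolar t θ) 1 = (C₁ + C₂ * t) * (Real.exp t * Real.cos θ)) ∧
    p (logPolar t θ) = 1 / 2 * Real.exp t ^ 2 * (C₂ ^ 2 * t ^ 2 + (2 * C₁ * C₂ - C₂ ^ 2) * t +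
      C₁ ^ 2 - C₁ * C₂ + 1 / 2 * C₂ ^ 2) + 2 * C₂ * θ + C₃) ∨
  (∃ C₁ C₂ C₃ : ℝ, ∀ t, ∀ θ ∈ Ioo α β,
    (u (logPolar t θ) 0 = C₁ ∧ u (logPolar t θ) 1 = C₂ * (Real.exp t * Real.cos θ)) ∧
    p (logPolar t θ) = -C₁ * C₂ * (Real.exp t * Real.sin θ) + C₃) ∨
  (∃ C₁ C₂ C₃ : ℝ, ∀ t, ∀ θ ∈ Ioo α β,
    (u (logPolar t θ) 0 = C₁ * (Real.exp t * Real.sin θ) ∧ u (logPolar t θ) 1 = C₂) ∧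
    p (logPolar t θ) = -C₁ * C₂ * (Real.exp t * Real.cos θ) + C₃)

section Pressure

variable {Ω : Set Plane} {u : Plane → Plane} {p : Plane → ℝ} {α β : ℝ}

/-- The pressure is determined up to a constant by a product velocity field. -/
lemma pressure_eq (hΩ : IsOpen Ω) (hu : ContDiffOn ℝ 3 u Ω) (hp : ContDiffOn ℝ 1 p Ω)
    (hsol : IsSolution Ω u p) (hαβ : α < β) (hmem : ∀ t, ∀ θ ∈ Ioo α β, logPolar t θ ∈ Ω)
    {a a₁ a₂ f f₁ f₂ b b₁ b₂ g g₁ g₂ : ℝ → ℝ} {P Pt Pθ : ℝ → ℝ → ℝ}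
    (da : ∀ x, HasDerivAt a (a₁ x) x) (da₁ : ∀ x, HasDerivAt a₁ (a₂ x) x)
    (df : ∀ x, HasDerivAt f (f₁ x) x) (df₁ : ∀ x, HasDerivAt f₁ (f₂ x) x)
    (db : ∀ x, HasDerivAt b (b₁ x) x) (db₁ : ∀ x, HasDerivAt b₁ (b₂ x) x)
    (dg : ∀ x, HasDerivAt g (g₁ x) x) (dg₁ : ∀ x, HasDerivAt g₁ (g₂ x) x)
    (dPt : ∀ t θ, HasDerivAt (fun τ => P τ θ) (Pt t θ) t)
    (dPθ : ∀ t θ, HasDerivAt (fun η => P t η) (Pθ t θ) θ)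
    (huv : ∀ t, ∀ θ ∈ Ioo α β, u (logPolar t θ) 0 = f t * a θ ∧ u (logPolar t θ) 1 = g t * b θ)
    (et : ∀ t θ, Real.exp t * Pt t θ =
      Real.cos θ * (f₂ t * a θ + f t * a₂ θ - Real.exp t *
        ((Real.cos θ * (f t * a θ) + Real.sin θ * (g t * b θ)) * (f₁ t * a θ) +
        (-Real.sin θ * (f t * a θ) + Real.cos θ * (g t * b θ)) * (f t * a₁ θ))) +
      Real.sin θ * (g₂ t * b θ + g t * b₂ θ - Real.exp t *
        ((Real.cos θ * (f t * a θ) + Real.sin θ * (g t * b θ)) * (g₁ t * b θ) +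
        (-Real.sin θ * (f t * a θ) + Real.cos θ * (g t * b θ)) * (g t * b₁ θ))))
    (eθ : ∀ t θ, Real.exp t * Pθ t θ =
      -Real.sin θ * (f₂ t * a θ + f t * a₂ θ - Real.exp t *
        ((Real.cos θ * (f t * a θ) + Real.sin θ * (g t * b θ)) * (f₁ t * a θ) +
        (-Real.sin θ * (f t * a θ) + Real.cos θ * (g t * b θ)) * (f t * a₁ θ))) +
      Real.cos θ * (g₂ t * b θ + g t * b₂ θ - Real.exp t *
        ((Real.cos θ * (f t * a θ) + Real.sin θ * (g t * b θ)) * (g₁ t * b θ) +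
        (-Real.sin θ * (f t * a θ) + Real.cos θ * (g t * b θ)) * (g t * b₁ θ)))) :
    ∃ C, ∀ t, ∀ θ ∈ Ioo α β, p (logPolar t θ) = P t θ + C := by
  have hF : HasPolarPartials α β (fun t θ => f t * a θ) (fun t θ => f₁ t * a θ)
      (fun t θ => f₂ t * a θ) (fun t θ => f t * a₁ θ) (fun t θ => f t * a₂ θ) :=
    ⟨fun t θ _ => (df t).mul_const _, fun t θ _ => (df₁ t).mul_const _,
      fun t θ _ => (da θ).const_mul _, fun t θ _ => (da₁ θ).const_mul _⟩
  have hG : HasPolarPartials α β (fun t θ => g t * b θ) (fun t θ => g₁ t * b θ)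
      (fun t θ => g₂ t * b θ) (fun t θ => g t * b₁ θ) (fun t θ => g t * b₂ θ) :=
    ⟨fun t θ _ => (dg t).mul_const _, fun t θ _ => (dg₁ t).mul_const _,
      fun t θ _ => (db θ).const_mul _, fun t θ _ => (db₁ θ).const_mul _⟩
  have hd := fun t θ (hθ : θ ∈ Ioo α β) => hasFDerivAt_pressure hΩ hu hp hsol hmem hF hG
    (fun t θ hθ => (huv t θ hθ).1) (fun t θ hθ => (huv t θ hθ).2) (t := t) hθ
  have he : ∀ t, Real.exp (-t) * Real.exp t = 1 := fun t => by rw [← Real.exp_add]; simp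
  have ht : ∀ θ ∈ Ioo α β, ∀ t, HasDerivAt (fun τ => p (logPolar τ θ) - P τ θ) 0 t := by
    intro θ hθ t
    have c1 : HasDerivAt (fun τ : ℝ => ((τ, θ) : ℝ × ℝ)) (1, 0) t :=
      (hasDerivAt_id t).prodMk (hasDerivAt_const t θ)
    refine ((HasFDerivAt.comp_hasDerivAt (f := fun τ : ℝ => ((τ, θ) : ℝ × ℝ)) t (hd t θ hθ) c1).sub
      (dPt t θ)).congr_deriv ?_
    simp [forcing]
    linear_combination -Real.exp (-t) * et t θ + Pt t θ * he t
  have hη : ∀ t, ∀ θ ∈ Ioo α β, HasDerivAt (fun η => p (logPolar t η) - P t η) 0 θ := by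
    intro t θ hθ
    have c2 : HasDerivAt (fun η : ℝ => ((t, η) : ℝ × ℝ)) (0, 1) θ :=
      (hasDerivAt_const θ t).prodMk (hasDerivAt_id θ)
    refine ((HasFDerivAt.comp_hasDerivAt (f := fun η : ℝ => ((t, η) : ℝ × ℝ)) θ (hd t θ hθ) c2).sub
      (dPθ t θ)).congr_deriv ?_
    simp [forcing]
    linear_combination -Real.exp (-t) * eθ t θ + Pθ t θ * he t
  obtain ⟨θ₀, hθ₀⟩ := nonempty_Ioo.2 hαβ
  refine ⟨p (logPolar 0 θ₀) - P 0 θ₀, fun t θ hθ => ?_⟩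
  have h1 : p (logPolar t θ) - P t θ = p (logPolar 0 θ) - P 0 θ :=
    const_of_hasDerivAt_zero_univ (ht θ hθ) t 0
  have h2 : p (logPolar 0 θ) - P 0 θ = p (logPolar 0 θ₀) - P 0 θ₀ :=
    const_of_hasDerivAt_zero (hη 0) hθ hθ₀
  linarith

lemma classified_flow (hΩ : IsOpen Ω) (hu : ContDiffOn ℝ 3 u Ω) (hp : ContDiffOn ℝ 1 p Ω)
    (hsol : IsSolution Ω u p) (hαβ : α < β) (hmem : ∀ t, ∀ θ ∈ Ioo α β, logPolar t θ ∈ Ω)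
    (h : IsClassified α β (fun t θ => u (logPolar t θ) 0) (fun t θ => u (logPolar t θ) 1)) :
    IsClassifiedFlow α β u p := by
  have hS := Real.hasDerivAt_sin
  have hC := Real.hasDerivAt_cos
  have hE := Real.hasDerivAt_exp
  have h0 : ∀ x : ℝ, HasDerivAt (fun _ : ℝ => (0 : ℝ)) 0 x := fun x => hasDerivAt_const x 0
  have hk : ∀ k x : ℝ, HasDerivAt (fun _ : ℝ => k) 0 x := fun k x => hasDerivAt_const x k
  have hnS : ∀ x, HasDerivAt (fun x => -Real.sin x) (-Real.cos x) x := fun x => (hS x).neg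
  have hnC : ∀ x, HasDerivAt (fun x => -Real.cos x) (Real.sin x) x := fun x =>
    (hC x).neg.congr_deriv (by simp)
  have hE2 : ∀ x, HasDerivAt (fun x => Real.exp x ^ 2) (2 * Real.exp x ^ 2) x := fun x => by
    refine ((hE x).pow 2).congr_deriv ?_
    push_cast; ring
  rcases h with ⟨a, b, h⟩ | ⟨a, b, c, h⟩ | ⟨a, b, c, d, k1, k2, h⟩ | ⟨a, b, lam, hlam, h⟩ |
    ⟨a, b, h⟩ | ⟨a, b, h⟩ | ⟨a, b, h⟩
  · obtain ⟨C, hP⟩ := pressure_eq (P := fun _ _ => 0) (Pt := fun _ _ => 0) (Pθ := fun _ _ => 0) hΩ hu hp hsol hαβ hmem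
      (hk a) h0 (hk 1) h0 (hk b) h0 (hk 1) h0 (fun t _ => h0 t) (fun _ θ => h0 θ)
      (fun t θ hθ => by simpa using h t θ hθ) (fun t θ => by ring) (fun t θ => by ring)
    exact Or.inl ⟨a, b, C, fun t θ hθ => ⟨h t θ hθ, by simpa using hP t θ hθ⟩⟩
  · obtain ⟨C, hP⟩ := pressure_eq (P := fun t _ => -(1 / 2) * (a ^ 2 + b * c) * Real.exp t ^ 2)
      hΩ hu hp hsol hαβ hmem
      (fun x => ((hC x).const_mul a).add ((hS x).const_mul b))
      (fun x => ((hnS x).const_mul a).add ((hC x).const_mul b)) hE hE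
      (fun x => ((hC x).const_mul c).sub ((hS x).const_mul a))
      (fun x => ((hnS x).const_mul c).sub ((hC x).const_mul a)) hE hE
      (fun t _ => (hE2 t).const_mul _) (fun _ => hk _) h
      (fun t θ => by
        have := Real.sin_sq_add_cos_sq θ
        simp only [Pi.add_apply, Pi.sub_apply]
        grind)
      (fun t θ => by
        have := Real.sin_sq_add_cos_sq θ
        simp only [Pi.add_apply, Pi.sub_apply]
        grind)
    exact Or.inr (Or.inl ⟨a, b, c, C, fun t θ hθ => ⟨h t θ hθ, hP t θ hθ⟩⟩)
  -- The curl of the quadratic field is `-8 (a x + b y)`. The constraints `k1` and `k2` say exactly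
  -- that it is constant along the flow, which makes the convective term a gradient; both pressure
  -- identities are checked with them in context.
  · have h' : ∀ t, ∀ θ ∈ Ioo α β, _ := fun t θ hθ => h t θ hθ
    have hexp2 : ∀ t : ℝ, Real.exp (2 * t) = Real.exp t ^ 2 := fun t => by
      rw [← Real.exp_nat_mul]; norm_num
    simp only [hexp2] at h
    obtain ⟨C, hP⟩ := pressure_eq
      (P := fun t θ => 1 / 2 * (a ^ 2 + b ^ 2 - c ^ 2 - d ^ 2) * Real.exp t ^ 4 +
        8 * b * (Real.exp t * Real.cos θ) - 8 * a * (Real.exp t * Real.sin θ))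
      (Pt := fun t θ => 2 * (a ^ 2 + b ^ 2 - c ^ 2 - d ^ 2) * Real.exp t ^ 4 +
        8 * b * (Real.exp t * Real.cos θ) - 8 * a * (Real.exp t * Real.sin θ))
      (Pθ := fun t θ => -8 * b * (Real.exp t * Real.sin θ) - 8 * a * (Real.exp t * Real.cos θ))
      (a₁ := fun θ => (4 * b - 4 * c) * (Real.cos θ * Real.sin θ) +
        2 * (a + d) * (Real.cos θ ^ 2 - Real.sin θ ^ 2))
      (a₂ := fun θ => (4 * b - 4 * c) * (Real.cos θ ^ 2 - Real.sin θ ^ 2) -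
        8 * (a + d) * (Real.cos θ * Real.sin θ))
      (b₁ := fun θ => (4 * a - 4 * d) * (Real.cos θ * Real.sin θ) -
        2 * (b + c) * (Real.cos θ ^ 2 - Real.sin θ ^ 2))
      (b₂ := fun θ => (4 * a - 4 * d) * (Real.cos θ ^ 2 - Real.sin θ ^ 2) +
        8 * (b + c) * (Real.cos θ * Real.sin θ))
      (f₂ := fun t => 2 * (2 * Real.exp t ^ 2)) (g₂ := fun t => 2 * (2 * Real.exp t ^ 2))
      hΩ hu hp hsol hαβ hmem
      (fun x => by
        refine (((((hC x).pow 2).const_mul (b + c)).add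
          (((hS x).pow 2).const_mul (3 * b - c))).add
          (((hC x).mul (hS x)).const_mul (2 * (a + d)))).congr_deriv ?_
        push_cast; ring)
      (fun x => by
        refine ((((hC x).mul (hS x)).const_mul (4 * b - 4 * c)).add
          ((((hC x).pow 2).sub ((hS x).pow 2)).const_mul (2 * (a + d)))).congr_deriv ?_
        push_cast; ring)
      hE2 (fun x => (hE2 x).const_mul 2)
      (fun x => by
        refine (((((hC x).pow 2).const_mul (d - 3 * a)).sub
          (((hS x).pow 2).const_mul (a + d))).sub
          (((hC x).mul (hS x)).const_mul (2 * (b + c)))).congr_deriv ?_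
        push_cast; ring)
      (fun x => by
        refine ((((hC x).mul (hS x)).const_mul (4 * a - 4 * d)).sub
          ((((hC x).pow 2).sub ((hS x).pow 2)).const_mul (2 * (b + c)))).congr_deriv ?_
        push_cast; ring)
      hE2 (fun x => (hE2 x).const_mul 2)
      (fun t θ => by
        refine (((((hE t).pow 4).const_mul _).add
          (((hE t).mul_const _).const_mul _)).sub (((hE t).mul_const _).const_mul _)).congr_deriv ?_
        push_cast; ring)
      (fun t θ => by
        refine (((((hC θ).const_mul (Real.exp t)).const_mul (8 * b)).const_add _).sub
          (((hS θ).const_mul (Real.exp t)).const_mul (8 * a))).congr_deriv ?_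
        ring) h
      (fun t θ => by
        have := Real.sin_sq_add_cos_sq θ
        generalize Real.sin θ = s at *
        generalize Real.cos θ = c at *
        generalize Real.exp t = e at *
        clear h hp hu hsol hmem hS hC hE h0 hk hnS hnC hE2 hexp2
        grind)
      (fun t θ => by
        have := Real.sin_sq_add_cos_sq θ
        generalize Real.sin θ = s at *
        generalize Real.cos θ = c at *
        generalize Real.exp t = e at *
        clear h hp hu hsol hmem hS hC hE h0 hk hnS hnC hE2 hexp2
        grind)
    exact Or.inr (Or.inr (Or.inl ⟨a, b, c, d, C, k1, k2, fun t θ hθ => ⟨h t θ hθ, hP t θ hθ⟩⟩))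
  · have hEl : ∀ x, HasDerivAt (fun x => Real.exp (lam * x)) (lam * Real.exp (lam * x)) x :=
      fun x => by
        refine (((hasDerivAt_id x).const_mul lam).exp).congr_deriv ?_
        simp; ring
    have hSl : ∀ x, HasDerivAt (fun x => Real.sin (lam * x)) (lam * Real.cos (lam * x)) x :=
      fun x => by
        refine (((hasDerivAt_id x).const_mul lam).sin).congr_deriv ?_
        simp; ring
    have hCl : ∀ x, HasDerivAt (fun x => Real.cos (lam * x)) (-(lam * Real.sin (lam * x))) x :=
      fun x => by
        refine (((hasDerivAt_id x).const_mul lam).cos).congr_deriv ?_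
        simp; ring
    have hA : ∀ x, HasDerivAt (fun x => a * Real.cos (lam * x) + b * Real.sin (lam * x))
        (lam * (b * Real.cos (lam * x) - a * Real.sin (lam * x))) x := fun x => by
      refine (((hCl x).const_mul a).add ((hSl x).const_mul b)).congr_deriv ?_
      ring
    have hB : ∀ x, HasDerivAt (fun x => b * Real.cos (lam * x) - a * Real.sin (lam * x))
        (-lam * (a * Real.cos (lam * x) + b * Real.sin (lam * x))) x := fun x => by
      refine (((hCl x).const_mul b).sub ((hSl x).const_mul a)).congr_deriv ?_
      ring
    obtain ⟨C, hP⟩ := pressure_eq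
      (P := fun t _ => -(1 / 2) * (a ^ 2 + b ^ 2) * Real.exp (lam * t) ^ 2)
      (Pt := fun t _ => -lam * (a ^ 2 + b ^ 2) * Real.exp (lam * t) ^ 2)
      hΩ hu hp hsol hαβ hmem hA (fun x => (hB x).const_mul lam) hEl (fun x => (hEl x).const_mul lam)
      hB (fun x => (hA x).const_mul (-lam)) hEl (fun x => (hEl x).const_mul lam)
      (fun t θ => by
        refine (((hEl t).pow 2).const_mul _).congr_deriv ?_
        push_cast; ring) (fun _ => hk _) h
      (fun t θ => by
        have h1 := Real.sin_sq_add_cos_sq θ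
        have h2 := Real.sin_sq_add_cos_sq (lam * θ)
        generalize Real.sin θ = s at *
        generalize Real.cos θ = c at *
        generalize Real.sin (lam * θ) = S at *
        generalize Real.cos (lam * θ) = K at *
        generalize Real.exp (lam * t) = E at *
        generalize Real.exp t = e at *
        linear_combination (lam * e * E ^ 2 * (a ^ 2 + b ^ 2) * (S ^ 2 + K ^ 2)) * h1 +
          lam * e * E ^ 2 * (a ^ 2 + b ^ 2) * h2)
      (fun t θ => by ring)
    exact Or.inr (Or.inr (Or.inr (Or.inl ⟨a, b, lam, C, hlam, fun t θ hθ =>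
      ⟨h t θ hθ, hP t θ hθ⟩⟩)))
  · have hf : ∀ x, HasDerivAt (fun x => (a + b * x) * Real.exp x) ((a + b + b * x) * Real.exp x) x :=
      fun x => by
        refine ((((hasDerivAt_id x).const_mul b).const_add a).mul (hE x)).congr_deriv ?_
        simp; ring
    have hf' : ∀ x, HasDerivAt (fun x => (a + b + b * x) * Real.exp x)
        ((a + b + b + b * x) * Real.exp x) x :=
      fun x => by
        refine ((((hasDerivAt_id x).const_mul b).const_add (a + b)).mul (hE x)).congr_deriv ?_
        simp; ring
    obtain ⟨C, hP⟩ := pressure_eq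
      (P := fun t θ => 1 / 2 * Real.exp t ^ 2 * (b ^ 2 * t ^ 2 + (2 * a * b - b ^ 2) * t +
        a ^ 2 - a * b + 1 / 2 * b ^ 2) + 2 * b * θ)
      (Pt := fun t _ => Real.exp t ^ 2 * (a + b * t) ^ 2) (Pθ := fun _ _ => 2 * b)
      hΩ hu hp hsol hαβ hmem hnS hnC hf hf' hC hnS hf hf'
      (fun t θ => by
        refine ((((hE2 t).const_mul (1 / 2)).mul ((((((hasDerivAt_id t).pow 2).const_mul (b ^ 2)).add
          ((hasDerivAt_id t).const_mul (2 * a * b - b ^ 2))).add_const _).sub_const _ |>.add_const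
          _)).add_const _).congr_deriv ?_
        simp; ring)
      (fun t θ => by
        refine (((hasDerivAt_id θ).const_mul (2 * b)).const_add _).congr_deriv ?_
        ring)
      (fun t θ hθ => by
        obtain ⟨e1, e2⟩ := h t θ hθ
        simp only at e1 e2
        exact ⟨by rw [e1]; ring, by rw [e2]; ring⟩)
      (fun t θ => by
        have h1 := Real.sin_sq_add_cos_sq θ
        generalize Real.sin θ = s at *
        generalize Real.cos θ = c at *
        generalize Real.exp t = e at *
        clear h hp hu hsol hmem hS hC hE h0 hk hnS hnC hE2 hf hf'
        grind)
      (fun t θ => by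
        have h1 := Real.sin_sq_add_cos_sq θ
        generalize Real.sin θ = s at *
        generalize Real.cos θ = c at *
        generalize Real.exp t = e at *
        clear h hp hu hsol hmem hS hC hE h0 hk hnS hnC hE2 hf hf'
        grind)
    exact Or.inr (Or.inr (Or.inr (Or.inr (Or.inl ⟨a, b, C, fun t θ hθ =>
      ⟨h t θ hθ, by simpa using hP t θ hθ⟩⟩))))
  · obtain ⟨C, hP⟩ := pressure_eq
      (P := fun t θ => -a * b * (Real.exp t * Real.sin θ))
      hΩ hu hp hsol hαβ hmem (hk a) h0 (hk 1) h0 (fun x => (hC x).const_mul b)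
      (fun x => (hnS x).const_mul b) hE hE
      (fun t θ => ((hE t).mul_const _).const_mul _) (fun t θ => ((hS θ).const_mul _).const_mul _)
      (fun t θ hθ => by
        obtain ⟨e1, e2⟩ := h t θ hθ
        simp only at e1 e2
        exact ⟨by rw [e1]; ring, by rw [e2]; ring⟩)
      (fun t θ => by
        have h1 := Real.sin_sq_add_cos_sq θ
        linear_combination (a * b * Real.exp t ^ 2 * Real.sin θ) * h1)
      (fun t θ => by
        have h1 := Real.sin_sq_add_cos_sq θ
        linear_combination (a * b * Real.exp t ^ 2 * Real.cos θ) * h1)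
    exact Or.inr (Or.inr (Or.inr (Or.inr (Or.inr (Or.inl ⟨a, b, C, fun t θ hθ =>
      ⟨h t θ hθ, hP t θ hθ⟩⟩)))))
  · obtain ⟨C, hP⟩ := pressure_eq
      (P := fun t θ => -a * b * (Real.exp t * Real.cos θ))
      hΩ hu hp hsol hαβ hmem (fun x => (hS x).const_mul a)
      (fun x => (hC x).const_mul a) hE hE (hk b) h0 (hk 1) h0
      (fun t θ => ((hE t).mul_const _).const_mul _) (fun t θ => ((hC θ).const_mul _).const_mul _)
      (fun t θ hθ => by
        obtain ⟨e1, e2⟩ := h t θ hθ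
        simp only at e1 e2
        exact ⟨by rw [e1]; ring, by rw [e2]; ring⟩)
      (fun t θ => by
        have h1 := Real.sin_sq_add_cos_sq θ
        linear_combination (a * b * Real.exp t ^ 2 * Real.cos θ) * h1)
      (fun t θ => by
        have h1 := Real.sin_sq_add_cos_sq θ
        linear_combination (-a * b * Real.exp t ^ 2 * Real.sin θ) * h1)
    exact Or.inr (Or.inr (Or.inr (Or.inr (Or.inr (Or.inr ⟨a, b, C, fun t θ hθ =>
      ⟨h t θ hθ, hP t θ hθ⟩⟩)))))

end Pressure

/-! ### Geometry of sectors and of the slit plane -/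

section Geometry

lemma continuous_polar : Continuous fun y : ℝ × ℝ => polar y.1 y.2 := by
  unfold polar
  refine (PiLp.continuous_toLp 2 _).comp (continuous_pi fun i => ?_)
  fin_cases i
  · simp; fun_prop
  · simp; fun_prop

lemma exists_polar {z : Plane} (hz : z ≠ 0) :
    ∃ r θ : ℝ, 0 < r ∧ 0 ≤ θ ∧ θ < 2 * Real.pi ∧ z = polar r θ := by
  -- The argument of `-z` lies in `(-π, π]`, so adding `π` gives an angle of `z` in `(0, 2π]`; the
  -- value `2π` is then replaced by `0`.
  set w : ℂ := ⟨-z 0, -z 1⟩ with hw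
  have hw0 : w ≠ 0 := by
    intro h
    apply hz
    have h0 := congrArg Complex.re h
    have h1 := congrArg Complex.im h
    simp [hw] at h0 h1
    ext i; fin_cases i
    · simpa using h0
    · simpa using h1
  have hc := Complex.norm_mul_cos_arg w
  have hs := Complex.norm_mul_sin_arg w
  have e : z = polar ‖w‖ (w.arg + Real.pi) := by
    ext i; fin_cases i
    · simp only [polar, Real.cos_add_pi]; simp [hw]
    · simp only [polar, Real.sin_add_pi]; simp [hw]
  have h1 := Complex.neg_pi_lt_arg w
  have h2 := Complex.arg_le_pi w
  rcases h2.lt_or_eq with h2 | h2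
  · exact ⟨‖w‖, _, norm_pos_iff.2 hw0, by linarith, by linarith, e⟩
  · refine ⟨‖w‖, 0, norm_pos_iff.2 hw0, le_rfl, by positivity, ?_⟩
    rw [e, h2]
    simp [polar, ← two_mul]

lemma polar_zero (θ : ℝ) : polar 0 θ = 0 := by
  ext i; fin_cases i <;> simp [polar]

lemma polar_sq (r θ : ℝ) : polar r θ 0 ^ 2 + polar r θ 1 ^ 2 = r ^ 2 := by
  simp [polar]
  linear_combination r ^ 2 * Real.sin_sq_add_cos_sq θ

lemma polar_injective {r r' θ θ' : ℝ} (hr : 0 < r) (hr' : 0 < r') (hθ : 0 ≤ θ)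
    (hθ2 : θ < 2 * Real.pi) (hθ' : 0 ≤ θ') (hθ2' : θ' < 2 * Real.pi)
    (h : polar r θ = polar r' θ') : r = r' ∧ θ = θ' := by
  have hrr : r = r' := by
    have := polar_sq r θ
    rw [h, polar_sq r' θ'] at this
    exact ((sq_eq_sq₀ hr'.le hr.le).1 this).symm
  subst hrr
  refine ⟨rfl, ?_⟩
  have h0 := congrArg (fun z : Plane => z 0) h
  have h1 := congrArg (fun z : Plane => z 1) h
  simp [polar, hr.ne'] at h0 h1
  obtain ⟨k, hk⟩ := Real.Angle.angle_eq_iff_two_pi_dvd_sub.1 (Real.Angle.cos_sin_inj h0 h1)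
  have hpi := Real.pi_pos
  have hk1 : (-1 : ℝ) < k := by nlinarith
  have hk2 : (k : ℝ) < 1 := by nlinarith
  have hk0 : k = 0 := by
    have a : -1 < k := by exact_mod_cast hk1
    have b : k < 1 := by exact_mod_cast hk2
    omega
  rw [hk0] at hk
  simp at hk
  linarith

lemma isOpen_sector {α β : ℝ} (hα : 0 ≤ α) (hβ : β ≤ 2 * Real.pi) : IsOpen (sector α β) := by
  -- Turning the sector by `-π` moves the cut of `polarCoord` to the positive `x`-axis, outside the
  -- sector even when `β = 2π`.
  have hsub : Ioi (0 : ℝ) ×ˢ Ioo (α - Real.pi) (β - Real.pi) ⊆ polarCoord.target := by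
    rintro ⟨r, θ⟩ ⟨hr, h1, h2⟩
    simp only [polarCoord_target, mem_prod, mem_Ioi, mem_Ioo] at *
    exact ⟨hr, by linarith, by linarith⟩
  have ho := polarCoord.isOpen_image_symm_of_subset_target
    (isOpen_Ioi.prod isOpen_Ioo) hsub
  have hc : Continuous fun z : Plane => ((-z 0, -z 1) : ℝ × ℝ) := by fun_prop
  convert ho.preimage hc using 1
  ext z
  simp only [sector, mem_ofPred_eq, mem_preimage, mem_image, Prod.exists, mem_prod, mem_Ioi,
    mem_Ioo, polarCoord_symm_apply, Prod.mk.injEq]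
  constructor
  · rintro ⟨r, θ, hr, h1, h2, rfl⟩
    refine ⟨r, θ - Real.pi, ⟨hr, by linarith, by linarith⟩, ?_, ?_⟩
    · simp [polar, Real.cos_sub_pi]
    · simp [polar, Real.sin_sub_pi]
  · rintro ⟨r, θ, ⟨hr, h1, h2⟩, e0, e1⟩
    refine ⟨r, θ + Real.pi, hr, by linarith, by linarith, ?_⟩
    ext i; fin_cases i
    · simp [polar, Real.cos_add_pi, e0]
    · simp [polar, Real.sin_add_pi, e1]

lemma halfPlane_eq_sector : {z : Plane | 0 < z 1} = sector 0 Real.pi := by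
  have hpi := Real.pi_pos
  ext z
  constructor
  · intro hz
    have hz0 : z ≠ 0 := fun h => by simp [h] at hz
    obtain ⟨r, θ, hr, h0, h2, rfl⟩ := exists_polar hz0
    have hs : 0 < Real.sin θ := by
      have : 0 < r * Real.sin θ := by simpa [polar] using hz
      exact (mul_pos_iff_of_pos_left hr).1 this
    refine ⟨r, θ, hr, lt_of_le_of_ne h0 (fun h => by simp [← h] at hs), ?_, rfl⟩
    by_contra! h
    have := Real.sin_nonneg_of_nonneg_of_le_pi (x := θ - Real.pi) (by linarith) (by linarith)
    rw [Real.sin_sub_pi] at this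
    linarith
  · rintro ⟨r, θ, hr, h1, h2, rfl⟩
    have := mul_pos hr (Real.sin_pos_of_pos_of_lt_pi h1 h2)
    simpa [polar] using this

lemma polar_mem_sector {α β r θ : ℝ} (hα : 0 ≤ α) (hβ : β ≤ 2 * Real.pi) (hr : 0 < r) (h0 : 0 ≤ θ)
    (h2 : θ < 2 * Real.pi) (h : polar r θ ∈ sector α β) : θ ∈ Ioo α β := by
  obtain ⟨r', θ', hr', h1', h2', e⟩ := h
  obtain ⟨-, rfl⟩ := polar_injective hr hr' h0 h2 (by linarith) (by linarith) e
  exact ⟨h1', h2'⟩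

lemma zero_notMem_sector (α β : ℝ) : (0 : Plane) ∉ sector α β := by
  rintro ⟨r, θ, hr, -, -, e⟩
  have := polar_sq r θ
  rw [← e] at this
  simp at this
  exact hr.ne' ((pow_eq_zero_iff two_ne_zero).1 this.symm)

lemma sector_ne_univ (α β : ℝ) : sector α β ≠ univ := fun h =>
  zero_notMem_sector α β (h ▸ mem_univ _)

lemma polar_eq_logPolar {r : ℝ} (hr : 0 < r) (θ : ℝ) : polar r θ = logPolar (Real.log r) θ := by
  rw [logPolar, Real.exp_log hr]

lemma tendsto_logPolar (θ : ℝ) : Tendsto (fun t => logPolar t θ) atBot (𝓝 0) := by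
  have h : Tendsto (fun t => polar (Real.exp t) θ) atBot (𝓝 (polar 0 θ)) :=
    (continuous_polar.tendsto (0, θ)).comp (Real.tendsto_exp_atBot.prodMk_nhds tendsto_const_nhds)
  rwa [polar_zero] at h

lemma eq_endpoints_of_eqOn_Ioo {X : Type*} [TopologicalSpace X] [T2Space X] {f g : ℝ → X} {a b : ℝ}
    (hab : a < b) (hf : Continuous f) (hg : Continuous g) (h : ∀ x ∈ Ioo a b, f x = g x) :
    f a = g a ∧ f b = g b := by
  have := EqOn.closure h hf hg
  rw [closure_Ioo hab.ne] at this
  exact ⟨this (left_mem_Icc.2 hab.le), this (right_mem_Icc.2 hab.le)⟩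

/-- Identities between continuous functions proved off the closed positive `x`-axis extend to the
whole plane. -/
lemma dense_slitPlane : Dense (sector 0 (2 * Real.pi)) := by
  have hpi := Real.pi_pos
  intro z
  by_cases hz : z = 0
  · subst hz
    exact mem_closure_of_tendsto (tendsto_logPolar Real.pi)
      (Eventually.of_forall fun t => ⟨_, _, Real.exp_pos t, hpi, by linarith, rfl⟩)
  · obtain ⟨r, θ, hr, h0, h2, rfl⟩ := exists_polar hz
    rcases h0.eq_or_lt with h0 | h0
    · subst h0
      have hc : Tendsto (fun η => polar r η) (𝓝[>] 0) (𝓝 (polar r 0)) :=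
        ((continuous_polar.comp (Continuous.prodMk_right r)).tendsto 0).mono_left nhdsWithin_le_nhds
      refine mem_closure_of_tendsto hc ?_
      filter_upwards [Ioo_mem_nhdsGT h2] with η hη using ⟨r, η, hr, hη.1, hη.2, rfl⟩
    · exact subset_closure ⟨r, θ, hr, h0, h2, rfl⟩

end Geometry

/-! ### Sectors, and passage to the whole plane -/

section Final

variable {Ω : Set Plane} {u : Plane → Plane} {p : Plane → ℝ} {α β : ℝ}

lemma plane_ext {z w : Plane} (h0 : z 0 = w 0) (h1 : z 1 = w 1) : z = w := by
  ext i; fin_cases i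
  · exact h0
  · exact h1

/-- The classification in a sector. -/
lemma sector_classification (hα : 0 ≤ α) (hαβ : α < β) (hβ : β ≤ 2 * Real.pi)
    (hu : ContDiffOn ℝ 3 u (sector α β)) (hp : ContDiffOn ℝ 1 p (sector α β))
    (hu0 : ContinuousOn u (closure (sector α β))) (hsol : IsSolution (sector α β) u p)
    (hsep : HasSeparatedForm (sector α β) u) :
    TypeI (sector α β) u p ∨ TypeII (sector α β) u p ∨ TypeIII (sector α β) u p ∨
      TypeIV (sector α β) u p ∨ TypeV (sector α β) u p ∨
      ShearX (sector α β) u p ∨ ShearY (sector α β) u p := by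
  have hΩ := isOpen_sector hα hβ
  have hmem : ∀ t, ∀ θ ∈ Ioo α β, logPolar t θ ∈ sector α β := fun t θ hθ =>
    ⟨_, θ, Real.exp_pos t, hθ.1, hθ.2, rfl⟩
  -- Continuity up to the boundary enters only here, at the vertex.
  have hlim : ∀ θ ∈ Ioo α β, Tendsto (fun t => u (logPolar t θ)) atBot (𝓝 (u 0)) := by
    intro θ hθ
    have h0 : (0 : Plane) ∈ closure (sector α β) :=
      mem_closure_of_tendsto (tendsto_logPolar θ) (Eventually.of_forall fun t => hmem t θ hθ)
    exact (hu0 0 h0).tendsto.comp (tendsto_nhdsWithin_iff.2 ⟨tendsto_logPolar θ,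
      Eventually.of_forall fun t => subset_closure (hmem t θ hθ)⟩)
  obtain ⟨f, f', g, g', hfg⟩ := hsep
  have hfg' : ∀ t, ∀ θ ∈ Ioo α β, u (logPolar t θ) =
      !₂[f θ * g (Real.exp t), f' θ * g' (Real.exp t)] := fun t θ hθ =>
    hfg _ θ (Real.exp_pos t) (hα.trans hθ.1.le) (hθ.2.trans_le hβ) (hmem t θ hθ)
  have hcl := separated_classified (f := f) (f' := f') (g := fun t => g (Real.exp t)) (g' := fun t => g' (Real.exp t))
    hΩ hu hp hsol hαβ hmem hlim
    (fun t θ hθ => by rw [hfg' t θ hθ]; simp) (fun t θ hθ => by rw [hfg' t θ hθ]; simp)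
  have hz : ∀ {Q : Plane → Prop}, (∀ t, ∀ θ ∈ Ioo α β, Q (logPolar t θ)) →
      ∀ z ∈ sector α β, Q z := by
    rintro Q hQ z ⟨r, θ, hr, h1, h2, rfl⟩
    rw [polar_eq_logPolar hr]
    exact hQ _ θ ⟨h1, h2⟩
  have hz0 : ∀ t θ, logPolar t θ 0 = Real.exp t * Real.cos θ := fun t θ => by simp [logPolar, polar]
  have hz1 : ∀ t θ, logPolar t θ 1 = Real.exp t * Real.sin θ := fun t θ => by simp [logPolar, polar]
  have hr2 : ∀ t θ, logPolar t θ 0 ^ 2 + logPolar t θ 1 ^ 2 = Real.exp t ^ 2 := fun t θ =>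
    polar_sq _ _
  rcases classified_flow hΩ hu hp hsol hαβ hmem hcl with
    ⟨a, b, k, h⟩ | ⟨a, b, c, k, h⟩ | ⟨a, b, c, d, k, k1, k2, h⟩ | ⟨a, b, lam, k, hlam, h⟩ |
    ⟨a, b, k, h⟩ | ⟨a, b, k, h⟩ | ⟨a, b, k, h⟩
  · refine Or.inl ⟨a, b, k, hz fun t θ hθ => ⟨plane_ext ?_ ?_, (h t θ hθ).2⟩⟩
    · simpa using (h t θ hθ).1.1
    · simpa using (h t θ hθ).1.2
  · refine Or.inr (Or.inl ⟨a, b, c, k, hz fun t θ hθ => ⟨plane_ext ?_ ?_, ?_⟩⟩)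
    · rw [(h t θ hθ).1.1, hz0, hz1]; simp; ring
    · rw [(h t θ hθ).1.2, hz0, hz1]; simp; ring
    · rw [hr2]; exact (h t θ hθ).2
  · refine Or.inr (Or.inr (Or.inl ⟨a, b, c, d, k, k1, k2, hz fun t θ hθ =>
      ⟨plane_ext ?_ ?_, ?_⟩⟩))
    · rw [(h t θ hθ).1.1, hz0, hz1]; simp; ring
    · rw [(h t θ hθ).1.2, hz0, hz1]; simp; ring
    · rw [hr2, (h t θ hθ).2, hz0, hz1]; ring
  · refine Or.inr (Or.inr (Or.inr (Or.inl ⟨a, b, k, lam, fun h => absurd h (sector_ne_univ _ _),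
      fun _ => hlam, fun r θ hr h0 h2 hm => ?_⟩)))
    rcases hr.eq_or_lt with hr | hr
    · rw [← hr, polar_zero] at hm
      exact absurd hm (zero_notMem_sector _ _)
    have hθ := polar_mem_sector hα hβ hr h0 h2 hm
    have e1 : r ^ lam = Real.exp (lam * Real.log r) := by
      rw [Real.rpow_def_of_pos hr, mul_comm]
    have e2 : r ^ (2 * lam) = Real.exp (lam * Real.log r) ^ 2 := by
      rw [← e1, ← Real.rpow_natCast, ← Real.rpow_mul hr.le]
      push_cast
      rw [mul_comm]
    rw [e1, e2, polar_eq_logPolar hr]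
    refine ⟨plane_ext ?_ ?_, (h _ θ hθ).2⟩
    · simpa using (h _ θ hθ).1.1
    · simpa using (h _ θ hθ).1.2
  · refine Or.inr (Or.inr (Or.inr (Or.inr (Or.inl ⟨sector_ne_univ _ _, a, b, k,
      fun r θ hr h0 h2 hm => ?_⟩))))
    have hθ := polar_mem_sector hα hβ hr h0 h2 hm
    have := h (Real.log r) θ hθ
    rw [← polar_eq_logPolar hr, Real.exp_log hr] at this
    refine ⟨plane_ext ?_ ?_, this.2⟩
    · rw [this.1.1]; simp
    · rw [this.1.2]; simp
  · refine Or.inr (Or.inr (Or.inr (Or.inr (Or.inr (Or.inl ⟨a, b, k, hz fun t θ hθ =>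
      ⟨plane_ext ?_ ?_, ?_⟩⟩)))))
    · simpa using (h t θ hθ).1.1
    · rw [(h t θ hθ).1.2, hz0]; simp
    · rw [(h t θ hθ).2, hz1]
  · refine Or.inr (Or.inr (Or.inr (Or.inr (Or.inr (Or.inr ⟨a, b, k, hz fun t θ hθ =>
      ⟨plane_ext ?_ ?_, ?_⟩⟩)))))
    · rw [(h t θ hθ).1.1, hz1]; simp
    · simpa using (h t θ hθ).1.2
    · rw [(h t θ hθ).2, hz0]

lemma eq_of_eqOn_slitPlane (hu : Continuous u) (hp : Continuous p) {U : Plane → Plane}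
    {P : Plane → ℝ} (hU : Continuous U) (hP : Continuous P)
    (h : ∀ z ∈ sector 0 (2 * Real.pi), u z = U z ∧ p z = P z) (z : Plane) :
    u z = U z ∧ p z = P z :=
  ⟨congrFun (hu.ext_on dense_slitPlane hU fun z hz => (h z hz).1) z,
    congrFun (hp.ext_on dense_slitPlane hP fun z hz => (h z hz).2) z⟩

lemma continuous_plane_mk {f g : Plane → ℝ} (hf : Continuous f) (hg : Continuous g) :
    Continuous fun z => (!₂[f z, g z] : Plane) := by
  refine (PiLp.continuous_toLp 2 _).comp (continuous_pi fun i => ?_)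
  fin_cases i
  · exact hf
  · exact hg

lemma typeI_univ (hu : Continuous u) (hp : Continuous p)
    (h : TypeI (sector 0 (2 * Real.pi)) u p) : TypeI univ u p := by
  obtain ⟨a, b, k, h⟩ := h
  exact ⟨a, b, k, fun z _ => eq_of_eqOn_slitPlane hu hp continuous_const continuous_const h z⟩

lemma typeII_univ (hu : Continuous u) (hp : Continuous p)
    (h : TypeII (sector 0 (2 * Real.pi)) u p) : TypeII univ u p := by
  obtain ⟨a, b, c, k, h⟩ := h
  exact ⟨a, b, c, k, fun z _ => eq_of_eqOn_slitPlane hu hp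
    (continuous_plane_mk (by fun_prop) (by fun_prop)) (by fun_prop) h z⟩

lemma typeIII_univ (hu : Continuous u) (hp : Continuous p)
    (h : TypeIII (sector 0 (2 * Real.pi)) u p) : TypeIII univ u p := by
  obtain ⟨a, b, c, d, k, k1, k2, h⟩ := h
  exact ⟨a, b, c, d, k, k1, k2, fun z _ => eq_of_eqOn_slitPlane hu hp
    (continuous_plane_mk (by fun_prop) (by fun_prop)) (by fun_prop) h z⟩

lemma shearX_univ (hu : Continuous u) (hp : Continuous p)
    (h : ShearX (sector 0 (2 * Real.pi)) u p) : ShearX univ u p := by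
  obtain ⟨a, b, k, h⟩ := h
  exact ⟨a, b, k, fun z _ => eq_of_eqOn_slitPlane hu hp
    (continuous_plane_mk (by fun_prop) (by fun_prop)) (by fun_prop) h z⟩

lemma shearY_univ (hu : Continuous u) (hp : Continuous p)
    (h : ShearY (sector 0 (2 * Real.pi)) u p) : ShearY univ u p := by
  obtain ⟨a, b, k, h⟩ := h
  exact ⟨a, b, k, fun z _ => eq_of_eqOn_slitPlane hu hp
    (continuous_plane_mk (by fun_prop) (by fun_prop)) (by fun_prop) h z⟩

/-- The term `2 C₂ θ` of the pressure jumps by `4 π C₂` across the slit, so continuity gives `C₂ =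
0` and a rigid rotation remains. -/
lemma typeV_univ (hu : Continuous u) (hp : Continuous p)
    (h : TypeV (sector 0 (2 * Real.pi)) u p) : TypeII univ u p := by
  have hpi := Real.pi_pos
  obtain ⟨-, a, b, k, h⟩ := h
  have hb : b = 0 := by
    obtain ⟨e1, e2⟩ := eq_endpoints_of_eqOn_Ioo (f := fun η => p (polar 1 η))
      (g := fun η => 1 / 2 * (a ^ 2 - a * b + 1 / 2 * b ^ 2) + 2 * b * η + k)
      (show (0 : ℝ) < 2 * Real.pi by positivity)
      (hp.comp (continuous_polar.comp (Continuous.prodMk_right 1))) (by fun_prop)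
      (fun η hη => by
        rw [(h 1 η one_pos hη.1.le hη.2 ⟨1, η, one_pos, hη.1, hη.2, rfl⟩).2]
        simp)
    have e3 : polar 1 (2 * Real.pi) = polar 1 0 := by simp [polar]
    simp only [e3, e1] at e2
    have : b * Real.pi = 0 := by linarith
    exact (mul_eq_zero.1 this).resolve_right hpi.ne'
  subst hb
  refine typeII_univ hu hp ⟨0, -a, a, k, ?_⟩
  rintro z ⟨r, θ, hr, h1, h2, rfl⟩
  obtain ⟨e1, e2⟩ := h r θ hr h1.le h2 ⟨r, θ, hr, h1, h2, rfl⟩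
  rw [e1, e2, polar_sq]
  refine ⟨plane_ext ?_ ?_, by ring⟩
  · simp [polar]
  · simp [polar]

/-- Continuity of `u` across the slit at `r = 1` says that the rotation by `2 π lam` fixes the
vector of amplitudes. Either the amplitudes vanish, leaving a fluid at rest, or `lam` is an integer,
and being positive and different from `1` and `2` it is at least `3`. -/
lemma typeIV_univ (hu : Continuous u) (hp : Continuous p)
    (h : TypeIV (sector 0 (2 * Real.pi)) u p) : TypeI univ u p ∨ TypeIV univ u p := by
  have hpi := Real.pi_pos
  have h2pi : (0 : ℝ) < 2 * Real.pi := by positivity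
  obtain ⟨a, b, k, lam, -, hlam, h⟩ := h
  have hlam := hlam (sector_ne_univ _ _)
  have hpos : 0 < lam := by
    rcases hlam with (h | h) | h
    · exact h.1
    · exact one_pos.trans h.1
    · exact two_pos.trans h
  have hcu : ∀ r, Continuous fun η => u (polar r η) := fun r =>
    hu.comp (continuous_polar.comp (Continuous.prodMk_right r))
  have hcp : ∀ r, Continuous fun η => p (polar r η) := fun r =>
    hp.comp (continuous_polar.comp (Continuous.prodMk_right r))
  have hang : Continuous fun η => (!₂[a * Real.cos (lam * η) + b * Real.sin (lam * η),
      b * Real.cos (lam * η) - a * Real.sin (lam * η)] : Plane) := by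
    refine (PiLp.continuous_toLp 2 _).comp (continuous_pi fun i => ?_)
    fin_cases i
    · simp; fun_prop
    · simp; fun_prop
  have hsl : ∀ r η, 0 < r → η ∈ Ioo 0 (2 * Real.pi) → polar r η ∈ sector 0 (2 * Real.pi) :=
    fun r η hr hη => ⟨r, η, hr, hη.1, hη.2, rfl⟩
  have hend : ∀ r : ℝ, 0 < r → _ := fun r hr => eq_endpoints_of_eqOn_Ioo h2pi (hcu r)
    (hang.const_smul (r ^ lam)) fun η hη => (h r η hr.le hη.1.le hη.2 (hsl r η hr hη)).1
  have hendp : ∀ r : ℝ, 0 < r → _ := fun r hr => eq_endpoints_of_eqOn_Ioo h2pi (hcp r)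
    (continuous_const (y := -(1 / 2) * (a ^ 2 + b ^ 2) * r ^ (2 * lam) + k)) fun η hη =>
    (h r η hr.le hη.1.le hη.2 (hsl r η hr hη)).2
  obtain ⟨e1, e2⟩ := hend 1 one_pos
  have e3 : polar 1 (2 * Real.pi) = polar 1 0 := by simp [polar]
  rw [e3, e1] at e2
  have e0 := congrArg (fun z : Plane => z 0) e2
  have e1 := congrArg (fun z : Plane => z 1) e2
  simp at e0 e1
  have hK : (a ^ 2 + b ^ 2) * (1 - Real.cos (lam * (2 * Real.pi))) = 0 := by
    linear_combination a * e0 + b * e1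
  rcases mul_eq_zero.1 hK with h0 | h1
  · left
    have ha : a = 0 := by nlinarith [sq_nonneg a, sq_nonneg b]
    have hb : b = 0 := by nlinarith [sq_nonneg a, sq_nonneg b]
    subst ha hb
    refine typeI_univ hu hp ⟨0, 0, k, ?_⟩
    rintro z ⟨r, θ, hr, h1, h2, rfl⟩
    obtain ⟨e1, e2⟩ := h r θ hr.le h1.le h2 (hsl r θ hr ⟨h1, h2⟩)
    rw [e1, e2]
    exact ⟨plane_ext (by simp) (by simp), by simp⟩
  · right
    obtain ⟨n, hn⟩ := (Real.cos_eq_one_iff _).1 (sub_eq_zero.1 h1).symm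
    have hln : lam = n := by
      have : ((n : ℝ) - lam) * (2 * Real.pi) = 0 := by linarith
      have := (mul_eq_zero.1 this).resolve_right h2pi.ne'
      linarith
    have hn3 : 3 ≤ n := by
      rw [hln] at hlam hpos
      have hn0 : 0 < n := by exact_mod_cast hpos
      by_contra! hcon
      have : n = 1 ∨ n = 2 := by omega
      rcases this with rfl | rfl <;> norm_num at hlam
    refine ⟨a, b, k, lam, fun _ => ⟨n.toNat, by omega, ?_⟩, fun h => absurd rfl h, ?_⟩
    · rw [hln]
      have : ((n.toNat : ℤ) : ℝ) = n := by rw [Int.toNat_of_nonneg (by omega)]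
      exact_mod_cast this.symm
    intro r θ hr h0 h2 _
    rcases hr.eq_or_lt with hr | hr
    -- The value at the origin is the limit along the negative `x`-axis, the ray `θ = π` inside the
    -- slit plane.
    · subst hr
      have hrad : Continuous fun r => polar r Real.pi := continuous_polar.comp (Continuous.prodMk_left _)
      have hz := (eq_endpoints_of_eqOn_Ioo (one_pos (α := ℝ)) (hu.comp hrad)
        ((Real.continuous_rpow_const hpos.le).smul continuous_const) fun r hr' =>
          (h r Real.pi hr'.1.le hpi.le (by linarith) (hsl r _ hr'.1 ⟨hpi, by linarith⟩)).1).1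
      have hzp := (eq_endpoints_of_eqOn_Ioo (one_pos (α := ℝ)) (hp.comp hrad)
        (((Real.continuous_rpow_const (by positivity : 0 ≤ 2 * lam)).const_mul _).add continuous_const)
        fun r hr' =>
          (h r Real.pi hr'.1.le hpi.le (by linarith) (hsl r _ hr'.1 ⟨hpi, by linarith⟩)).2).1
      simp only [Function.comp, polar_zero] at hz hzp
      rw [polar_zero, hz, hzp]
      simp [Real.zero_rpow hpos.ne']
    · rcases h0.eq_or_lt with h0 | h0
      · subst h0
        exact ⟨(hend r hr).1, (hendp r hr).1⟩
      · exact h r θ hr.le h0.le h2 (hsl r θ hr ⟨h0, h2⟩)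

lemma HasSeparatedForm.mono {Ω' : Set Plane} (h : HasSeparatedForm Ω u) (hs : Ω' ⊆ Ω) :
    HasSeparatedForm Ω' u := by
  obtain ⟨a, b, c, d, h⟩ := h
  exact ⟨a, b, c, d, fun r θ h0 h1 h2 hm => h r θ h0 h1 h2 (hs hm)⟩

lemma IsSolution.mono {Ω' : Set Plane} (h : IsSolution Ω u p) (hs : Ω' ⊆ Ω) :
    IsSolution Ω' u p :=
  ⟨fun z hz => h.momentum z (hs hz), fun z hz => h.incompressible z (hs hz)⟩

end Final

end SteadyNS

theorem theorem2 (Ω : Set SteadyNS.Plane) (hΩ : SteadyNS.IsConeLike Ω)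
    (u : SteadyNS.Plane → SteadyNS.Plane) (p : SteadyNS.Plane → ℝ)
    (hu : ContDiffOn ℝ 3 u Ω) (hp : ContDiffOn ℝ 1 p Ω)
    (hu0 : ContinuousOn u (closure Ω))
    (hsol : SteadyNS.IsSolution Ω u p)
    (hsep : SteadyNS.HasSeparatedForm Ω u) :
    SteadyNS.TypeI Ω u p ∨ SteadyNS.TypeII Ω u p ∨ SteadyNS.TypeIII Ω u p ∨
      SteadyNS.TypeIV Ω u p ∨ SteadyNS.TypeV Ω u p ∨
      SteadyNS.ShearX Ω u p ∨ SteadyNS.ShearY Ω u p := by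
  have hpi := Real.pi_pos
  rcases hΩ with rfl | rfl | ⟨α, β, hα, hαβ, hβ, rfl⟩
  -- The plane is restricted to the slit plane, where angles in `(0, 2π)` are single valued, and
  -- each type is then extended by continuity.
  · have hs := Set.subset_univ (SteadyNS.sector 0 (2 * Real.pi))
    have huc : Continuous u := continuousOn_univ.1 hu.continuousOn
    have hpc : Continuous p := continuousOn_univ.1 hp.continuousOn
    rcases SteadyNS.sector_classification le_rfl (by positivity) le_rfl (hu.mono hs) (hp.mono hs)
      huc.continuousOn (hsol.mono hs) (hsep.mono hs) with h | h | h | h | h | h | h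
    · exact Or.inl (SteadyNS.typeI_univ huc hpc h)
    · exact Or.inr (Or.inl (SteadyNS.typeII_univ huc hpc h))
    · exact Or.inr (Or.inr (Or.inl (SteadyNS.typeIII_univ huc hpc h)))
    · rcases SteadyNS.typeIV_univ huc hpc h with h | h
      · exact Or.inl h
      · exact Or.inr (Or.inr (Or.inr (Or.inl h)))
    · exact Or.inr (Or.inl (SteadyNS.typeV_univ huc hpc h))
    · exact Or.inr (Or.inr (Or.inr (Or.inr (Or.inr (Or.inl (SteadyNS.shearX_univ huc hpc h))))))
    · exact Or.inr (Or.inr (Or.inr (Or.inr (Or.inr (Or.inr (SteadyNS.shearY_univ huc hpc h))))))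
  · rw [SteadyNS.halfPlane_eq_sector] at *
    exact SteadyNS.sector_classification le_rfl hpi (by linarith) hu hp hu0 hsol hsep
  · exact SteadyNS.sector_classification hα hαβ hβ hu hp hu0 hsol hsep
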